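/- **Conventions.** $g_{\mu\rho}=\mathrm{diag}(1,-1,-1,-1)$; $\epsilon_{ab}=-\epsilon^{ab}$, $\epsilon_{12}=1$, $\psi^a=\epsilon^{ab}\psi_b$ (likewise for barred indices); $\sigma^0=\mathbf 1$ and $\sigma^{1,2,3}$ are the Pauli matrices, with entries $\sigma^\mu_{a\bar b}$; $\theta\psi=\theta^a\psi_a$, $\bar\theta\bar\psi=\bar\theta_{\bar a}\bar\psi^{\bar a}$, $\theta^2=\theta\theta$, $\bar\theta^2=\bar\theta\bar\theta$, $\theta\sigma^\mu\bar\theta=\theta^a\sigma^\mu_{a\bar b}\bar\theta^{\bar b}$. For $m\ge 0$, $D_m(x)=\frac{i}{(2\pi)^3}\int d^4p\,\delta(p^2-m^2)\,\mathrm{sgn}(p^0)\,e^{-ip\cdot x}$ is the Pauli–Jordan distribution. **Setting.** On a dense domain of a Hilbert space, equipped with a non-degenerate Hermitian (possibly indefinite) form, with $\dagger$ the adjoint with respect to this form, let the following free fields of one mass $m\ge 0$ be given as operator-valued tempered distributions: Hermitian scalar fields $b^{(j)}$ $(1\le j\le s)$, a Hermitian vector field $b_\mu$, and spinor fields $f^{(A)}_a$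 $(1\le A\le n)$ with $\bar f^{(A)}_{\bar a}=(f^{(A)}_a)^\dagger$. The bosonic fields satisfy the Klein–Gordon equation, and the spinors satisfy $$i\sigma^\mu_{a\bar b}\partial_\mu\bar f^{(A)\bar b}=m f^{(A)}_a,\qquad -i\sigma^\mu_{a\bar b}\partial_\mu f^{(A)a}=m\bar f^{(A)}_{\bar b}.$$ Their (anti)commutators are $$[b^{(j)}(x),b^{(k)}(y)]=-i\delta_{jk}D_m(x-y),\qquad [b_\mu(x),b_\rho(y)]=ig_{\mu\rho}D_m(x-y),$$ $$\{f^{(A)}_a(x),f^{(B)}_b(y)\}=i\delta_{AB}\epsilon_{ab}\,m\,D_m(x-y),\qquad \{f^{(A)}_a(x),\bar f^{(B)}_{\bar b}(y)\}=\delta_{AB}\sigma^\mu_{a\bar b}\partial_\mu D_m(x-y),$$ and the fields $b^{(j)}$, $b_\mu$, $f^{(A)}$ of different type commute. Let $Q_a$, $\bar Q_{\bar a}=(Q_a)^\dagger$ be supercharges: they are fermionic operators that annihilate the vacuum and satisfy $\{Q_a,Q_b\}=0$, $\{Q_a,\bar Q_{\bar b}\}=2\sigma^\mu_{a\bar b}P_\mu$,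 $[Q_a,P_\mu]=0$, where $[P_\mu,\,\cdot\,]=-i\partial_\mu$ on all the free fields. Let $C=\sum_j\gamma_j b^{(j)}$ with $\vec\gamma\in\mathbb R^s$, $\vec\gamma\ne 0$. Let $V=WCW^{-1}$ with $W=\exp(i\theta^aQ_a-i\bar\theta^{\bar a}\bar Q_{\bar a})$, where the Grassmann parameters $\theta_a,\bar\theta_{\bar a}$ anticommute with all fermionic operators. Suppose that $$V=C+\theta\chi+\bar\theta\bar\chi+\theta^2\phi+\bar\theta^2\phi^\dagger+(\theta\sigma^\mu\bar\theta)v_\mu+\theta^2\,\bar\theta\bar\lambda+\bar\theta^2\,\theta\lambda+\theta^2\bar\theta^2 d,$$ with component fields, for complex coefficients, $$\chi=\sum_A\alpha_Af^{(A)},\quad \lambda=\sum_A\beta_Af^{(A)},\quad d=\sum_j\delta_jb^{(j)}+\delta_0\partial^\mu b_\mu,\quad \phi=\sum_j\rho_jb^{(j)}+\rho_0\partial^\mu b_\mu,\quad v_\mu=\tau_0b_\mu+\sum_j\tau_j\partial_\mu b^{(j)},$$ where $\bar\chi_{\bar a}=(\chi_a)^\dagger$ and $\bar\lambda_{\bar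 a}=(\lambda_a)^\dagger$. **Theorem.** (i) If $m=0$, then $\{\lambda_a(x),\bar\lambda_{\bar b}(y)\}=0$, and hence $\lambda=0$. Consequently the vector multiplet, in which $\lambda\neq 0$, exists only for $m>0$. (ii) If $m>0$ and $C$ is normalised by $\sum_j\gamma_j^2=1$, then there are $\alpha\in\mathbb R$ and $\beta\in\mathbb C$ such that, with $D_m$ and its derivatives taken at $x-y$, $$[C(x),C(y)]=-iD_m,\quad [C(x),d(y)]=-i\alpha D_m,\quad [C(x),\phi(y)]=\beta D_m,$$ $$[\phi(x),\phi^\dagger(y)]=-i\left(\alpha+\tfrac{m^2}{4}\right)D_m,\quad [\phi(x),d(y)]=\tfrac{m^2\beta}{4}D_m,\quad [\phi(x),v_\mu(y)]=i\beta\,\partial_\mu D_m,$$ $$[d(x),d(y)]=-\tfrac{im^4}{16}D_m,\quad [v_\mu(x),v_\rho(y)]=i\partial_\mu\partial_\rho D_m+i\left(\tfrac{m^2}{2}-2\alpha\right)g_{\mu\rho}D_m,$$ $$\{\chi_a(x),\chi_b(y)\}=2\beta\epsilon_{ab}D_m,\quad \{\chi_a(x),\bar\chi_{\bar b}(y)\}=\sigma^\mu_{a\bar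 b}\partial_\mu D_m,$$ $$\{\lambda_a(x),\lambda_b(y)\}=-\tfrac{m^2\bar\beta}{2}\epsilon_{ab}D_m,\quad \{\lambda_a(x),\bar\lambda_{\bar b}(y)\}=\tfrac{m^2}{4}\sigma^\mu_{a\bar b}\partial_\mu D_m,$$ $$\{\chi_a(x),\lambda_b(y)\}=-2i\alpha\,\epsilon_{ab}D_m,\quad \{\chi_a(x),\bar\lambda_{\bar b}(y)\}=i\beta\,\sigma^\mu_{a\bar b}\partial_\mu D_m.$$ All other (anti)commutators, apart from those obtained from these by taking adjoints or exchanging the two fields, vanish. The parameters satisfy $$|\alpha|\le\frac{m^2}{4},\qquad |\beta|\le\frac m2,\qquad |\mathrm{Im}\,\beta|\le\frac m4+\frac{\alpha}{m}.$$ -/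

import Mathlib

open scoped SchwartzMap LineDeriv TensorProduct ComplexConjugate
open MeasureTheory

noncomputable section

namespace SuperVector

/-! ### Minkowski space, index conventions, the Pauli–Jordan distribution -/

/-- Minkowski space with coordinates `x⁰, x¹, x², x³`. -/
abbrev Spacetime := EuclideanSpace ℝ (Fin 4)

/-- Real test functions. A (possibly non-Hermitian) field is determined by its values on them. -/
abbrev TestFn := 𝓢(Spacetime, ℝ)

/-- The Minkowski metric `g_{μρ} = g^{μρ}`, with diagonal `1, -1, -1, -1`. -/
def metric (μ ρ : Fin 4) : ℝ := if μ = ρ then (if μ = 0 then 1 else -1) else 0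

/-- The spinor metric `ε_{ab}` with lower indices, `ε_{12} = 1`. -/
def epsLow : Matrix (Fin 2) (Fin 2) ℂ := !![0, 1; -1, 0]

/-- The spinor metric `ε^{ab} = -ε_{ab}` with upper indices. -/
def epsUp : Matrix (Fin 2) (Fin 2) ℂ := -epsLow

/-- The Pauli matrices `σ^μ_{a b̄}`, with `σ⁰ = 1`. -/
def pauli : Fin 4 → Matrix (Fin 2) (Fin 2) ℂ :=
  ![1, !![0, 1; 1, 0], !![0, -Complex.I; Complex.I, 0], !![1, 0; 0, -1]]

/-- Raising a spinor index: `ψ^a = ε^{ab} ψ_b` (the same for barred indices). -/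
def raise {M : Type*} [AddCommGroup M] [Module ℂ M] (ψ : Fin 2 → M) (a : Fin 2) : M :=
  ∑ b, epsUp a b • ψ b

/-- The partial derivative `∂_μ = ∂/∂x^μ` on test functions. -/
def pd (μ : Fin 4) : TestFn →ₗ[ℝ] TestFn :=
  (LineDeriv.lineDerivOpCLM ℝ TestFn (EuclideanSpace.single μ (1 : ℝ))).toLinearMap

/-- The energy `ω_p = √(|p|² + m²)`. -/
def energy (m : ℝ) (p : EuclideanSpace ℝ (Fin 3)) : ℝ := √(‖p‖ ^ 2 + m ^ 2)

/-- The Minkowski product `ω_p x⁰ - p ⬝ x` of the mass-shell momentum `(ω_p, p)` with `x`. -/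
def shellPhase (m : ℝ) (p : EuclideanSpace ℝ (Fin 3)) (x : Spacetime) : ℝ :=
  energy m p * x 0 - ∑ i : Fin 3, p i * x i.succ

/-- The Pauli–Jordan distribution
`D_m(x) = i (2π)⁻³ ∫ d⁴p δ(p² - m²) sgn(p⁰) e^{-ipx} = (2π)⁻³ ∫ d³p ω_p⁻¹ sin(ω_p x⁰ - p ⬝ x)`,
as the kernel `D_m(x - y)` smeared with `f(x)` and `g(y)`. -/
def pauliJordan (m : ℝ) (f g : TestFn) : ℝ :=
  ((2 * Real.pi) ^ 3)⁻¹ * ∫ p : EuclideanSpace ℝ (Fin 3), (energy m p)⁻¹ *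
    ∫ x : Spacetime, ∫ y : Spacetime, f x * g y * Real.sin (shellPhase m p (x - y))

/-- Smeared two-point kernels `K(x, y)`. -/
abbrev Kernel := TestFn → TestFn → ℂ

/-- The kernel `D_m(x - y)`. -/
def kerD (m : ℝ) : Kernel := fun f g => (pauliJordan m f g : ℂ)

/-- The kernel `(∂_μ D_m)(x - y)`. -/
def kerdD (m : ℝ) (μ : Fin 4) : Kernel := fun f g => -(pauliJordan m (pd μ f) g : ℂ)

/-- The kernel `(∂_μ ∂_ρ D_m)(x - y)`. -/
def kerddD (m : ℝ) (μ ρ : Fin 4) : Kernel := fun f g => (pauliJordan m (pd μ (pd ρ f)) g : ℂ)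

/-- The kernel `σ^μ_{a b̄} (∂_μ D_m)(x - y)`. -/
def kerSigmaD (m : ℝ) (a b : Fin 2) : Kernel := ∑ μ, pauli μ a b • kerdD m μ

/-! ### State space, operators and fields -/

variable {H : Type*} [NormedAddCommGroup H] [InnerProductSpace ℂ H]

/-- The state space: a Hilbert space `H`, with a dense domain on which all operators act, a
non-degenerate Hermitian (in general indefinite) sesquilinear form `⟨·,·⟩` on the domain, the
operator `(-1)^F` (`F` the fermion number), and the vacuum. -/
structure StateSpace (H : Type*) [NormedAddCommGroup H] [InnerProductSpace ℂ H] where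
  dom : Submodule ℂ H
  dense : Dense (dom : Set H)
  form : dom →ₗ⋆[ℂ] dom →ₗ[ℂ] ℂ
  form_conj : ∀ x y, conj (form x y) = form y x
  form_nondeg : ∀ x, (∀ y, form x y = 0) → x = 0
  parity : Module.End ℂ dom
  parity_sq : parity * parity = 1
  vacuum : dom
  vacuum_ne_zero : vacuum ≠ 0

namespace StateSpace

variable (𝒬 : StateSpace H)

/-- Operators on the common invariant domain. -/
abbrev Op := Module.End ℂ 𝒬.dom

/-- Operator-valued distributions. -/
abbrev Field := TestFn →ₗ[ℝ] 𝒬.Op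

variable {𝒬}

/-- `B = A†`, the adjoint being taken with respect to the form `⟨·,·⟩`. -/
def IsAdjoint (A B : 𝒬.Op) : Prop := ∀ x y, 𝒬.form (A x) y = 𝒬.form x (B y)

def IsEven (A : 𝒬.Op) : Prop := 𝒬.parity * A = A * 𝒬.parity

def IsOdd (A : 𝒬.Op) : Prop := 𝒬.parity * A = -(A * 𝒬.parity)

/-- Matrix elements are tempered distributions. -/
def IsTempered (φ : 𝒬.Field) : Prop :=
  ∀ x y : 𝒬.dom, Continuous fun f : TestFn => inner ℂ (x : H) (φ f y : H)

/-- `∂_μ φ`, in the sense of distributions. -/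
def fieldDeriv (μ : Fin 4) (φ : 𝒬.Field) : 𝒬.Field := -(φ ∘ₗ pd μ)

/-- `∂^μ v_μ`. -/
def div (v : Fin 4 → 𝒬.Field) : 𝒬.Field := ∑ μ, ∑ ρ, (metric μ ρ : ℂ) • fieldDeriv μ (v ρ)

/-- The Klein–Gordon equation `(∂² + m²) φ = 0`. -/
def KleinGordon (m : ℝ) (φ : 𝒬.Field) : Prop :=
  (∑ μ, ∑ ρ, (metric μ ρ : ℂ) • fieldDeriv μ (fieldDeriv ρ φ)) + ((m ^ 2 : ℝ) : ℂ) • φ = 0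

/-- `[φ(x), ψ(y)] = K(x, y) 1`. -/
def Comm (φ ψ : 𝒬.Field) (K : Kernel) : Prop :=
  ∀ f g, φ f * ψ g - ψ g * φ f = K f g • (1 : 𝒬.Op)

/-- `{φ(x), ψ(y)} = K(x, y) 1`. -/
def Anticomm (φ ψ : 𝒬.Field) (K : Kernel) : Prop :=
  ∀ f g, φ f * ψ g + ψ g * φ f = K f g • (1 : 𝒬.Op)

end StateSpace

open StateSpace

/-- Free fields of mass `m`: real scalar fields `b^{(j)}`, a real vector field `b_μ`, and Majorana
fields `f^{(A)}_a`, `f̄^{(A)}_ā = (f^{(A)}_a)†` of spin `1/2`. -/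
structure FreeFields (𝒬 : StateSpace H) (m : ℝ) (s n : ℕ) where
  b : Fin s → 𝒬.Field
  bv : Fin 4 → 𝒬.Field
  f : Fin n → Fin 2 → 𝒬.Field
  fbar : Fin n → Fin 2 → 𝒬.Field
  b_tempered : ∀ j, IsTempered (b j)
  bv_tempered : ∀ μ, IsTempered (bv μ)
  f_tempered : ∀ A a, IsTempered (f A a)
  fbar_tempered : ∀ A a, IsTempered (fbar A a)
  b_even : ∀ j h, IsEven (b j h)
  bv_even : ∀ μ h, IsEven (bv μ h)
  f_odd : ∀ A a h, IsOdd (f A a h)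
  fbar_odd : ∀ A a h, IsOdd (fbar A a h)
  -- hermiticity
  b_adj : ∀ j h, IsAdjoint (b j h) (b j h)
  bv_adj : ∀ μ h, IsAdjoint (bv μ h) (bv μ h)
  f_adj : ∀ A a h, IsAdjoint (f A a h) (fbar A a h)
  -- equations of motion
  b_kg : ∀ j, KleinGordon m (b j)
  bv_kg : ∀ μ, KleinGordon m (bv μ)
  dirac : ∀ A a, Complex.I • ∑ μ, ∑ c, pauli μ a c • fieldDeriv μ (raise (fbar A) c)
    = (m : ℂ) • f A a
  dirac_bar : ∀ A c, (-Complex.I) • ∑ μ, ∑ a, pauli μ a c • fieldDeriv μ (raise (f A) a)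
    = (m : ℂ) • fbar A c
  -- causal (anti)commutation relations
  b_b : ∀ j k, Comm (b j) (b k) (if j = k then (-Complex.I) • kerD m else 0)
  bv_bv : ∀ μ ρ, Comm (bv μ) (bv ρ) ((Complex.I * metric μ ρ) • kerD m)
  f_f : ∀ A B a c, Anticomm (f A a) (f B c)
    (if A = B then (Complex.I * epsLow a c * m) • kerD m else 0)
  f_fbar : ∀ A B a c, Anticomm (f A a) (fbar B c) (if A = B then kerSigmaD m a c else 0)
  b_bv : ∀ j μ, Comm (b j) (bv μ) 0
  b_f : ∀ j A a, Comm (b j) (f A a) 0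
  b_fbar : ∀ j A a, Comm (b j) (fbar A a) 0
  bv_f : ∀ μ A a, Comm (bv μ) (f A a) 0
  bv_fbar : ∀ μ A a, Comm (bv μ) (fbar A a) 0

/-- Supercharges `Q_a`, `Q̄_ā = (Q_a)†` and generators `P_μ` of the translations:
`Q_a Ω = Q̄_ā Ω = 0`, `{Q_a, Q_b} = 0`, `{Q_a, Q̄_b̄} = 2 σ^μ_{a b̄} P_μ`, `[Q_a, P_μ] = 0`, and
`[P_μ, φ] = -i ∂_μ φ` for every free field `φ`. -/
structure Supercharges {𝒬 : StateSpace H} {m : ℝ} {s n : ℕ} (F : FreeFields 𝒬 m s n) where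
  Q : Fin 2 → 𝒬.Op
  Qbar : Fin 2 → 𝒬.Op
  P : Fin 4 → 𝒬.Op
  Q_odd : ∀ a, IsOdd (Q a)
  Qbar_odd : ∀ a, IsOdd (Qbar a)
  Q_adj : ∀ a, IsAdjoint (Q a) (Qbar a)
  Q_vacuum : ∀ a, Q a 𝒬.vacuum = 0
  Qbar_vacuum : ∀ a, Qbar a 𝒬.vacuum = 0
  Q_Q : ∀ a b, Q a * Q b + Q b * Q a = 0
  Q_Qbar : ∀ a b, Q a * Qbar b + Qbar b * Q a = ∑ μ, (2 * pauli μ a b) • P μ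
  Q_P : ∀ a μ, Q a * P μ - P μ * Q a = 0
  P_b : ∀ μ j h, P μ * F.b j h - F.b j h * P μ = (-Complex.I) • fieldDeriv μ (F.b j) h
  P_bv : ∀ μ ρ h, P μ * F.bv ρ h - F.bv ρ h * P μ = (-Complex.I) • fieldDeriv μ (F.bv ρ) h
  P_f : ∀ μ A a h, P μ * F.f A a h - F.f A a h * P μ = (-Complex.I) • fieldDeriv μ (F.f A a) h
  P_fbar : ∀ μ A a h,
    P μ * F.fbar A a h - F.fbar A a h * P μ = (-Complex.I) • fieldDeriv μ (F.fbar A a) h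

/-! ### Superfields -/

section Superspace

variable (𝒬 : StateSpace H)

/-- The Grassmann algebra on the four generators `θ_1, θ_2` (left summand) and `θ̄_1, θ̄_2`
(right summand). -/
abbrev Grassmann := ExteriorAlgebra ℂ (Fin 2 ⊕ Fin 2 → ℂ)

/-- Operators on the Grassmann extension `𝒢 ⊗ 𝓗` of the state space. -/
abbrev SuperOp := Grassmann ⊗[ℂ] 𝒬.Op

/-- The operator `1 ⊗ T`. -/
def lift (T : 𝒬.Op) : SuperOp 𝒬 := 1 ⊗ₜ[ℂ] T

/-- The parameter `θ_a` as an operator. The Klein transform, i.e. the factor `(-1)^F`, makes it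
anticommute with all fermionic operators. -/
def thetaLow (a : Fin 2) : SuperOp 𝒬 :=
  ExteriorAlgebra.ι ℂ (Pi.single (Sum.inl a) 1) ⊗ₜ[ℂ] 𝒬.parity

/-- The parameter `θ̄_ā` as an operator, with the Klein transform. -/
def thetabarLow (a : Fin 2) : SuperOp 𝒬 :=
  ExteriorAlgebra.ι ℂ (Pi.single (Sum.inr a) 1) ⊗ₜ[ℂ] 𝒬.parity

/-- `θ^a`. -/
def theta (a : Fin 2) : SuperOp 𝒬 := raise (thetaLow 𝒬) a

/-- `θ̄^ā`. -/
def thetabar (a : Fin 2) : SuperOp 𝒬 := raise (thetabarLow 𝒬) a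

/-- `θ² = θ^a θ_a`. -/
def thetaSq : SuperOp 𝒬 := ∑ a, theta 𝒬 a * thetaLow 𝒬 a

/-- `θ̄² = θ̄_ā θ̄^ā`. -/
def thetabarSq : SuperOp 𝒬 := ∑ a, thetabarLow 𝒬 a * thetabar 𝒬 a

/-- `θ σ^μ θ̄ = θ^a σ^μ_{a b̄} θ̄^b̄`. -/
def thetaSigma (μ : Fin 4) : SuperOp 𝒬 :=
  ∑ a, ∑ b, pauli μ a b • (theta 𝒬 a * thetabar 𝒬 b)

variable {𝒬}

/-- `θψ = θ^a ψ_a`, smeared with `h`. -/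
def thetaContr (ψ : Fin 2 → 𝒬.Field) (h : TestFn) : SuperOp 𝒬 :=
  ∑ a, theta 𝒬 a * lift 𝒬 (ψ a h)

/-- `θ̄ψ̄ = θ̄_ā ψ̄^ā`, smeared with `h`. -/
def thetabarContr (ψ : Fin 2 → 𝒬.Field) (h : TestFn) : SuperOp 𝒬 :=
  ∑ a, thetabarLow 𝒬 a * lift 𝒬 (raise ψ a h)

/-- The exponential as a finite Taylor series: there are four Grassmann parameters, so for `X`
linear in them the powers `Xᵏ` with `k ≥ 5` vanish. -/
def superExp (X : SuperOp 𝒬) : SuperOp 𝒬 := ∑ k ∈ Finset.range 5, ((k.factorial : ℂ)⁻¹) • X ^ k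

variable {m : ℝ} {s n : ℕ} {F : FreeFields 𝒬 m s n}

/-- `i θ^a Q_a - i θ̄^ā Q̄_ā`. -/
def superGenerator (S : Supercharges F) : SuperOp 𝒬 :=
  Complex.I • (∑ a, theta 𝒬 a * lift 𝒬 (S.Q a))
    - Complex.I • (∑ a, thetabar 𝒬 a * lift 𝒬 (S.Qbar a))

/-- The superfield `s(φ) = W φ W⁻¹`, with `W = exp(i θ^a Q_a - i θ̄^ā Q̄_ā)`, smeared with `h`. -/
def superfield (S : Supercharges F) (φ : 𝒬.Field) (h : TestFn) : SuperOp 𝒬 :=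
  superExp (superGenerator S) * lift 𝒬 (φ h) * superExp (-superGenerator S)

end Superspace

/-! ### The components of the vector multiplet -/

/-- Coefficients of the component fields with respect to the free fields. -/
structure Coefficients (s n : ℕ) where
  γ : Fin s → ℝ
  α : Fin n → ℂ
  β : Fin n → ℂ
  δ : Fin s → ℂ
  ρ : Fin s → ℂ
  τ : Fin s → ℂ
  δ₀ : ℂ
  ρ₀ : ℂ
  τ₀ : ℂ

namespace Coefficients

variable {𝒬 : StateSpace H} {m : ℝ} {s n : ℕ} (c : Coefficients s n) (F : FreeFields 𝒬 m s n)

/-- `C = ∑ γ_j b^{(j)}`. -/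
def C : 𝒬.Field := ∑ j, (c.γ j : ℂ) • F.b j

/-- `χ_a = ∑ α_A f^{(A)}_a`. -/
def chi (a : Fin 2) : 𝒬.Field := ∑ A, c.α A • F.f A a

/-- `χ̄_ā = (χ_a)†`. -/
def chibar (a : Fin 2) : 𝒬.Field := ∑ A, conj (c.α A) • F.fbar A a

/-- `λ_a = ∑ β_A f^{(A)}_a`. -/
def lam (a : Fin 2) : 𝒬.Field := ∑ A, c.β A • F.f A a

/-- `λ̄_ā = (λ_a)†`. -/
def lambar (a : Fin 2) : 𝒬.Field := ∑ A, conj (c.β A) • F.fbar A a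

/-- `d = ∑ δ_j b^{(j)} + δ₀ ∂^μ b_μ`. -/
def d : 𝒬.Field := (∑ j, c.δ j • F.b j) + c.δ₀ • div F.bv

/-- `φ = ∑ ρ_j b^{(j)} + ρ₀ ∂^μ b_μ`. -/
def phi : 𝒬.Field := (∑ j, c.ρ j • F.b j) + c.ρ₀ • div F.bv

/-- `φ†`. -/
def phidag : 𝒬.Field := (∑ j, conj (c.ρ j) • F.b j) + conj c.ρ₀ • div F.bv

/-- `v_μ = τ₀ b_μ + ∑ τ_j ∂_μ b^{(j)}`. -/
def v (μ : Fin 4) : 𝒬.Field := c.τ₀ • F.bv μ + ∑ j, c.τ j • fieldDeriv μ (F.b j)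

/-- The superfield
`C + θχ + θ̄χ̄ + θ² φ + θ̄² φ† + (θσ^μθ̄) v_μ + θ² θ̄λ̄ + θ̄² θλ + θ² θ̄² d`,
smeared with `h`. -/
def expansion (h : TestFn) : SuperOp 𝒬 :=
  lift 𝒬 (c.C F h) + thetaContr (c.chi F) h + thetabarContr (c.chibar F) h
    + thetaSq 𝒬 * lift 𝒬 (c.phi F h) + thetabarSq 𝒬 * lift 𝒬 (c.phidag F h)
    + (∑ μ, thetaSigma 𝒬 μ * lift 𝒬 (c.v F μ h))
    + thetaSq 𝒬 * thetabarContr (c.lambar F) h + thetabarSq 𝒬 * thetaContr (c.lam F) h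
    + thetaSq 𝒬 * thetabarSq 𝒬 * lift 𝒬 (c.d F h)

/-- The list of all causal (anti)commutators of the component fields (up to taking adjoints and
exchanging the two fields), with parameters `α` and `β`. -/
structure CausalRelations (α : ℝ) (β : ℂ) : Prop where
  C_C : Comm (c.C F) (c.C F) ((-Complex.I) • kerD m)
  C_d : Comm (c.C F) (c.d F) ((-Complex.I * α) • kerD m)
  C_phi : Comm (c.C F) (c.phi F) (β • kerD m)
  phi_phidag : Comm (c.phi F) (c.phidag F) ((-Complex.I * (α + m ^ 2 / 4)) • kerD m)
  phi_d : Comm (c.phi F) (c.d F) ((m ^ 2 * β / 4) • kerD m)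
  phi_v : ∀ μ, Comm (c.phi F) (c.v F μ) ((Complex.I * β) • kerdD m μ)
  d_d : Comm (c.d F) (c.d F) ((-(Complex.I * m ^ 4 / 16)) • kerD m)
  v_v : ∀ μ ρ, Comm (c.v F μ) (c.v F ρ)
    (Complex.I • kerddD m μ ρ + (Complex.I * (m ^ 2 / 2 - 2 * α) * metric μ ρ) • kerD m)
  chi_chi : ∀ a b, Anticomm (c.chi F a) (c.chi F b) ((2 * β * epsLow a b) • kerD m)
  chi_chibar : ∀ a b, Anticomm (c.chi F a) (c.chibar F b) (kerSigmaD m a b)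
  lam_lam : ∀ a b, Anticomm (c.lam F a) (c.lam F b)
    ((-(m ^ 2 * conj β / 2) * epsLow a b) • kerD m)
  lam_lambar : ∀ a b, Anticomm (c.lam F a) (c.lambar F b) (((m : ℂ) ^ 2 / 4) • kerSigmaD m a b)
  chi_lam : ∀ a b, Anticomm (c.chi F a) (c.lam F b)
    ((-(2 * Complex.I * α) * epsLow a b) • kerD m)
  chi_lambar : ∀ a b, Anticomm (c.chi F a) (c.lambar F b) ((Complex.I * β) • kerSigmaD m a b)
  -- the remaining (anti)commutators vanish
  C_v : ∀ μ, Comm (c.C F) (c.v F μ) 0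
  phi_phi : Comm (c.phi F) (c.phi F) 0
  d_v : ∀ μ, Comm (c.d F) (c.v F μ) 0
  bose_fermi : ∀ φ ψ : 𝒬.Field,
    (φ = c.C F ∨ φ = c.phi F ∨ φ = c.phidag F ∨ φ = c.d F ∨ ∃ μ, φ = c.v F μ) →
    (∃ a, ψ = c.chi F a ∨ ψ = c.chibar F a ∨ ψ = c.lam F a ∨ ψ = c.lambar F a) →
    Comm φ ψ 0

end Coefficients

end SuperVector

end

open scoped SchwartzMap LineDeriv TensorProduct ComplexConjugate
open MeasureTheory

noncomputable section

namespace SuperVector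

/-! ### Nontriviality of the Pauli–Jordan distribution -/

/-! Write `R_a = iQ_a` and `Rbar_a = -iQ̄_a`. The superfield is the exponential of the commutator
with X = θR + θ̄Rbar applied to C, so its Grassmann components are iterated graded commutators of C
with these charges. Rescaling all Grassmann parameters separates the degrees, and contraction with
dual generators reads off each monomial. The result is `susyRelations`: formulas such as [R_a, C] =
χ_a, and the combinations of brackets that give φ, v, λ and d.

The supersymmetry algebra then determines the action of the charges on the components. Jacobi
identities, with {R, R} = 0 and {R, Rbar} acting as -2iσ∂, fix the parts of the brackets that the
expansion does not contain. The Dirac equation replaces divergences of spinors by m times a spinor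
of the opposite chirality. Since it carries f̄ to f without conjugating coefficients, σ∂χ̄ gives ∑
ᾱ_A f^{(A)} rather than χ; this is where `chiConj` and its companions enter.

Finally, bosons commute with fermions, so the Jacobi identity gives {[R, φ], ψ} = -[φ, {R, ψ}] for φ
bosonic and ψ fermionic. It exchanges commutators of bosons with anticommutators of spinors, which
are bilinear in the coefficient vectors. Write z = (α_A), w = (β_A) for these vectors, N = ∑ γ_j²,
and β for the parameter `beta`. Because D_m and σ∂D_m are not zero (`exists_kerdD_zero_ne_zero`),
coefficients can be compared: z·z̄ = N, im z·z = 2β, z·w̄ = iβ, w·w̄ = m²N/4, im w·w = -m²β̄/2, and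
m z·w is real. Setting m z·w = -2α gives all the listed relations when N = 1.

For m = 0 the identity w·w̄ = m²N/4 (`beta_dot_star_beta`) says ∑ |β_A|² = 0, so λ = 0. This
positivity is that of the coefficient space ℂⁿ; the form on the state space may be indefinite. For m
> 0, the products show that Re w and Im w are m/2 times as long as Re z and Im z respectively.
Cauchy–Schwarz for each pair gives the bounds on α and Im β, and |z·z| ≤ z·z̄ gives the bound on β
(`bounds_of_dotProduct`). -/

/-- The shell momentum `(ω_p, -p) / 2π`, conjugate to `x` for the Fourier transform. -/
def shellPoint (m : ℝ) (p : EuclideanSpace ℝ (Fin 3)) : Spacetime :=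
  WithLp.toLp 2 (Fin.cons ((2 * Real.pi)⁻¹ * energy m p) fun i => -((2 * Real.pi)⁻¹ * p i))

lemma continuous_energy (m : ℝ) : Continuous (energy m) := by
  unfold energy; fun_prop

lemma continuous_shellPoint (m : ℝ) : Continuous (shellPoint m) := by
  unfold shellPoint
  refine (PiLp.continuous_toLp 2 _).comp (continuous_pi fun i => ?_)
  refine Fin.cases ?_ (fun j => ?_) i
  · simpa using (continuous_energy m).const_mul _
  · simp only [Fin.cons_succ]; fun_prop

lemma two_pi_mul_inner_shellPoint (m : ℝ) (p : EuclideanSpace ℝ (Fin 3)) (x : Spacetime) :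
    2 * Real.pi * inner ℝ x (shellPoint m p) = shellPhase m p x := by
  simp only [PiLp.inner_apply, shellPoint, shellPhase, Fin.sum_univ_succ (n := 3), Fin.cons_zero,
    Fin.cons_succ, RCLike.inner_apply, conj_trivial]
  rw [mul_add, Finset.mul_sum, sub_eq_add_neg, ← Finset.sum_neg_distrib]
  congr 1
  · field_simp
  · exact Finset.sum_congr rfl fun i _ => by field_simp

/-- Turns the decay of a Fourier transform in its own variable into decay in p along the mass shell.
-/
lemma norm_le_norm_shellPoint (m : ℝ) (p : EuclideanSpace ℝ (Fin 3)) :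
    (2 * Real.pi)⁻¹ * ‖p‖ ≤ ‖shellPoint m p‖ := by
  have h : 0 ≤ (2 * Real.pi)⁻¹ := by positivity
  rw [← abs_of_nonneg h, ← Real.norm_eq_abs, ← norm_smul]
  rw [EuclideanSpace.norm_eq, EuclideanSpace.norm_eq]
  apply Real.sqrt_le_sqrt
  rw [Fin.sum_univ_succ (n := 3)]
  simp only [shellPoint, Fin.cons_succ, norm_neg, PiLp.smul_apply, smul_eq_mul]
  exact le_add_of_nonneg_left (by positivity)

/-- A real test function as a complex one. -/
def toComplex (f : TestFn) : 𝓢(Spacetime, ℂ) :=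
  f.postcompCLM (Complex.ofRealCLM)

lemma toComplex_apply (f : TestFn) (x : Spacetime) : toComplex f x = (f x : ℂ) := rfl

lemma toComplex_pd (μ : Fin 4) (f : TestFn) :
    toComplex (pd μ f) = ∂_{EuclideanSpace.single μ (1 : ℝ)} (toComplex f) := by
  ext x
  have h : ⇑(toComplex f) = Complex.ofRealCLM ∘ f := rfl
  rw [toComplex_apply, SchwartzMap.lineDerivOp_apply_eq_fderiv, h,
    fderiv_comp _ Complex.ofRealCLM.differentiableAt f.differentiableAt]
  simp [pd, SchwartzMap.lineDerivOp_apply_eq_fderiv]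

/-- The cosine transform of `f` on the mass shell. -/
def cosT (m : ℝ) (p : EuclideanSpace ℝ (Fin 3)) (f : TestFn) : ℝ :=
  ∫ x, f x * Real.cos (shellPhase m p x)

/-- The sine transform of `f` on the mass shell. -/
def sinT (m : ℝ) (p : EuclideanSpace ℝ (Fin 3)) (f : TestFn) : ℝ :=
  ∫ x, f x * Real.sin (shellPhase m p x)

lemma continuous_shellPhase (m : ℝ) (p : EuclideanSpace ℝ (Fin 3)) :
    Continuous (shellPhase m p) := by
  unfold shellPhase; fun_prop

lemma integrable_mul_cos (m : ℝ) (p : EuclideanSpace ℝ (Fin 3)) (f : TestFn) :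
    Integrable fun x => f x * Real.cos (shellPhase m p x) := by
  refine f.integrable.mul_bdd (c := 1) ?_ (ae_of_all _ fun x => Real.abs_cos_le_one _)
  exact (Real.continuous_cos.comp (continuous_shellPhase m p)).aestronglyMeasurable

lemma integrable_mul_sin (m : ℝ) (p : EuclideanSpace ℝ (Fin 3)) (f : TestFn) :
    Integrable fun x => f x * Real.sin (shellPhase m p x) := by
  refine f.integrable.mul_bdd (c := 1) ?_ (ae_of_all _ fun x => Real.abs_sin_le_one _)
  exact (Real.continuous_sin.comp (continuous_shellPhase m p)).aestronglyMeasurable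

open FourierTransform in
lemma fourier_toComplex_shellPoint (m : ℝ) (p : EuclideanSpace ℝ (Fin 3)) (f : TestFn) :
    𝓕 (toComplex f) (shellPoint m p) = cosT m p f - sinT m p f * Complex.I := by
  rw [SchwartzMap.fourier_coe, Real.fourier_eq']
  unfold cosT sinT
  rw [← integral_complex_ofReal, ← integral_complex_ofReal, ← integral_mul_const, ← integral_sub]
  · congr 1; ext x
    rw [toComplex_apply, ← two_pi_mul_inner_shellPoint m p x]
    simp only [smul_eq_mul]
    push_cast
    rw [Complex.exp_mul_I]
    rw [show (-2 * (Real.pi : ℂ) * ((inner ℝ x (shellPoint m p) : ℝ) : ℂ)) =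
      -(2 * (Real.pi : ℂ) * ((inner ℝ x (shellPoint m p) : ℝ) : ℂ)) by ring, Complex.cos_neg,
      Complex.sin_neg]
    ring
  · exact (integrable_mul_cos m p f).ofReal
  · exact (integrable_mul_sin m p f).ofReal.mul_const _

-- Differentiation becomes multiplication by 2πi times the time component of `shellPoint`, that is
-- by iω_p; the two formulas are its real and imaginary parts.
open FourierTransform in
lemma trig_transform_pd_zero (m : ℝ) (p : EuclideanSpace ℝ (Fin 3)) (f : TestFn) :
    cosT m p (pd 0 f) = energy m p * sinT m p f ∧
      sinT m p (pd 0 f) = -(energy m p * cosT m p f) := by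
  have h := fourier_toComplex_shellPoint m p (pd 0 f)
  rw [toComplex_pd, SchwartzMap.fourier_lineDerivOp_eq] at h
  have hg : (inner ℝ · (EuclideanSpace.single (0 : Fin 4) (1 : ℝ)) :
    Spacetime → ℝ).HasTemperateGrowth := ((innerSL ℝ).flip _).hasTemperateGrowth
  rw [smul_apply, SchwartzMap.smulLeftCLM_apply_apply hg,
    fourier_toComplex_shellPoint] at h
  have h0 : inner ℝ (shellPoint m p) (EuclideanSpace.single (0 : Fin 4) (1 : ℝ)) =
      (2 * Real.pi)⁻¹ * energy m p := by
    simp [EuclideanSpace.inner_single_right, shellPoint]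
  rw [h0] at h
  have h1 : (energy m p : ℂ) * Complex.I * (cosT m p f - sinT m p f * Complex.I) =
      cosT m p (pd 0 f) - sinT m p (pd 0 f) * Complex.I := by
    rw [← h, Complex.real_smul, smul_eq_mul]
    have : (Real.pi : ℂ) ≠ 0 := by exact_mod_cast Real.pi_ne_zero
    push_cast
    field_simp
  have hr := congrArg Complex.re h1
  have hi := congrArg Complex.im h1
  simp at hr hi
  constructor <;> linarith

lemma integral_integral_sin (m : ℝ) (p : EuclideanSpace ℝ (Fin 3)) (f g : TestFn) :
    ∫ x : Spacetime, ∫ y : Spacetime, f x * g y * Real.sin (shellPhase m p (x - y)) =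
      sinT m p f * cosT m p g - cosT m p f * sinT m p g := by
  have hs (x y : Spacetime) : shellPhase m p (x - y) = shellPhase m p x - shellPhase m p y := by
    simp only [shellPhase, PiLp.sub_apply, mul_sub, Finset.sum_sub_distrib]; ring
  have hi (x : Spacetime) : ∫ y : Spacetime, f x * g y * Real.sin (shellPhase m p (x - y)) =
      f x * Real.sin (shellPhase m p x) * cosT m p g -
        f x * Real.cos (shellPhase m p x) * sinT m p g := by
    unfold cosT sinT
    rw [← integral_const_mul, ← integral_const_mul, ← integral_sub]
    · congr 1; ext y
      rw [hs, Real.sin_sub]; ring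
    · exact (integrable_mul_cos m p g).const_mul _
    · exact (integrable_mul_sin m p g).const_mul _
  simp_rw [hi]
  rw [integral_sub, integral_mul_const, integral_mul_const]
  · rfl
  · exact (integrable_mul_sin m p f).mul_const _
  · exact (integrable_mul_cos m p f).mul_const _

-- The integrand is |𝓕f|² on the shell. Second-order decay of 𝓕f bounds it by a multiple of (1 +
-- ‖p‖)⁻⁴, which is integrable in three dimensions.
open FourierTransform in
lemma integrable_sq_cosT_add_sq_sinT (m : ℝ) (f : TestFn) :
    Integrable fun p => cosT m p f ^ 2 + sinT m p f ^ 2 := by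
  have hn (p) : cosT m p f ^ 2 + sinT m p f ^ 2 = ‖𝓕 (toComplex f) (shellPoint m p)‖ ^ 2 := by
    rw [fourier_toComplex_shellPoint, ← Complex.normSq_eq_norm_sq, Complex.normSq_apply]
    simp; ring
  simp_rw [hn]
  set F := 𝓕 (toComplex f)
  obtain ⟨K, hK⟩ : ∃ K, ∀ ξ, (1 + ‖ξ‖) ^ 2 * ‖F ξ‖ ≤ K := by
    refine ⟨2 ^ 2 * ((Finset.Iic (2, 0)).sup fun k => SchwartzMap.seminorm ℝ k.1 k.2) F, fun ξ => ?_⟩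
    have := SchwartzMap.one_add_le_sup_seminorm_apply (𝕜 := ℝ) (m := (2, 0)) (k := 2) (n := 0)
      le_rfl le_rfl F ξ
    simpa using this
  have hK0 : 0 ≤ K := le_trans (by positivity) (hK 0)
  have hint : Integrable fun p : EuclideanSpace ℝ (Fin 3) =>
      (K * (2 * Real.pi) ^ 2) ^ 2 * (1 + ‖p‖) ^ (-4 : ℝ) :=
    (integrable_one_add_norm (by simp; norm_num)).const_mul _
  refine hint.mono' ?_ (ae_of_all _ fun p => ?_)
  · exact ((F.continuous.comp (continuous_shellPoint m)).norm.pow 2).aestronglyMeasurable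
  · have h1 := hK (shellPoint m p)
    have h2 := norm_le_norm_shellPoint m p
    have hpi : 1 ≤ 2 * Real.pi := by linarith [Real.pi_gt_three]
    have h3 : (1 + ‖p‖) ≤ (2 * Real.pi) * (1 + ‖shellPoint m p‖) := by
      rw [inv_mul_le_iff₀ (by positivity)] at h2
      linarith
    have h4 : ‖F (shellPoint m p)‖ * (1 + ‖p‖) ^ 2 ≤ K * (2 * Real.pi) ^ 2 := by
      calc ‖F (shellPoint m p)‖ * (1 + ‖p‖) ^ 2
          ≤ ‖F (shellPoint m p)‖ * ((2 * Real.pi) * (1 + ‖shellPoint m p‖)) ^ 2 := by gcongr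
        _ = ((1 + ‖shellPoint m p‖) ^ 2 * ‖F (shellPoint m p)‖) * (2 * Real.pi) ^ 2 := by ring
        _ ≤ _ := by gcongr
    rw [Real.rpow_neg (by positivity), ← div_eq_mul_inv, le_div_iff₀ (by positivity)]
    rw [Real.norm_of_nonneg (by positivity)]
    calc ‖F (shellPoint m p)‖ ^ 2 * (1 + ‖p‖) ^ (4 : ℝ)
        = (‖F (shellPoint m p)‖ * (1 + ‖p‖) ^ 2) ^ 2 := by
          rw [show (4 : ℝ) = ((4 : ℕ) : ℝ) by norm_num, Real.rpow_natCast]; ring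
      _ ≤ _ := by gcongr

open FourierTransform in
lemma continuous_cosT (m : ℝ) (f : TestFn) : Continuous fun p => cosT m p f := by
  have h : (fun p => cosT m p f) = fun p => (𝓕 (toComplex f) (shellPoint m p)).re := by
    ext p; rw [fourier_toComplex_shellPoint]; simp
  rw [h]
  exact Complex.continuous_re.comp ((𝓕 (toComplex f)).continuous.comp (continuous_shellPoint m))

open FourierTransform in
lemma continuous_sinT (m : ℝ) (f : TestFn) : Continuous fun p => sinT m p f := by
  have h : (fun p => sinT m p f) = fun p => -(𝓕 (toComplex f) (shellPoint m p)).im := by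
    ext p; rw [fourier_toComplex_shellPoint]; simp
  rw [h]
  exact (Complex.continuous_im.comp
    ((𝓕 (toComplex f)).continuous.comp (continuous_shellPoint m))).neg

/-- At p = 0 the phase is |m| x⁰. A bump supported in radius 1/(1 + |m|) keeps it within [-1, 1],
where the cosine is positive. -/
lemma exists_cosT_pos (m : ℝ) : ∃ f : TestFn, 0 < cosT m 0 f := by
  have hr : 0 < (1 + |m|)⁻¹ := by positivity
  let φ : ContDiffBump (0 : Spacetime) := ⟨(1 + |m|)⁻¹ / 2, (1 + |m|)⁻¹, by positivity, by linarith⟩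
  refine ⟨φ.hasCompactSupport.toSchwartzMap φ.contDiff, ?_⟩
  have hc : Continuous fun x => φ x * Real.cos (shellPhase m 0 x) :=
    φ.continuous.mul (Real.continuous_cos.comp (continuous_shellPhase m 0))
  refine Continuous.integral_pos_of_hasCompactSupport_nonneg_nonzero (x := 0) hc
    φ.hasCompactSupport.mul_right (fun x => ?_) ?_
  · by_cases hx : ‖x‖ < (1 + |m|)⁻¹
    · refine mul_nonneg φ.nonneg (Real.cos_nonneg_of_mem_Icc ?_)
      have h0 : |x 0| ≤ ‖x‖ := PiLp.norm_apply_le x 0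
      have h1 : |shellPhase m 0 x| ≤ 1 := by
        simp only [shellPhase, energy, norm_zero, PiLp.zero_apply, zero_mul, Finset.sum_const_zero,
          sub_zero, ne_eq, OfNat.ofNat_ne_zero, not_false_eq_true, zero_pow, zero_add,
          Real.sqrt_sq_eq_abs, abs_mul, abs_abs]
        calc |m| * |x 0| ≤ (1 + |m|) * (1 + |m|)⁻¹ := by
              gcongr
              · linarith
              · linarith
          _ = 1 := mul_inv_cancel₀ (by positivity)
      rw [abs_le] at h1
      constructor <;> linarith [Real.pi_gt_three]
    · have h0 : φ x = 0 := φ.zero_of_le_dist (by simpa using hx)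
      exact (by simp [h0] : 0 ≤ φ x * Real.cos (shellPhase m 0 x))
  · simpa [shellPhase] using (φ.pos_of_mem_ball (x := 0) (by simpa [φ] using hr)).ne'

/-- The time derivative produces a factor ω_p that cancels the ω_p⁻¹ in D_m, leaving a definite
quadratic form in f. This is the reason for testing ∂₀D_m rather than D_m. -/
lemma pauliJordan_pd_zero (m : ℝ) (f : TestFn) :
    pauliJordan m (pd 0 f) f =
      -(((2 * Real.pi) ^ 3)⁻¹ * ∫ p, (cosT m p f ^ 2 + sinT m p f ^ 2)) := by
  unfold pauliJordan
  rw [← mul_neg, ← integral_neg]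
  congr 1
  refine integral_congr_ae ?_
  -- For m = 0 the energy vanishes at p = 0, where the cancellation of ω_p fails; a single point is
  -- negligible.
  have h0 : ∀ᵐ p : EuclideanSpace ℝ (Fin 3), p ≠ 0 := by
    simp [ae_iff]
  filter_upwards [h0] with p hp
  have hE : energy m p ≠ 0 := by
    have : 0 < ‖p‖ := norm_pos_iff.2 hp
    exact (Real.sqrt_pos.2 (by positivity)).ne'
  rw [integral_integral_sin, (trig_transform_pd_zero m p f).1, (trig_transform_pd_zero m p f).2]
  field_simp
  ring

theorem exists_kerdD_zero_ne_zero (m : ℝ) : ∃ f, kerdD m 0 f f ≠ 0 := by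
  obtain ⟨f, hf⟩ := exists_cosT_pos m
  refine ⟨f, fun h => ?_⟩
  simp only [kerdD, pauliJordan_pd_zero, Complex.ofReal_neg, neg_neg, Complex.ofReal_eq_zero,
    mul_eq_zero] at h
  have h1 := h.resolve_left (by positivity)
  have hn : 0 ≤ fun p => cosT m p f ^ 2 + sinT m p f ^ 2 := fun p => by
    simp only [Pi.zero_apply]; positivity
  -- Integrability matters here: the integral of a non-integrable function is 0 by convention.
  rw [integral_eq_zero_iff_of_nonneg hn (integrable_sq_cosT_add_sq_sinT m f)] at h1
  have h2 := (((continuous_cosT m f).pow 2).add ((continuous_sinT m f).pow 2)).ae_eq_iff_eq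
    volume continuous_const |>.1 h1
  have h3 := congrFun h2 0
  change cosT m 0 f ^ 2 + sinT m 0 f ^ 2 = 0 at h3
  nlinarith [sq_nonneg (sinT m 0 f)]

lemma pd_comm (μ ν : Fin 4) (f : TestFn) : pd μ (pd ν f) = pd ν (pd μ f) := by
  ext x
  have h (μ ν : Fin 4) : pd μ (pd ν f) x = fderiv ℝ (fderiv ℝ f) x (EuclideanSpace.single μ 1)
      (EuclideanSpace.single ν 1) := by
    have h1 : ⇑(pd ν f) = fun y => fderiv ℝ f y (EuclideanSpace.single ν 1) := by
      ext y; exact SchwartzMap.lineDerivOp_apply_eq_fderiv _ f y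
    have h2 : DifferentiableAt ℝ (fderiv ℝ f) x :=
      ((f.smooth 2).contDiffAt.fderiv_right (m := 1) (by norm_num)).differentiableAt (by norm_num)
    refine (SchwartzMap.lineDerivOp_apply_eq_fderiv _ (pd ν f) x).trans ?_
    rw [h1, fderiv_clm_apply h2 (differentiableAt_const _)]
    simp
  rw [h, h]
  exact ((f.smooth 2).contDiffAt.isSymmSndFDerivAt (by simp)).eq _ _

/-! ### Coefficients of a superfield -/

section Extraction

variable {H : Type*} [NormedAddCommGroup H] [InnerProductSpace ℂ H] {𝒬 : StateSpace H}

open StateSpace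

instance instMulSuperOp (𝒬 : StateSpace H) : Mul (SuperOp 𝒬) := inferInstance

instance instSubSuperOp (𝒬 : StateSpace H) : Sub (SuperOp 𝒬) := inferInstance

/-- Linear functionals reduce this to a complex polynomial that vanishes at every t. It separates
Grassmann degrees after rescaling by t. -/
lemma eq_zero_of_forall_sum_pow_smul_eq_zero {V : Type*} [AddCommGroup V] [Module ℂ V] {n : ℕ}
    (Z : Fin n → V) (h : ∀ t : ℂ, ∑ k : Fin n, t ^ (k : ℕ) • Z k = 0) (k : Fin n) : Z k = 0 := by
  rw [← Module.forall_dual_apply_eq_zero_iff ℂ]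
  intro l
  have hp : (∑ k : Fin n, Polynomial.C (l (Z k)) * Polynomial.X ^ (k : ℕ) : Polynomial ℂ) = 0 := by
    refine Polynomial.funext fun t => ?_
    have := congrArg l (h t)
    simp only [map_sum, map_smul, smul_eq_mul, map_zero] at this
    simp only [Polynomial.eval_finsetSum, Polynomial.eval_mul, Polynomial.eval_C,
      Polynomial.eval_pow, Polynomial.eval_X, Polynomial.eval_zero]
    rw [← this]
    exact Finset.sum_congr rfl fun _ _ => mul_comm _ _
  have hc := congrArg (fun p => Polynomial.coeff p (k : ℕ)) hp
  simpa [Polynomial.finsetSum_coeff, Polynomial.coeff_C_mul, Polynomial.coeff_X_pow, Fin.val_inj]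
    using hc

/-- The rescaling of all Grassmann parameters by `t`. -/
def rescale (𝒬 : StateSpace H) (t : ℂ) : SuperOp 𝒬 →ₐ[ℂ] SuperOp 𝒬 :=
  Algebra.TensorProduct.map (ExteriorAlgebra.map (t • LinearMap.id)) (AlgHom.id ℂ _)

lemma rescale_lift (t : ℂ) (A : 𝒬.Op) : rescale 𝒬 t (lift 𝒬 A) = lift 𝒬 A := by
  simp [rescale, lift]

/-- The expansion of a conjugation by an exponential, when `X` and the components `V k` are
homogeneous. -/
lemma commutator_of_superExp_eq {X A V₀ V₁ V₂ V₃ V₄ : SuperOp 𝒬}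
    (hX : ∀ t, rescale 𝒬 t X = t • X) (hA : ∀ t, rescale 𝒬 t A = A)
    (h₀ : ∀ t, rescale 𝒬 t V₀ = V₀) (h₁ : ∀ t, rescale 𝒬 t V₁ = t • V₁)
    (h₂ : ∀ t, rescale 𝒬 t V₂ = t ^ 2 • V₂) (h₃ : ∀ t, rescale 𝒬 t V₃ = t ^ 3 • V₃)
    (h₄ : ∀ t, rescale 𝒬 t V₄ = t ^ 4 • V₄)
    (h : superExp X * A * superExp (-X) = V₀ + V₁ + V₂ + V₃ + V₄) :
    X * A - A * X = V₁ ∧ X * V₁ - V₁ * X = (2 : ℂ) • V₂ ∧ X * V₂ - V₂ * X = (3 : ℂ) • V₃ ∧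
      X * V₃ - V₃ * X = (4 : ℂ) • V₄ := by
  let c : ℕ → ℂ := fun k => (k.factorial : ℂ)⁻¹
  let Y : ℕ → ℕ → SuperOp 𝒬 := fun k l => (c k * c l * (-1) ^ l) • (X ^ k * A * X ^ l)
  have hY (t : ℂ) : superExp (t • X) * A * superExp (-(t • X)) =
      ∑ k ∈ Finset.range 5, ∑ l ∈ Finset.range 5, t ^ (k + l) • Y k l := by
    simp only [superExp, Finset.sum_mul, Finset.mul_sum, Y]
    rw [Finset.sum_comm]
    refine Finset.sum_congr rfl fun k _ => Finset.sum_congr rfl fun l _ => ?_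
    rw [show -(t • X) = (-t) • X from (neg_smul t X).symm, smul_pow, smul_pow]
    simp only [smul_mul_assoc, mul_smul_comm, smul_smul]
    congr 1
    simp only [c]
    ring
  have key (t : ℂ) : ∑ k ∈ Finset.range 5, ∑ l ∈ Finset.range 5, t ^ (k + l) • Y k l =
      V₀ + t • V₁ + t ^ 2 • V₂ + t ^ 3 • V₃ + t ^ 4 • V₄ := by
    rw [← hY, ← h₀ t, ← h₁, ← h₂, ← h₃, ← h₄]
    simp only [← map_add, ← h]
    simp only [map_mul, hA, superExp, map_sum, map_smul, map_pow, map_neg, hX]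
  -- Both exponentials are truncated at order 4, so powers of t up to 8 occur. Only the coefficients
  -- of degrees 1 to 4 are used, and neither nilpotency of X nor invertibility of the exponential is
  -- needed.
  let Z : Fin 9 → SuperOp 𝒬 := ![Y 0 0 - V₀, Y 0 1 + Y 1 0 - V₁, Y 0 2 + Y 1 1 + Y 2 0 - V₂,
    Y 0 3 + Y 1 2 + Y 2 1 + Y 3 0 - V₃, Y 0 4 + Y 1 3 + Y 2 2 + Y 3 1 + Y 4 0 - V₄,
    Y 1 4 + Y 2 3 + Y 3 2 + Y 4 1, Y 2 4 + Y 3 3 + Y 4 2, Y 3 4 + Y 4 3, Y 4 4]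
  have hZ := eq_zero_of_forall_sum_pow_smul_eq_zero Z fun t => by
    have := key t
    simp only [Finset.sum_range_succ, Finset.sum_range_zero] at this
    simp only [Fin.sum_univ_succ, Fin.sum_univ_zero, Z, Matrix.cons_val_zero, Matrix.cons_val_succ,
      Fin.val_zero, Fin.val_succ]
    norm_num at this ⊢
    linear_combination (norm := module) this
  have e₁ : V₁ = Y 0 1 + Y 1 0 := (sub_eq_zero.1 (hZ 1)).symm
  have e₂ : V₂ = Y 0 2 + Y 1 1 + Y 2 0 := (sub_eq_zero.1 (hZ 2)).symm
  have e₃ : V₃ = Y 0 3 + Y 1 2 + Y 2 1 + Y 3 0 := (sub_eq_zero.1 (hZ 3)).symm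
  have e₄ : V₄ = Y 0 4 + Y 1 3 + Y 2 2 + Y 3 1 + Y 4 0 := (sub_eq_zero.1 (hZ 4)).symm
  have hf : c 0 = 1 ∧ c 1 = 1 ∧ c 2 = 1 / 2 ∧ c 3 = 1 / 6 ∧ c 4 = 1 / 24 := by
    norm_num [c, Nat.factorial]
  obtain ⟨f0, f1, f2, f3, f4⟩ := hf
  simp only [Y, f0, f1, f2, f3, f4, pow_succ, pow_zero, one_mul, mul_one] at e₁ e₂ e₃ e₄
  refine ⟨?_, ?_, ?_, ?_⟩
  · rw [e₁]; module
  · rw [e₁, e₂]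
    simp only [mul_add, add_mul, mul_smul_comm, smul_mul_assoc, mul_assoc]
    module
  · rw [e₂, e₃]
    simp only [mul_add, add_mul, mul_smul_comm, smul_mul_assoc, mul_assoc]
    module
  · rw [e₃, e₄]
    simp only [mul_add, add_mul, mul_smul_comm, smul_mul_assoc, mul_assoc]
    module

lemma mul_mul_congr {A : Type*} {M M' : Mul A} (hM : M = M') (x y z : A) :
    @HMul.hMul _ _ _ (@instHMul _ M) (@HMul.hMul _ _ _ (@instHMul _ M) x y) z =
      @HMul.hMul _ _ _ (@instHMul _ M') (@HMul.hMul _ _ _ (@instHMul _ M') x y) z := by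
  rw [hM]

variable {m : ℝ} {s n : ℕ} {F : FreeFields 𝒬 m s n}

/-- The two sides differ only in the instance path of the multiplication on `SuperOp 𝒬`. Abstracting
the factors reduces the claim to the equality of these instances. -/
lemma superExp_mul_lift_mul_superExp (S : Supercharges F) (φ : 𝒬.Field) (h : TestFn) :
    superExp (superGenerator S) * lift 𝒬 (φ h) * superExp (-superGenerator S) =
      superfield S φ h := by
  suffices H : ∀ g : Supercharges F → 𝒬.Field → TestFn → SuperOp 𝒬, g = superfield →
      superExp (superGenerator S) * lift 𝒬 (φ h) * superExp (-superGenerator S) = g S φ h from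
    H _ rfl
  intro g hg
  delta superfield at hg
  subst hg
  beta_reduce
  generalize superGenerator S = X
  generalize lift 𝒬 (φ h) = A
  refine mul_mul_congr (A := SuperOp 𝒬) ?_ _ _ _
  delta instMulSuperOp inferInstance
  rfl

end Extraction

/-! ### Grassmann monomials, the Klein factor and coefficient functionals. -/

section Coefficients

variable {H : Type*} [NormedAddCommGroup H] [InnerProductSpace ℂ H] {𝒬 : StateSpace H}

open StateSpace

instance instAddCommGroupField (𝒬 : StateSpace H) : AddCommGroup 𝒬.Field :=
  LinearMap.addCommGroup

instance instAddCommGroupOp (𝒬 : StateSpace H) : AddCommGroup 𝒬.Op := LinearMap.addCommGroup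

instance instRingOp (𝒬 : StateSpace H) : Ring 𝒬.Op := Module.End.instRing

lemma op_mul_neg (x y : 𝒬.Op) : x * -y = -(x * y) := mul_neg x y

lemma op_neg_mul (x y : 𝒬.Op) : -x * y = -(x * y) := neg_mul x y

lemma superOp_tmul_neg (g : Grassmann) (x : 𝒬.Op) :
    (g ⊗ₜ (-x) : SuperOp 𝒬) = -(g ⊗ₜ x : SuperOp 𝒬) := TensorProduct.tmul_neg g x

lemma superOp_neg_tmul (g : Grassmann) (x : 𝒬.Op) :
    ((-g) ⊗ₜ x : SuperOp 𝒬) = -(g ⊗ₜ x : SuperOp 𝒬) := TensorProduct.neg_tmul g x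

lemma superOp_neg_mul (x y : SuperOp 𝒬) : -x * y = -(x * y) := neg_mul x y

lemma superOp_mul_neg (x y : SuperOp 𝒬) : x * -y = -(x * y) := mul_neg x y

/-- The generators `θ^a` and `θ̄^a` (with upper indices) of the Grassmann algebra. -/
def gr : Fin 2 ⊕ Fin 2 → Grassmann
  | Sum.inl a => ExteriorAlgebra.ι ℂ (![-Pi.single (Sum.inl 1) 1, Pi.single (Sum.inl 0) 1] a)
  | Sum.inr a => ExteriorAlgebra.ι ℂ (![-Pi.single (Sum.inr 1) 1, Pi.single (Sum.inr 0) 1] a)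

lemma gr_mul_gr_swap (i j : Fin 2 ⊕ Fin 2) : gr i * gr j = -(gr j * gr i) := by
  rcases i with i | i <;> rcases j with j | j <;>
    exact eq_neg_of_add_eq_zero_left (ExteriorAlgebra.ι_add_mul_swap _ _)

lemma theta_eq (a : Fin 2) : theta 𝒬 a = gr (Sum.inl a) ⊗ₜ 𝒬.parity := by
  fin_cases a <;>
    simp [theta, raise, thetaLow, gr, epsUp, epsLow, TensorProduct.neg_tmul]

lemma thetabar_eq (a : Fin 2) : thetabar 𝒬 a = gr (Sum.inr a) ⊗ₜ 𝒬.parity := by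
  fin_cases a <;>
    simp [thetabar, raise, thetabarLow, gr, epsUp, epsLow, TensorProduct.neg_tmul]

/-- In products of two parameters the Klein factors cancel, since the parity operator squares to 1.
-/
lemma thetaSq_eq :
    thetaSq 𝒬 = (2 : ℂ) • ((gr (Sum.inl 0) * gr (Sum.inl 1)) ⊗ₜ (1 : 𝒬.Op)) := by
  have h0 : thetaLow 𝒬 0 = gr (Sum.inl 1) ⊗ₜ 𝒬.parity := by simp [thetaLow, gr]
  have h1 : thetaLow 𝒬 1 = (-gr (Sum.inl 0)) ⊗ₜ 𝒬.parity := by simp [thetaLow, gr]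
  simp only [thetaSq, Fin.sum_univ_two, theta_eq, h0, h1, Algebra.TensorProduct.tmul_mul_tmul,
    𝒬.parity_sq, mul_neg, gr_mul_gr_swap (Sum.inl 1) (Sum.inl 0), neg_neg, two_smul]

lemma thetabarSq_eq :
    thetabarSq 𝒬 = (-2 : ℂ) • ((gr (Sum.inr 0) * gr (Sum.inr 1)) ⊗ₜ (1 : 𝒬.Op)) := by
  have h0 : thetabarLow 𝒬 0 = gr (Sum.inr 1) ⊗ₜ 𝒬.parity := by simp [thetabarLow, gr]
  have h1 : thetabarLow 𝒬 1 = (-gr (Sum.inr 0)) ⊗ₜ 𝒬.parity := by simp [thetabarLow, gr]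
  simp only [thetabarSq, Fin.sum_univ_two, thetabar_eq, h0, h1,
    Algebra.TensorProduct.tmul_mul_tmul, 𝒬.parity_sq,
    gr_mul_gr_swap (Sum.inr 1) (Sum.inr 0), superOp_neg_tmul, superOp_neg_mul]
  module

lemma thetaSigma_eq (μ : Fin 4) : thetaSigma 𝒬 μ =
    ∑ a, ∑ b, pauli μ a b • ((gr (Sum.inl a) * gr (Sum.inr b)) ⊗ₜ (1 : 𝒬.Op)) := by
  simp only [thetaSigma, theta_eq, thetabar_eq, Algebra.TensorProduct.tmul_mul_tmul, 𝒬.parity_sq]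

lemma thetaContr_eq (ψ : Fin 2 → 𝒬.Field) (h : TestFn) :
    thetaContr ψ h = ∑ a, gr (Sum.inl a) ⊗ₜ (𝒬.parity * ψ a h) := by
  simp [thetaContr, theta_eq, lift]

/-- The minus sign is that of moving the contraction: θ̄_ā ψ̄^ā = -θ̄^ā ψ̄_ā. -/
lemma thetabarContr_eq (ψ : Fin 2 → 𝒬.Field) (h : TestFn) :
    thetabarContr ψ h = ∑ a, gr (Sum.inr a) ⊗ₜ (𝒬.parity * -ψ a h) := by
  have h0 : thetabarLow 𝒬 0 = gr (Sum.inr 1) ⊗ₜ 𝒬.parity := by simp [thetabarLow, gr]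
  have h1 : thetabarLow 𝒬 1 = (-gr (Sum.inr 0)) ⊗ₜ 𝒬.parity := by simp [thetabarLow, gr]
  have h2 : raise ψ 0 h = -ψ 1 h := by simp [raise, epsUp, epsLow]
  have h3 : raise ψ 1 h = ψ 0 h := by simp [raise, epsUp, epsLow]
  simp only [thetabarContr, Fin.sum_univ_two, h0, h1, lift, h2, h3,
    Algebra.TensorProduct.tmul_mul_tmul, mul_one, superOp_neg_tmul, superOp_neg_mul, op_mul_neg,
    superOp_tmul_neg, superOp_mul_neg]
  exact add_comm (G := SuperOp 𝒬) _ _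

/-- The coordinate functionals dual to the generators `gr i`. -/
def grDual : Fin 2 ⊕ Fin 2 → Module.Dual ℂ (Fin 2 ⊕ Fin 2 → ℂ)
  | Sum.inl a => ![-LinearMap.proj (Sum.inl 1), LinearMap.proj (Sum.inl 0)] a
  | Sum.inr a => ![-LinearMap.proj (Sum.inr 1), LinearMap.proj (Sum.inr 0)] a

/-- The contraction of a Grassmann element with a dual generator. -/
def contract (i : Fin 2 ⊕ Fin 2) : Grassmann →ₗ[ℂ] Grassmann :=
  CliffordAlgebra.contractLeft (grDual i)

lemma contract_one (i : Fin 2 ⊕ Fin 2) : contract i 1 = 0 :=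
  CliffordAlgebra.contractLeft_one (Q := (0 : QuadraticForm ℂ (Fin 2 ⊕ Fin 2 → ℂ))) _

/-- The exterior algebra is the Clifford algebra of the zero form, and contraction is an
antiderivation. The functional `grCoeff [i, j, ...]` therefore takes the value 1 on the monomial of
distinct generators `gr i * gr j * ...` in the same order. -/
lemma contract_gr_mul (i j : Fin 2 ⊕ Fin 2) (g : Grassmann) :
    contract i (gr j * g) = (if i = j then (1 : ℂ) else 0) • g - gr j * contract i g := by
  rcases i with i | i <;> rcases j with j | j <;>
    refine (CliffordAlgebra.contractLeft_ι_mul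
      (Q := (0 : QuadraticForm ℂ (Fin 2 ⊕ Fin 2 → ℂ))) _ _ g).trans ?_ <;>
    congr 2 <;> fin_cases i <;> fin_cases j <;> simp [grDual]

/-- Iterated contraction, followed by the projection to degree zero. -/
def grCoeff : List (Fin 2 ⊕ Fin 2) → Grassmann →ₗ[ℂ] ℂ
  | [] => ExteriorAlgebra.algebraMapInv.toLinearMap
  | i :: l => grCoeff l ∘ₗ contract i

lemma grCoeff_nil_one : grCoeff [] 1 = 1 := by simp [grCoeff]

lemma grCoeff_cons (i : Fin 2 ⊕ Fin 2) (l) (g : Grassmann) :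
    grCoeff (i :: l) g = grCoeff l (contract i g) := rfl

/-- The coefficient functional `grCoeff l`, acting on operators. -/
def opCoeff (𝒬 : StateSpace H) (l : List (Fin 2 ⊕ Fin 2)) : SuperOp 𝒬 →ₗ[ℂ] 𝒬.Op :=
  (TensorProduct.lid ℂ 𝒬.Op).toLinearMap ∘ₗ LinearMap.rTensor _ (grCoeff l)

lemma opCoeff_tmul (l : List (Fin 2 ⊕ Fin 2)) (g : Grassmann) (A : 𝒬.Op) :
    opCoeff 𝒬 l (g ⊗ₜ A) = grCoeff l g • A := by
  simp [opCoeff]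

/-- The odd element `∑ gr i ⊗ K R_i`, where `K` is the fermion parity. -/
def superSum (R : Fin 2 ⊕ Fin 2 → 𝒬.Op) : SuperOp 𝒬 := ∑ i, gr i ⊗ₜ[ℂ] (𝒬.parity * R i)

variable (R : Fin 2 ⊕ Fin 2 → 𝒬.Op)

/-- The parity operator commutes with an even A, so the plain commutator survives behind one Klein
factor. -/
lemma superSum_commutator_even {g : Grassmann} (hg : ∀ i, g * gr i = gr i * g) {A : 𝒬.Op}
    (hA : IsEven A) : superSum R * (g ⊗ₜ A) - (g ⊗ₜ A) * superSum R =
      ∑ i, (gr i * g) ⊗ₜ[ℂ] (𝒬.parity * (R i * A - A * R i)) := by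
  have hA' (x : 𝒬.Op) : A * (𝒬.parity * x) = 𝒬.parity * (A * x) := by
    rw [← mul_assoc, ← mul_assoc, show A * 𝒬.parity = 𝒬.parity * A from hA.symm]
  simp only [superSum, Finset.sum_mul, Finset.mul_sum, Algebra.TensorProduct.tmul_mul_tmul, hg,
    hA', mul_assoc, ← Finset.sum_sub_distrib, ← TensorProduct.tmul_sub, mul_sub]

/-- Moving one Klein factor past an odd operator costs a sign, as does exchanging the odd Grassmann
elements. Together they turn the commutator of super-operators into an anticommutator of operators.
-/
lemma superSum_commutator_odd (hR : ∀ i, IsOdd (R i)) {g : Grassmann}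
    (hg : ∀ i, g * gr i = -(gr i * g)) {A : 𝒬.Op}
    (hA : IsOdd A) : superSum R * (g ⊗ₜ (𝒬.parity * A)) - (g ⊗ₜ (𝒬.parity * A)) * superSum R =
      -∑ i, (gr i * g) ⊗ₜ[ℂ] (R i * A + A * R i) := by
  have hK {A : 𝒬.Op} (hA : IsOdd A) (x : 𝒬.Op) :
      𝒬.parity * A * (𝒬.parity * x) = -(A * x) := by
    rw [← mul_assoc, mul_assoc _ A, show A * 𝒬.parity = -(𝒬.parity * A) by
      rw [show 𝒬.parity * A = -(A * 𝒬.parity) from hA, neg_neg], op_mul_neg, ← mul_assoc,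
      𝒬.parity_sq, one_mul, op_neg_mul]
  simp only [superSum, Finset.sum_mul, Finset.mul_sum, Algebra.TensorProduct.tmul_mul_tmul, hg,
    hK hA, hK (hR _), ← Finset.sum_sub_distrib, ← Finset.sum_neg_distrib]
  refine Finset.sum_congr rfl fun i _ => ?_
  rw [superOp_tmul_neg, superOp_tmul_neg, superOp_neg_tmul, TensorProduct.tmul_add]
  abel

lemma superSum_commutator_superSum (hR : ∀ i, IsOdd (R i)) {ψ : Fin 2 ⊕ Fin 2 → 𝒬.Op}
    (hψ : ∀ i, IsOdd (ψ i)) : superSum R * superSum ψ - superSum ψ * superSum R =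
      -∑ j, ∑ i, (gr i * gr j) ⊗ₜ[ℂ] (R i * ψ j + ψ j * R i) := by
  conv_lhs => simp only [superSum, Finset.mul_sum (f := fun i => gr i ⊗ₜ[ℂ] (𝒬.parity * ψ i)),
    Finset.sum_mul (f := fun i => gr i ⊗ₜ[ℂ] (𝒬.parity * ψ i)), ← Finset.sum_sub_distrib]
  rw [← Finset.sum_neg_distrib]
  exact Finset.sum_congr rfl fun j _ =>
    superSum_commutator_odd R hR (fun i => gr_mul_gr_swap _ _) (hψ j)

lemma parity_mul_injective {x y : 𝒬.Op} (hxy : 𝒬.parity * x = 𝒬.parity * y) : x = y := by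
  rw [← one_mul x, ← one_mul y, ← 𝒬.parity_sq, mul_assoc, hxy, mul_assoc]

lemma superSum_injective {ψ ψ' : Fin 2 ⊕ Fin 2 → 𝒬.Op} (h : superSum ψ = superSum ψ') :
    ψ = ψ' := by
  ext1 i
  have h1 (j) : grCoeff [i] (gr j) = if i = j then 1 else 0 := by
    rw [grCoeff_cons, ← mul_one (gr j), contract_gr_mul, contract_one, mul_zero, sub_zero,
      map_smul, grCoeff_nil_one, smul_eq_mul, mul_one]
  have := congrArg (opCoeff 𝒬 [i]) h
  simp only [superSum, map_sum, opCoeff_tmul, h1, ite_smul, one_smul,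
    zero_smul, Finset.sum_ite_eq, Finset.mem_univ, if_true] at this
  exact parity_mul_injective this

end Coefficients

/-! ### Component identities in Grassmann degrees one to four. -/

section Components

variable {H : Type*} [NormedAddCommGroup H] [InnerProductSpace ℂ H] {𝒬 : StateSpace H}

open StateSpace

lemma contract_gr (i j : Fin 2 ⊕ Fin 2) :
    contract i (gr j) = (if i = j then (1 : ℂ) else 0) • 1 := by
  rw [← mul_one (gr j), contract_gr_mul, contract_one, mul_zero, sub_zero]

variable {R ψ : Fin 2 ⊕ Fin 2 → 𝒬.Op}

lemma degree_one_components {A : 𝒬.Op} (hA : IsEven A)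
    (h : superSum R * lift 𝒬 A - lift 𝒬 A * superSum R = superSum ψ) (i : Fin 2 ⊕ Fin 2) :
    R i * A - A * R i = ψ i := by
  rw [lift, superSum_commutator_even R (fun i => by rw [one_mul, mul_one]) hA] at h
  simp only [mul_one] at h
  exact congrFun (superSum_injective h) i

/-- The component of degree two of a superfield. -/
def degTwo (A B : 𝒬.Op) (W : Fin 2 → Fin 2 → 𝒬.Op) : SuperOp 𝒬 :=
  (gr (Sum.inl 0) * gr (Sum.inl 1)) ⊗ₜ A + (gr (Sum.inr 0) * gr (Sum.inr 1)) ⊗ₜ B +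
    ∑ a, ∑ b, (gr (Sum.inl a) * gr (Sum.inr b)) ⊗ₜ W a b

/-- The component of degree three of a superfield. -/
def degThree (L L' : Fin 2 → 𝒬.Op) : SuperOp 𝒬 :=
  ∑ b, (gr (Sum.inl 0) * (gr (Sum.inl 1) * gr (Sum.inr b))) ⊗ₜ (𝒬.parity * L b) +
    ∑ a, (gr (Sum.inr 0) * (gr (Sum.inr 1) * gr (Sum.inl a))) ⊗ₜ (𝒬.parity * L' a)

set_option maxHeartbeats 1000000 in
lemma degree_two_components (hR : ∀ i, IsOdd (R i)) (hψ : ∀ i, IsOdd (ψ i)) {A B : 𝒬.Op}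
    {W : Fin 2 → Fin 2 → 𝒬.Op}
    (h : superSum R * superSum ψ - superSum ψ * superSum R = degTwo A B W) :
    (R (Sum.inl 1) * ψ (Sum.inl 0) + ψ (Sum.inl 0) * R (Sum.inl 1)) -
      (R (Sum.inl 0) * ψ (Sum.inl 1) + ψ (Sum.inl 1) * R (Sum.inl 0)) = A ∧
    (R (Sum.inr 1) * ψ (Sum.inr 0) + ψ (Sum.inr 0) * R (Sum.inr 1)) -
      (R (Sum.inr 0) * ψ (Sum.inr 1) + ψ (Sum.inr 1) * R (Sum.inr 0)) = B ∧
    ∀ a b, (R (Sum.inr b) * ψ (Sum.inl a) + ψ (Sum.inl a) * R (Sum.inr b)) -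
      (R (Sum.inl a) * ψ (Sum.inr b) + ψ (Sum.inr b) * R (Sum.inl a)) = W a b := by
  rw [superSum_commutator_superSum R hR hψ, degTwo] at h
  have key (i j) := congrArg (opCoeff 𝒬 [i, j]) h
  refine ⟨?_, ?_, Fin.forall_fin_two.2 ⟨Fin.forall_fin_two.2 ⟨?_, ?_⟩,
    Fin.forall_fin_two.2 ⟨?_, ?_⟩⟩⟩
  · have := key (Sum.inl 0) (Sum.inl 1)
    simp [Fintype.sum_sum_type, opCoeff_tmul, grCoeff_cons, contract_gr_mul, contract_gr,
      grCoeff_nil_one] at this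
    rw [← this]; abel
  · have := key (Sum.inr 0) (Sum.inr 1)
    simp [Fintype.sum_sum_type, opCoeff_tmul, grCoeff_cons, contract_gr_mul, contract_gr,
      grCoeff_nil_one] at this
    rw [← this]; abel
  · have := key (Sum.inl 0) (Sum.inr 0)
    simp [Fintype.sum_sum_type, opCoeff_tmul, grCoeff_cons, contract_gr_mul, contract_gr,
      grCoeff_nil_one] at this
    rw [← this]; abel
  · have := key (Sum.inl 0) (Sum.inr 1)
    simp [Fintype.sum_sum_type, opCoeff_tmul, grCoeff_cons, contract_gr_mul, contract_gr,
      grCoeff_nil_one] at this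
    rw [← this]; abel
  · have := key (Sum.inl 1) (Sum.inr 0)
    simp [Fintype.sum_sum_type, opCoeff_tmul, grCoeff_cons, contract_gr_mul, contract_gr,
      grCoeff_nil_one] at this
    rw [← this]; abel
  · have := key (Sum.inl 1) (Sum.inr 1)
    simp [Fintype.sum_sum_type, opCoeff_tmul, grCoeff_cons, contract_gr_mul, contract_gr,
      grCoeff_nil_one] at this
    rw [← this]; abel

lemma gr_mul_gr_commute (i j k : Fin 2 ⊕ Fin 2) :
    gr i * gr j * gr k = gr k * (gr i * gr j) := by
  rw [mul_assoc, gr_mul_gr_swap j k, mul_neg, ← mul_assoc, gr_mul_gr_swap i k, neg_mul, neg_neg,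
    mul_assoc]

set_option maxHeartbeats 1000000 in
lemma degree_three_components {A B : 𝒬.Op} {W : Fin 2 → Fin 2 → 𝒬.Op} {L L' : Fin 2 → 𝒬.Op}
    (hA : IsEven A) (hB : IsEven B) (hW : ∀ a b, IsEven (W a b))
    (h : superSum R * degTwo A B W - degTwo A B W * superSum R = degThree L L') :
    (∀ b, (R (Sum.inr b) * A - A * R (Sum.inr b)) -
      (R (Sum.inl 1) * W 0 b - W 0 b * R (Sum.inl 1)) +
      (R (Sum.inl 0) * W 1 b - W 1 b * R (Sum.inl 0)) = L b) ∧
    ∀ a, (R (Sum.inl a) * B - B * R (Sum.inl a)) +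
      (R (Sum.inr 1) * W a 0 - W a 0 * R (Sum.inr 1)) -
      (R (Sum.inr 0) * W a 1 - W a 1 * R (Sum.inr 0)) = L' a := by
  have e : superSum R * degTwo A B W - degTwo A B W * superSum R =
      ∑ i, (gr i * (gr (Sum.inl 0) * gr (Sum.inl 1))) ⊗ₜ[ℂ] (𝒬.parity * (R i * A - A * R i)) +
      ∑ i, (gr i * (gr (Sum.inr 0) * gr (Sum.inr 1))) ⊗ₜ[ℂ] (𝒬.parity * (R i * B - B * R i)) +
      ∑ a, ∑ b, ∑ i, (gr i * (gr (Sum.inl a) * gr (Sum.inr b))) ⊗ₜ[ℂ]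
        (𝒬.parity * (R i * W a b - W a b * R i)) := by
    rw [← superSum_commutator_even R (fun k => gr_mul_gr_commute _ _ k) hA,
      ← superSum_commutator_even R (fun k => gr_mul_gr_commute _ _ k) hB]
    simp_rw [← superSum_commutator_even R (fun k => gr_mul_gr_commute _ _ k) (hW _ _)]
    simp only [degTwo, mul_add, add_mul, Finset.mul_sum, Finset.sum_mul, Finset.sum_sub_distrib]
    abel
  rw [e, degThree] at h
  have key (i j k) := congrArg (opCoeff 𝒬 [i, j, k]) h
  refine ⟨Fin.forall_fin_two.2 ⟨?_, ?_⟩, Fin.forall_fin_two.2 ⟨?_, ?_⟩⟩ <;>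
    refine parity_mul_injective ?_
  · have := key (Sum.inl 0) (Sum.inl 1) (Sum.inr 0)
    simp [Fintype.sum_sum_type, opCoeff_tmul, grCoeff_cons, contract_gr_mul, contract_gr,
      grCoeff_nil_one] at this
    rw [← this]; simp only [mul_add, mul_sub]; module
  · have := key (Sum.inl 0) (Sum.inl 1) (Sum.inr 1)
    simp [Fintype.sum_sum_type, opCoeff_tmul, grCoeff_cons, contract_gr_mul, contract_gr,
      grCoeff_nil_one] at this
    rw [← this]; simp only [mul_add, mul_sub]; module
  · have := key (Sum.inr 0) (Sum.inr 1) (Sum.inl 0)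
    simp [Fintype.sum_sum_type, opCoeff_tmul, grCoeff_cons, contract_gr_mul, contract_gr,
      grCoeff_nil_one] at this
    rw [← this]; simp only [mul_add, mul_sub]; module
  · have := key (Sum.inr 0) (Sum.inr 1) (Sum.inl 1)
    simp [Fintype.sum_sum_type, opCoeff_tmul, grCoeff_cons, contract_gr_mul, contract_gr,
      grCoeff_nil_one] at this
    rw [← this]; simp only [mul_add, mul_sub]; module

lemma gr_mul_gr_mul_gr_swap (i j k l : Fin 2 ⊕ Fin 2) :
    gr i * (gr j * gr k) * gr l = -(gr l * (gr i * (gr j * gr k))) := by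
  rw [mul_assoc, gr_mul_gr_commute, ← mul_assoc, gr_mul_gr_swap i l, neg_mul, mul_assoc]

lemma degree_four_components (hR : ∀ i, IsOdd (R i)) {L L' : Fin 2 → 𝒬.Op} {D : 𝒬.Op}
    (hL : ∀ a, IsOdd (L a)) (hL' : ∀ a, IsOdd (L' a))
    (h : superSum R * degThree L L' - degThree L L' * superSum R =
      (gr (Sum.inl 0) * (gr (Sum.inl 1) * (gr (Sum.inr 0) * gr (Sum.inr 1)))) ⊗ₜ D) :
    (R (Sum.inr 1) * L 0 + L 0 * R (Sum.inr 1)) - (R (Sum.inr 0) * L 1 + L 1 * R (Sum.inr 0)) +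
      ((R (Sum.inl 1) * L' 0 + L' 0 * R (Sum.inl 1)) -
        (R (Sum.inl 0) * L' 1 + L' 1 * R (Sum.inl 0))) = D := by
  have e : superSum R * degThree L L' - degThree L L' * superSum R =
      ∑ b, -∑ i, (gr i * (gr (Sum.inl 0) * (gr (Sum.inl 1) * gr (Sum.inr b)))) ⊗ₜ[ℂ]
        (R i * L b + L b * R i) +
      ∑ a, -∑ i, (gr i * (gr (Sum.inr 0) * (gr (Sum.inr 1) * gr (Sum.inl a)))) ⊗ₜ[ℂ]
        (R i * L' a + L' a * R i) := by
    simp_rw [← superSum_commutator_odd R hR (fun k => gr_mul_gr_mul_gr_swap _ _ _ k) (hL _),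
      ← superSum_commutator_odd R hR (fun k => gr_mul_gr_mul_gr_swap _ _ _ k) (hL' _)]
    simp only [degThree, mul_add, add_mul, Finset.mul_sum, Finset.sum_mul, Finset.sum_sub_distrib]
    abel
  rw [e] at h
  have := congrArg (opCoeff 𝒬 [Sum.inl 0, Sum.inl 1, Sum.inr 0, Sum.inr 1]) h
  simp [Fintype.sum_sum_type, opCoeff_tmul, grCoeff_cons, contract_gr_mul, contract_gr,
    grCoeff_nil_one] at this
  rw [← this]; abel

end Components

/-! ### Jacobi identities and operator-valued bidistributions. -/

/-! ### Graded commutators of fields -/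

section Brackets

variable {H : Type*} [NormedAddCommGroup H] [InnerProductSpace ℂ H] {𝒬 : StateSpace H}

open StateSpace

/-- The commutator `[R, φ]` of an operator with a field. -/
def ad (R : 𝒬.Op) : 𝒬.Field →ₗ[ℂ] 𝒬.Field where
  toFun φ :=
    { toFun := fun h => R * φ h - φ h * R
      map_add' := fun f g => by simp only [map_add, mul_add, add_mul]; abel
      map_smul' := fun t f => by
        simp only [map_smul, mul_smul_comm, smul_mul_assoc, smul_sub, RingHom.id_apply] }
  map_add' φ ψ := by
    ext1 h
    change R * (φ h + ψ h) - (φ h + ψ h) * R = (R * φ h - φ h * R) + (R * ψ h - ψ h * R)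
    simp only [mul_add, add_mul]; abel
  map_smul' z φ := by
    ext1 h
    change R * (z • φ h) - (z • φ h) * R = z • (R * φ h - φ h * R)
    rw [mul_smul_comm, smul_mul_assoc, smul_sub]

/-- The anticommutator `{R, φ}` of an operator with a field. -/
def aad (R : 𝒬.Op) : 𝒬.Field →ₗ[ℂ] 𝒬.Field where
  toFun φ :=
    { toFun := fun h => R * φ h + φ h * R
      map_add' := fun f g => by simp only [map_add, mul_add, add_mul]; abel
      map_smul' := fun t f => by
        simp only [map_smul, mul_smul_comm, smul_mul_assoc, smul_add, RingHom.id_apply] }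
  map_add' φ ψ := by
    ext1 h
    change R * (φ h + ψ h) + (φ h + ψ h) * R = (R * φ h + φ h * R) + (R * ψ h + ψ h * R)
    simp only [mul_add, add_mul]; abel
  map_smul' z φ := by
    ext1 h
    change R * (z • φ h) + (z • φ h) * R = z • (R * φ h + φ h * R)
    rw [mul_smul_comm, smul_mul_assoc, smul_add]

lemma ad_apply (R : 𝒬.Op) (φ : 𝒬.Field) (h : TestFn) : ad R φ h = R * φ h - φ h * R := rfl

lemma aad_apply (R : 𝒬.Op) (φ : 𝒬.Field) (h : TestFn) : aad R φ h = R * φ h + φ h * R := rfl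

/-- `φ ↦ ∂_μ φ` as a linear map. -/
def fieldDerivₗ (μ : Fin 4) : 𝒬.Field →ₗ[ℂ] 𝒬.Field where
  toFun := fieldDeriv μ
  map_add' φ ψ := by
    ext1 h; change -(φ (pd μ h) + ψ (pd μ h)) = -φ (pd μ h) + -ψ (pd μ h); abel
  map_smul' z φ := by ext1 h; change -(z • φ (pd μ h)) = z • -φ (pd μ h); rw [smul_neg]

lemma fieldDeriv_apply (μ : Fin 4) (φ : 𝒬.Field) (h : TestFn) :
    fieldDeriv μ φ h = -φ (pd μ h) := rfl

lemma fieldDeriv_comm (μ ν : Fin 4) (φ : 𝒬.Field) :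
    fieldDeriv μ (fieldDeriv ν φ) = fieldDeriv ν (fieldDeriv μ φ) := by
  ext1 h; simp only [fieldDeriv_apply, pd_comm μ ν]

/-- `σ^μ_{a b̄} ∂_μ φ`. -/
def sigmaDeriv (a b : Fin 2) : 𝒬.Field →ₗ[ℂ] 𝒬.Field := ∑ μ, pauli μ a b • fieldDerivₗ μ

lemma sigmaDeriv_apply (a b : Fin 2) (φ : 𝒬.Field) :
    sigmaDeriv a b φ = ∑ μ, pauli μ a b • fieldDeriv μ φ := by
  simp [sigmaDeriv, fieldDerivₗ, LinearMap.sum_apply]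

/-- `σ^μ_{a b̄} v_μ`. -/
def slash (v : Fin 4 → 𝒬.Field) (a b : Fin 2) : 𝒬.Field := ∑ μ, pauli μ a b • v μ

lemma ad_fieldDeriv (R : 𝒬.Op) (μ : Fin 4) (φ : 𝒬.Field) :
    ad R (fieldDeriv μ φ) = fieldDeriv μ (ad R φ) := by
  ext1 h; simp only [ad_apply, fieldDeriv_apply, op_mul_neg, op_neg_mul]; abel

lemma aad_fieldDeriv (R : 𝒬.Op) (μ : Fin 4) (φ : 𝒬.Field) :
    aad R (fieldDeriv μ φ) = fieldDeriv μ (aad R φ) := by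
  ext1 h; simp only [aad_apply, fieldDeriv_apply, op_mul_neg, op_neg_mul]; abel

lemma ad_sigmaDeriv (R : 𝒬.Op) (a b : Fin 2) (φ : 𝒬.Field) :
    ad R (sigmaDeriv a b φ) = sigmaDeriv a b (ad R φ) := by
  simp only [sigmaDeriv_apply, map_sum, map_smul, ad_fieldDeriv]

lemma aad_sigmaDeriv (R : 𝒬.Op) (a b : Fin 2) (φ : 𝒬.Field) :
    aad R (sigmaDeriv a b φ) = sigmaDeriv a b (aad R φ) := by
  simp only [sigmaDeriv_apply, map_sum, map_smul, aad_fieldDeriv]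

/-- The Jacobi identity for two odd operators and an even field. -/
lemma aad_ad_add_aad_ad (R R' : 𝒬.Op) (φ : 𝒬.Field) :
    aad R (ad R' φ) + aad R' (ad R φ) = ad (R * R' + R' * R) φ := by
  ext1 h
  simp only [LinearMap.add_apply, aad_apply, ad_apply, mul_add, add_mul, mul_sub, sub_mul,
    mul_assoc]
  abel

/-- The Jacobi identity for two odd operators and an odd field. -/
lemma ad_aad_add_ad_aad (R R' : 𝒬.Op) (φ : 𝒬.Field) :
    ad R (aad R' φ) + ad R' (aad R φ) = ad (R * R' + R' * R) φ := by
  ext1 h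
  simp only [LinearMap.add_apply, aad_apply, ad_apply, mul_add, add_mul,
    mul_assoc]
  abel

/-- The commutator `[φ(x), ψ(y)]`. -/
def cm : 𝒬.Field →ₗ[ℂ] 𝒬.Field →ₗ[ℂ] (TestFn → TestFn → 𝒬.Op) :=
  LinearMap.mk₂ ℂ (fun φ ψ f g => φ f * ψ g - ψ g * φ f)
    (fun φ φ' ψ => by
      ext1 f; ext1 g
      change (φ f + φ' f) * ψ g - ψ g * (φ f + φ' f) =
        (φ f * ψ g - ψ g * φ f) + (φ' f * ψ g - ψ g * φ' f)
      simp only [mul_add, add_mul]; abel)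
    (fun z φ ψ => by
      ext1 f; ext1 g
      change (z • φ f) * ψ g - ψ g * (z • φ f) = z • (φ f * ψ g - ψ g * φ f)
      rw [mul_smul_comm, smul_mul_assoc, smul_sub])
    (fun φ ψ ψ' => by
      ext1 f; ext1 g
      change φ f * (ψ g + ψ' g) - (ψ g + ψ' g) * φ f =
        (φ f * ψ g - ψ g * φ f) + (φ f * ψ' g - ψ' g * φ f)
      simp only [mul_add, add_mul]; abel)
    (fun z φ ψ => by
      ext1 f; ext1 g
      change φ f * (z • ψ g) - (z • ψ g) * φ f = z • (φ f * ψ g - ψ g * φ f)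
      rw [mul_smul_comm, smul_mul_assoc, smul_sub])

/-- The anticommutator `{φ(x), ψ(y)}`. -/
def am : 𝒬.Field →ₗ[ℂ] 𝒬.Field →ₗ[ℂ] (TestFn → TestFn → 𝒬.Op) :=
  LinearMap.mk₂ ℂ (fun φ ψ f g => φ f * ψ g + ψ g * φ f)
    (fun φ φ' ψ => by
      ext1 f; ext1 g
      change (φ f + φ' f) * ψ g + ψ g * (φ f + φ' f) =
        (φ f * ψ g + ψ g * φ f) + (φ' f * ψ g + ψ g * φ' f)
      simp only [mul_add, add_mul]; abel)
    (fun z φ ψ => by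
      ext1 f; ext1 g
      change (z • φ f) * ψ g + ψ g * (z • φ f) = z • (φ f * ψ g + ψ g * φ f)
      rw [mul_smul_comm, smul_mul_assoc, smul_add])
    (fun φ ψ ψ' => by
      ext1 f; ext1 g
      change φ f * (ψ g + ψ' g) + (ψ g + ψ' g) * φ f =
        (φ f * ψ g + ψ g * φ f) + (φ f * ψ' g + ψ' g * φ f)
      simp only [mul_add, add_mul]; abel)
    (fun z φ ψ => by
      ext1 f; ext1 g
      change φ f * (z • ψ g) + (z • ψ g) * φ f = z • (φ f * ψ g + ψ g * φ f)
      rw [mul_smul_comm, smul_mul_assoc, smul_add])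

lemma cm_apply (φ ψ : 𝒬.Field) (f g : TestFn) : cm φ ψ f g = φ f * ψ g - ψ g * φ f := rfl

lemma am_apply (φ ψ : 𝒬.Field) (f g : TestFn) : am φ ψ f g = φ f * ψ g + ψ g * φ f := rfl

/-- A kernel as a multiple of the identity operator. -/
def scalarK (𝒬 : StateSpace H) : Kernel →ₗ[ℂ] (TestFn → TestFn → 𝒬.Op) where
  toFun K f g := K f g • 1
  map_add' K K' := by
    ext1 f; ext1 g; exact add_smul (K f g) (K' f g) (1 : 𝒬.Op)
  map_smul' z K := by
    ext1 f; ext1 g; exact mul_smul z (K f g) (1 : 𝒬.Op)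

/-- Acting on the nonzero vacuum recovers the scalar. -/
lemma scalarK_injective : Function.Injective (scalarK 𝒬) := by
  refine (injective_iff_map_eq_zero _).2 fun K hK => ?_
  ext f g
  have h1 : (K f g • (1 : 𝒬.Op)) 𝒬.vacuum = 0 := by
    have : K f g • (1 : 𝒬.Op) = 0 := congrFun (congrFun hK f) g
    rw [this]; rfl
  exact (smul_eq_zero.1 (show K f g • 𝒬.vacuum = 0 from h1)).resolve_right 𝒬.vacuum_ne_zero

lemma comm_iff {φ ψ : 𝒬.Field} {K : Kernel} : Comm φ ψ K ↔ cm φ ψ = scalarK 𝒬 K :=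
  ⟨fun h => by ext1 f; ext1 g; exact h f g, fun h f g => congrFun (congrFun h f) g⟩

lemma anticomm_iff {φ ψ : 𝒬.Field} {K : Kernel} : Anticomm φ ψ K ↔ am φ ψ = scalarK 𝒬 K :=
  ⟨fun h => by ext1 f; ext1 g; exact h f g, fun h f g => congrFun (congrFun h f) g⟩

/-- The derivative `∂/∂x^μ` of a bidistribution. -/
def derivLeft (V : Type*) [AddCommGroup V] [Module ℂ V] (μ : Fin 4) :
    (TestFn → TestFn → V) →ₗ[ℂ] (TestFn → TestFn → V) where
  toFun K f g := -K (pd μ f) g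
  map_add' K K' := by
    ext1 f; ext1 g; exact neg_add _ _
  map_smul' z K := by ext1 f; ext1 g; exact (smul_neg z (K (pd μ f) g)).symm

/-- The derivative `∂/∂y^μ` of a bidistribution. -/
def derivRight (V : Type*) [AddCommGroup V] [Module ℂ V] (μ : Fin 4) :
    (TestFn → TestFn → V) →ₗ[ℂ] (TestFn → TestFn → V) where
  toFun K f g := -K f (pd μ g)
  map_add' K K' := by
    ext1 f; ext1 g; exact neg_add _ _
  map_smul' z K := by ext1 f; ext1 g; exact (smul_neg z (K f (pd μ g))).symm

/-- The exchange of the two arguments of a bidistribution. -/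
def swapArgs (V : Type*) [AddCommGroup V] [Module ℂ V] :
    (TestFn → TestFn → V) →ₗ[ℂ] (TestFn → TestFn → V) where
  toFun K f g := K g f
  map_add' _ _ := rfl
  map_smul' _ _ := rfl

lemma scalarK_derivLeft (μ : Fin 4) (K : Kernel) :
    derivLeft 𝒬.Op μ (scalarK 𝒬 K) = scalarK 𝒬 (derivLeft ℂ μ K) := by
  ext1 f; ext1 g; exact (neg_smul (K (pd μ f) g) (1 : 𝒬.Op)).symm

lemma scalarK_derivRight (μ : Fin 4) (K : Kernel) :
    derivRight 𝒬.Op μ (scalarK 𝒬 K) = scalarK 𝒬 (derivRight ℂ μ K) := by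
  ext1 f; ext1 g; exact (neg_smul (K f (pd μ g)) (1 : 𝒬.Op)).symm

lemma scalarK_swapArgs (K : Kernel) :
    swapArgs 𝒬.Op (scalarK 𝒬 K) = scalarK 𝒬 (swapArgs ℂ K) := rfl

lemma cm_fieldDeriv_left (μ : Fin 4) (φ ψ : 𝒬.Field) :
    cm (fieldDeriv μ φ) ψ = derivLeft 𝒬.Op μ (cm φ ψ) := by
  ext1 f; ext1 g
  change -φ (pd μ f) * ψ g - ψ g * -φ (pd μ f) = -(φ (pd μ f) * ψ g - ψ g * φ (pd μ f))
  rw [op_neg_mul, op_mul_neg]; abel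

lemma cm_fieldDeriv_right (μ : Fin 4) (φ ψ : 𝒬.Field) :
    cm φ (fieldDeriv μ ψ) = derivRight 𝒬.Op μ (cm φ ψ) := by
  ext1 f; ext1 g
  change φ f * -ψ (pd μ g) - -ψ (pd μ g) * φ f = -(φ f * ψ (pd μ g) - ψ (pd μ g) * φ f)
  rw [op_neg_mul, op_mul_neg]; abel

lemma am_fieldDeriv_left (μ : Fin 4) (φ ψ : 𝒬.Field) :
    am (fieldDeriv μ φ) ψ = derivLeft 𝒬.Op μ (am φ ψ) := by
  ext1 f; ext1 g
  change -φ (pd μ f) * ψ g + ψ g * -φ (pd μ f) = -(φ (pd μ f) * ψ g + ψ g * φ (pd μ f))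
  rw [op_neg_mul, op_mul_neg]; abel

lemma am_fieldDeriv_right (μ : Fin 4) (φ ψ : 𝒬.Field) :
    am φ (fieldDeriv μ ψ) = derivRight 𝒬.Op μ (am φ ψ) := by
  ext1 f; ext1 g
  change φ f * -ψ (pd μ g) + -ψ (pd μ g) * φ f = -(φ f * ψ (pd μ g) + ψ (pd μ g) * φ f)
  rw [op_neg_mul, op_mul_neg]; abel

lemma cm_swap (φ ψ : 𝒬.Field) : cm ψ φ = -swapArgs 𝒬.Op (cm φ ψ) := by
  ext1 f; ext1 g; exact (neg_sub _ _).symm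

lemma am_swap (φ ψ : 𝒬.Field) : am ψ φ = swapArgs 𝒬.Op (am φ ψ) := by
  ext1 f; ext1 g; exact add_comm _ _

/-- The Jacobi identity for an odd operator and vanishing `[φ, ψ]`, with `φ` even and `ψ` odd. -/
lemma am_ad_left (R : 𝒬.Op) {φ ψ : 𝒬.Field} (h : cm φ ψ = 0) :
    am (ad R φ) ψ = -cm φ (aad R ψ) := by
  ext1 f; ext1 g
  have h0 : φ f * ψ g - ψ g * φ f = 0 := congrFun (congrFun h f) g
  change am (ad R φ) ψ f g = -cm φ (aad R ψ) f g
  have h1 : am (ad R φ) ψ f g + cm φ (aad R ψ) f g =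
      R * (φ f * ψ g - ψ g * φ f) + (φ f * ψ g - ψ g * φ f) * R := by
    simp only [am_apply, cm_apply, ad_apply, aad_apply, mul_add, add_mul, mul_sub, sub_mul,
      mul_assoc]
    abel
  rw [h0, mul_zero, zero_mul, add_zero] at h1
  exact eq_neg_of_add_eq_zero_left h1

/-- The Jacobi identity for an odd operator and vanishing `[ψ, φ]`, with `φ` even and `ψ` odd. -/
lemma am_ad_right (R : 𝒬.Op) {φ ψ : 𝒬.Field} (h : cm ψ φ = 0) :
    am ψ (ad R φ) = cm (aad R ψ) φ := by
  ext1 f; ext1 g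
  have h0 : ψ f * φ g - φ g * ψ f = 0 := congrFun (congrFun h f) g
  have h1 : cm (aad R ψ) φ f g - am ψ (ad R φ) f g =
      R * (ψ f * φ g - φ g * ψ f) + (ψ f * φ g - φ g * ψ f) * R := by
    simp only [am_apply, cm_apply, ad_apply, aad_apply, mul_add, add_mul, mul_sub, sub_mul,
      mul_assoc]
    abel
  rw [h0, mul_zero, zero_mul, add_zero] at h1
  exact (sub_eq_zero.1 h1).symm

/-- The Jacobi identity for an operator and a scalar commutator. -/
lemma cm_ad_add_cm_ad (R : 𝒬.Op) {φ ψ : 𝒬.Field} {K : Kernel} (h : cm φ ψ = scalarK 𝒬 K) :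
    cm (ad R φ) ψ + cm φ (ad R ψ) = 0 := by
  ext1 f; ext1 g
  have h0 : φ f * ψ g - ψ g * φ f = K f g • 1 := congrFun (congrFun h f) g
  have h1 : cm (ad R φ) ψ f g + cm φ (ad R ψ) f g =
      R * (φ f * ψ g - ψ g * φ f) - (φ f * ψ g - ψ g * φ f) * R := by
    simp only [cm_apply, ad_apply, mul_sub, sub_mul, mul_assoc]
    abel
  rw [h0, mul_smul_comm, smul_mul_assoc, mul_one, one_mul, sub_self] at h1
  exact h1

/-- Inversion of the Pauli matrices. -/
lemma eq_zero_of_sum_pauli_smul {V : Type*} [AddCommGroup V] [Module ℂ V] {X : Fin 4 → V}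
    (h : ∀ a b, ∑ μ, pauli μ a b • X μ = 0) (μ : Fin 4) : X μ = 0 := by
  have h00 := h 0 0
  have h01 := h 0 1
  have h10 := h 1 0
  have h11 := h 1 1
  simp [Fin.sum_univ_four, pauli] at h00 h01 h10 h11
  have hI : Complex.I * Complex.I = -1 := Complex.I_mul_I
  fin_cases μ
  · change X 0 = 0
    linear_combination (norm := module) (1 / 2 : ℂ) • h00 + (1 / 2 : ℂ) • h11
  · change X 1 = 0
    linear_combination (norm := module) (1 / 2 : ℂ) • h01 + (1 / 2 : ℂ) • h10
  · change X 2 = 0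
    have h2 : (2 * Complex.I) • X 2 = 0 := by
      linear_combination (norm := module) h10 - h01
    exact (smul_eq_zero.1 h2).resolve_left (by simp)
  · change X 3 = 0
    linear_combination (norm := module) (1 / 2 : ℂ) • h00 - (1 / 2 : ℂ) • h11

end Brackets

/-! ### Free fields -/

section Free

variable {H : Type*} [NormedAddCommGroup H] [InnerProductSpace ℂ H] {𝒬 : StateSpace H}

open StateSpace

namespace StateSpace.IsAdjoint

lemma mul {A B A' B' : 𝒬.Op} (h : IsAdjoint A B) (h' : IsAdjoint A' B') :
    IsAdjoint (A * A') (B' * B) := fun _ _ => (h _ _).trans (h' _ _)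

lemma add {A B A' B' : 𝒬.Op} (h : IsAdjoint A B) (h' : IsAdjoint A' B') :
    IsAdjoint (A + A') (B + B') := fun x y => by
  change 𝒬.form (A x + A' x) y = 𝒬.form x (B y + B' y)
  rw [map_add, map_add, LinearMap.add_apply, h x y, h' x y]

lemma smul_one (𝒬 : StateSpace H) (z : ℂ) :
    IsAdjoint (z • (1 : 𝒬.Op)) (conj z • (1 : 𝒬.Op)) := fun x y => by
  change 𝒬.form (z • x) y = 𝒬.form x (conj z • y)
  rw [𝒬.form.map_smulₛₗ z x, (𝒬.form x).map_smul (conj z) y]; rfl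

lemma unique {A B B' : 𝒬.Op} (h : IsAdjoint A B) (h' : IsAdjoint A B') : B = B' := by
  refine LinearMap.ext fun y => ?_
  rw [← sub_eq_zero]
  refine 𝒬.form_nondeg _ fun x => ?_
  rw [← 𝒬.form_conj, map_sub, ← h x y, ← h' x y, sub_self, map_zero]

end StateSpace.IsAdjoint

lemma op_neg_eq_smul (A : 𝒬.Op) : -A = (-1 : ℂ) • A := (neg_one_smul ℂ A).symm

lemma isEven_sum_smul {ι : Type*} [Fintype ι] (z : ι → ℂ) {A : ι → 𝒬.Op}
    (hA : ∀ i, IsEven (A i)) : IsEven (∑ i, z i • A i) := by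
  change 𝒬.parity * _ = _ * 𝒬.parity
  rw [Finset.mul_sum, Finset.sum_mul]
  refine Finset.sum_congr rfl fun i _ => ?_
  rw [mul_smul_comm, smul_mul_assoc, show 𝒬.parity * A i = _ from hA i]

lemma isOdd_sum_smul {ι : Type*} [Fintype ι] (z : ι → ℂ) {A : ι → 𝒬.Op}
    (hA : ∀ i, IsOdd (A i)) : IsOdd (∑ i, z i • A i) := by
  change 𝒬.parity * _ = -(_ * 𝒬.parity)
  rw [Finset.mul_sum, Finset.sum_mul, ← Finset.sum_neg_distrib]
  refine Finset.sum_congr rfl fun i _ => ?_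
  rw [mul_smul_comm, smul_mul_assoc, show 𝒬.parity * A i = _ from hA i, smul_neg]

lemma isEven_add {A B : 𝒬.Op} (hA : IsEven A) (hB : IsEven B) : IsEven (A + B) := by
  change 𝒬.parity * _ = _ * 𝒬.parity
  rw [mul_add, add_mul, show 𝒬.parity * A = _ from hA, show 𝒬.parity * B = _ from hB]

lemma isEven_smul (z : ℂ) {A : 𝒬.Op} (hA : IsEven A) : IsEven (z • A) := by
  change 𝒬.parity * _ = _ * 𝒬.parity
  rw [mul_smul_comm, smul_mul_assoc, show 𝒬.parity * A = _ from hA]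

lemma isOdd_smul (z : ℂ) {A : 𝒬.Op} (hA : IsOdd A) : IsOdd (z • A) := by
  change 𝒬.parity * _ = -(_ * 𝒬.parity)
  rw [mul_smul_comm, smul_mul_assoc, show 𝒬.parity * A = _ from hA, smul_neg]

lemma isOdd_neg {A : 𝒬.Op} (hA : IsOdd A) : IsOdd (-A) := by
  rw [op_neg_eq_smul]
  exact isOdd_smul _ hA

lemma isEven_fieldDeriv {φ : 𝒬.Field} (hφ : ∀ h, IsEven (φ h)) (μ : Fin 4) (h : TestFn) :
    IsEven (fieldDeriv μ φ h) := by
  rw [fieldDeriv_apply, op_neg_eq_smul]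
  exact isEven_smul _ (hφ _)

lemma sum_smul_field_apply {ι : Type*} [Fintype ι] (z : ι → ℂ) (φ : ι → 𝒬.Field) (h : TestFn) :
    (∑ i, z i • φ i) h = ∑ i, z i • φ i h := by
  rw [LinearMap.sum_apply]; rfl

lemma sum_sub_sum_field {ι : Type*} [Fintype ι] (φ ψ : ι → 𝒬.Field) :
    ∑ i, φ i - ∑ i, ψ i = ∑ i, (φ i - ψ i) := (Finset.sum_sub_distrib _ _).symm

variable {m : ℝ} {s n : ℕ} (F : FreeFields 𝒬 m s n)

namespace FreeFields

/-- `∑ z_A f^{(A)}_a`. -/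
def fSum (z : Fin n → ℂ) (a : Fin 2) : 𝒬.Field := ∑ A, z A • F.f A a

/-- `∑ z_A f̄^{(A)}_ā`. -/
def fbarSum (z : Fin n → ℂ) (a : Fin 2) : 𝒬.Field := ∑ A, z A • F.fbar A a

lemma fSum_odd (z : Fin n → ℂ) (a : Fin 2) (h : TestFn) : IsOdd (F.fSum z a h) := by
  rw [fSum, sum_smul_field_apply]; exact isOdd_sum_smul z fun A => F.f_odd A a h

lemma fbarSum_odd (z : Fin n → ℂ) (a : Fin 2) (h : TestFn) : IsOdd (F.fbarSum z a h) := by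
  rw [fbarSum, sum_smul_field_apply]; exact isOdd_sum_smul z fun A => F.fbar_odd A a h

/-- The adjoint of {f, f}; adjoints are unique because the form is nondegenerate. The kernel D_m is
real, so only the factor i changes sign. -/
lemma fbar_fbar (A B : Fin n) (a b : Fin 2) : Anticomm (F.fbar A a) (F.fbar B b)
    (if A = B then (-(Complex.I * epsLow a b * m)) • kerD m else 0) := by
  intro g h
  have h1 := ((F.f_adj A a g).mul (F.f_adj B b h)).add ((F.f_adj B b h).mul (F.f_adj A a g))
  rw [F.f_f A B a b g h] at h1
  have h2 := h1.unique (IsAdjoint.smul_one 𝒬 _)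
  rw [add_comm, h2]
  congr 1
  have he : conj (epsLow a b) = epsLow a b := by fin_cases a <;> fin_cases b <;> simp [epsLow]
  split_ifs
  · simp [kerD, he]
  · simp

lemma am_fSum_fSum (z w : Fin n → ℂ) (a b : Fin 2) : am (F.fSum z a) (F.fSum w b) =
    scalarK 𝒬 ((Complex.I * m * (∑ A, z A * w A) * epsLow a b) • kerD m) := by
  simp only [fSum, map_sum, map_smul, LinearMap.sum_apply, LinearMap.smul_apply,
    anticomm_iff.1 (F.f_f _ _ a b)]
  simp only [Finset.mul_sum, Finset.sum_mul, Finset.sum_smul]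
  refine Finset.sum_congr rfl fun B _ => ?_
  rw [Finset.sum_eq_single B]
  · simp only [if_true, map_smul, smul_smul]; congr 1; ring
  · intro A _ hA; simp [hA]
  · simp

lemma am_fbarSum_fbarSum (z w : Fin n → ℂ) (a b : Fin 2) : am (F.fbarSum z a) (F.fbarSum w b) =
    scalarK 𝒬 ((-(Complex.I * m * (∑ A, z A * w A) * epsLow a b)) • kerD m) := by
  simp only [fbarSum, map_sum, map_smul, LinearMap.sum_apply, LinearMap.smul_apply,
    anticomm_iff.1 (F.fbar_fbar _ _ a b)]
  simp only [Finset.mul_sum, Finset.sum_mul, Finset.sum_smul, ← Finset.sum_neg_distrib]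
  refine Finset.sum_congr rfl fun B _ => ?_
  rw [Finset.sum_eq_single B]
  · simp only [if_true, map_smul, smul_smul]; congr 1; ring
  · intro A _ hA; simp [hA]
  · simp

lemma am_fSum_fbarSum (z w : Fin n → ℂ) (a b : Fin 2) : am (F.fSum z a) (F.fbarSum w b) =
    scalarK 𝒬 ((∑ A, z A * w A) • kerSigmaD m a b) := by
  simp only [fSum, fbarSum, map_sum, map_smul, LinearMap.sum_apply, LinearMap.smul_apply,
    anticomm_iff.1 (F.f_fbar _ _ a b)]
  simp only [Finset.sum_smul]
  refine Finset.sum_congr rfl fun B _ => ?_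
  rw [Finset.sum_eq_single B]
  · simp only [if_true, smul_smul]; congr 1; ring
  · intro A _ hA; simp [hA]
  · simp

lemma raise_zero (ψ : Fin 2 → 𝒬.Field) : raise ψ 0 = (-1 : ℂ) • ψ 1 := by
  simp only [raise, epsUp, epsLow, Fin.sum_univ_two]
  simp only [Matrix.neg_apply, Matrix.of_apply, Matrix.cons_val_zero, Matrix.cons_val_one,
    neg_zero, zero_smul, zero_add]

lemma raise_one (ψ : Fin 2 → 𝒬.Field) : raise ψ 1 = ψ 0 := by
  simp only [raise, epsUp, epsLow, Fin.sum_univ_two]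
  simp

lemma sum_sum_pauli_fieldDeriv_right (ψ : Fin 2 → 𝒬.Field) (a : Fin 2) :
    ∑ μ, ∑ c, pauli μ a c • fieldDeriv μ (raise ψ c) =
      sigmaDeriv a 1 (ψ 0) - sigmaDeriv a 0 (ψ 1) := by
  rw [Finset.sum_comm, Fin.sum_univ_two, raise_zero, raise_one, ← sigmaDeriv_apply,
    ← sigmaDeriv_apply, map_smul]
  module

lemma sum_sum_pauli_fieldDeriv_left (ψ : Fin 2 → 𝒬.Field) (b : Fin 2) :
    ∑ μ, ∑ a, pauli μ a b • fieldDeriv μ (raise ψ a) =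
      sigmaDeriv 1 b (ψ 0) - sigmaDeriv 0 b (ψ 1) := by
  rw [Finset.sum_comm, Fin.sum_univ_two, raise_zero, raise_one, ← sigmaDeriv_apply,
    ← sigmaDeriv_apply, map_smul]
  module

/-- The field equation is linear over ℂ and leaves the coefficients z unconjugated, although it
exchanges f̄ and f. -/
lemma sigmaDeriv_fbarSum (z : Fin n → ℂ) (a : Fin 2) :
    sigmaDeriv a 1 (F.fbarSum z 0) - sigmaDeriv a 0 (F.fbarSum z 1) =
      (-(Complex.I * m)) • F.fSum z a := by
  simp only [fbarSum, fSum, map_sum, map_smul, Finset.smul_sum]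
  rw [sum_sub_sum_field]
  refine Finset.sum_congr rfl fun A _ => ?_
  have h := F.dirac A a
  rw [sum_sum_pauli_fieldDeriv_right] at h
  have h2 : (-(Complex.I * m)) • z A • F.f A a = (-(Complex.I * z A)) • ((m : ℂ) • F.f A a) := by
    module
  rw [h2, ← h, smul_smul, ← smul_sub]
  congr 1
  linear_combination (z A) * Complex.I_mul_I

lemma sigmaDeriv_fSum (z : Fin n → ℂ) (b : Fin 2) :
    sigmaDeriv 1 b (F.fSum z 0) - sigmaDeriv 0 b (F.fSum z 1) =
      (Complex.I * m) • F.fbarSum z b := by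
  simp only [fbarSum, fSum, map_sum, map_smul, Finset.smul_sum]
  rw [sum_sub_sum_field]
  refine Finset.sum_congr rfl fun A _ => ?_
  have h := F.dirac_bar A b
  rw [sum_sum_pauli_fieldDeriv_left] at h
  have h2 : (Complex.I * m) • z A • F.fbar A b = (Complex.I * z A) • ((m : ℂ) • F.fbar A b) := by
    module
  rw [h2, ← h, smul_smul, ← smul_sub]
  congr 1
  linear_combination (z A) * Complex.I_mul_I

end FreeFields

namespace Supercharges

variable {F} (S : Supercharges F)

/-- `[P_μ, φ] = -i ∂_μ φ`. -/
def IsCovariant (φ : 𝒬.Field) : Prop := ∀ μ, ad (S.P μ) φ = (-Complex.I) • fieldDeriv μ φ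

variable {S}

lemma IsCovariant.smul (z : ℂ) {φ : 𝒬.Field} (h : S.IsCovariant φ) : S.IsCovariant (z • φ) :=
  fun μ => by
    rw [map_smul, h μ, smul_comm]
    exact congrArg _ ((fieldDerivₗ μ).map_smul z φ).symm

lemma IsCovariant.add {φ ψ : 𝒬.Field} (h : S.IsCovariant φ) (h' : S.IsCovariant ψ) :
    S.IsCovariant (φ + ψ) := fun μ => by
  rw [map_add, h μ, h' μ, ← smul_add]
  exact congrArg _ ((fieldDerivₗ μ).map_add φ ψ).symm

lemma IsCovariant.sum {ι : Type*} [Fintype ι] {φ : ι → 𝒬.Field} (h : ∀ i, S.IsCovariant (φ i)) :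
    S.IsCovariant (∑ i, φ i) := fun μ => by
  rw [map_sum, Finset.sum_congr rfl fun i _ => h i μ, ← Finset.smul_sum]
  exact congrArg _ (map_sum (fieldDerivₗ μ) φ _).symm

lemma IsCovariant.fieldDeriv {φ : 𝒬.Field} (h : S.IsCovariant φ) (ν : Fin 4) :
    S.IsCovariant (fieldDeriv ν φ) := fun μ => by
  rw [ad_fieldDeriv, h μ, fieldDeriv_comm μ ν]
  exact (fieldDerivₗ ν).map_smul _ _

variable (S)

lemma isCovariant_b (j : Fin s) : S.IsCovariant (F.b j) := fun μ => LinearMap.ext (S.P_b μ j)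

lemma isCovariant_bv (ρ : Fin 4) : S.IsCovariant (F.bv ρ) := fun μ => LinearMap.ext (S.P_bv μ ρ)

lemma isCovariant_fSum (z : Fin n → ℂ) (a : Fin 2) : S.IsCovariant (F.fSum z a) :=
  .sum fun A => .smul _ fun μ => LinearMap.ext (S.P_f μ A a)

lemma isCovariant_fbarSum (z : Fin n → ℂ) (a : Fin 2) : S.IsCovariant (F.fbarSum z a) :=
  .sum fun A => .smul _ fun μ => LinearMap.ext (S.P_fbar μ A a)

/-- `i Q_a`. -/
def R (a : Fin 2) : 𝒬.Op := Complex.I • S.Q a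

/-- `-i Q̄_ā`. -/
def Rbar (a : Fin 2) : 𝒬.Op := (-Complex.I) • S.Qbar a

lemma R_R (a b : Fin 2) : S.R a * S.R b + S.R b * S.R a = 0 := by
  simp only [R, mul_smul_comm, smul_mul_assoc, ← smul_add, S.Q_Q, smul_zero]

lemma Qbar_Qbar (a b : Fin 2) : S.Qbar a * S.Qbar b + S.Qbar b * S.Qbar a = 0 := by
  have h := ((S.Q_adj b).mul (S.Q_adj a)).add ((S.Q_adj a).mul (S.Q_adj b))
  rw [S.Q_Q] at h
  refine h.unique fun x y => ?_
  change 𝒬.form 0 y = 𝒬.form x 0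
  rw [map_zero, map_zero, LinearMap.zero_apply]

lemma Rbar_Rbar (a b : Fin 2) : S.Rbar a * S.Rbar b + S.Rbar b * S.Rbar a = 0 := by
  simp only [Rbar, mul_smul_comm, smul_mul_assoc, ← smul_add, S.Qbar_Qbar, smul_zero]

/-- The factors i and -i cancel, so {R, Rbar} = {Q, Q̄} = 2σP, and P acts as -i∂. -/
lemma ad_R_Rbar {φ : 𝒬.Field} (h : S.IsCovariant φ) (a b : Fin 2) :
    ad (S.R a * S.Rbar b + S.Rbar b * S.R a) φ = (-2 * Complex.I) • sigmaDeriv a b φ := by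
  have h1 : S.R a * S.Rbar b + S.Rbar b * S.R a = ∑ μ, (2 * pauli μ a b) • S.P μ := by
    rw [← S.Q_Qbar]
    simp only [R, Rbar, mul_smul_comm, smul_mul_assoc, smul_smul]
    simp
  have h2 : ad (∑ μ, (2 * pauli μ a b) • S.P μ) φ = ∑ μ, (2 * pauli μ a b) • ad (S.P μ) φ := by
    ext1 g
    rw [sum_smul_field_apply]
    simp only [ad_apply, Finset.sum_mul, Finset.mul_sum, ← Finset.sum_sub_distrib, smul_sub,
      smul_mul_assoc, mul_smul_comm]
  rw [h1, h2, sigmaDeriv_apply, Finset.smul_sum]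
  refine Finset.sum_congr rfl fun μ _ => ?_
  rw [h μ, smul_smul, smul_smul]
  congr 1; ring

lemma ad_zero_left (φ : 𝒬.Field) : ad 0 φ = 0 := by
  ext1 g; simp only [ad_apply, zero_mul, mul_zero, sub_zero, LinearMap.zero_apply]

end Supercharges

end Free

/-! ### The kernels -/

section Kernels

lemma derivLeft_kerD (m : ℝ) (μ : Fin 4) : derivLeft ℂ μ (kerD m) = kerdD m μ := rfl

lemma derivLeft_kerdD (m : ℝ) (μ ν : Fin 4) : derivLeft ℂ μ (kerdD m ν) = kerddD m μ ν := by
  ext f g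
  change - -((pauliJordan m (pd ν (pd μ f)) g : ℝ) : ℂ) = (pauliJordan m (pd μ (pd ν f)) g : ℂ)
  rw [neg_neg, pd_comm]

lemma kerdD_ne_zero (m : ℝ) : kerdD m 0 ≠ 0 := by
  obtain ⟨f, hf⟩ := exists_kerdD_zero_ne_zero m
  exact fun h => hf (congrFun (congrFun h f) f)

lemma kerD_ne_zero (m : ℝ) : kerD m ≠ 0 := fun h =>
  kerdD_ne_zero m (by rw [← derivLeft_kerD, h, map_zero])

/-- The trace over the spinor indices is 2∂₀D_m, because the other Pauli matrices are traceless. -/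
lemma kerSigmaD_ne_zero (m : ℝ) : ∃ a, kerSigmaD m a a ≠ 0 := by
  by_contra! h
  have h0 : kerSigmaD m 0 0 + kerSigmaD m 1 1 = (2 : ℂ) • kerdD m 0 := by
    simp [kerSigmaD, Fin.sum_univ_four, pauli]
    module
  rw [h, h, add_zero] at h0
  exact kerdD_ne_zero m ((smul_eq_zero.1 h0.symm).resolve_left two_ne_zero)

variable {H : Type*} [NormedAddCommGroup H] [InnerProductSpace ℂ H] {𝒬 : StateSpace H}
  {m : ℝ} {s n : ℕ} {F : FreeFields 𝒬 m s n}

/-- Antisymmetry of D_m is read off from [b, b] instead of the integral; this is why an index j of a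
scalar field is carried along. -/
lemma swapArgs_kerD (F : FreeFields 𝒬 m s n) (j : Fin s) : swapArgs ℂ (kerD m) = -kerD m := by
  have h := comm_iff.1 (F.b_b j j)
  rw [if_pos rfl] at h
  have h1 := cm_swap (F.b j) (F.b j)
  rw [h, scalarK_swapArgs, ← map_neg] at h1
  have h2 := scalarK_injective h1
  rw [map_smul, ← smul_neg] at h2
  have h3 := smul_right_injective Kernel (show -Complex.I ≠ 0 by simp) h2
  rw [← neg_eq_iff_eq_neg] at h3
  exact h3.symm

/-- Translation invariance: bracketing P_μ with a scalar commutator gives 0, so the x- and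
y-derivatives of D_m cancel. -/
lemma derivRight_kerD (S : Supercharges F) (j : Fin s) (μ : Fin 4) :
    derivRight ℂ μ (kerD m) = -kerdD m μ := by
  have h := comm_iff.1 (F.b_b j j)
  rw [if_pos rfl] at h
  have h1 := cm_ad_add_cm_ad (S.P μ) h
  rw [S.isCovariant_b j μ, map_smul, map_smul, LinearMap.smul_apply, ← smul_add,
    cm_fieldDeriv_left, cm_fieldDeriv_right, h, scalarK_derivLeft, scalarK_derivRight,
    ← map_add, ← map_smul, ← map_zero (scalarK 𝒬)] at h1
  have h2 := scalarK_injective h1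
  rw [map_smul, map_smul, ← smul_add, smul_smul] at h2
  have h3 := (smul_eq_zero.1 h2).resolve_left (by simp)
  rw [derivLeft_kerD] at h3
  exact eq_neg_of_add_eq_zero_right h3

lemma swapArgs_kerdD (S : Supercharges F) (j : Fin s) (μ : Fin 4) :
    swapArgs ℂ (kerdD m μ) = kerdD m μ := by
  have h : swapArgs ℂ (kerdD m μ) = derivRight ℂ μ (swapArgs ℂ (kerD m)) := rfl
  rw [h, swapArgs_kerD F j, map_neg, derivRight_kerD S j, neg_neg]

lemma swapArgs_kerSigmaD (S : Supercharges F) (j : Fin s) (a b : Fin 2) :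
    swapArgs ℂ (kerSigmaD m a b) = kerSigmaD m a b := by
  simp only [kerSigmaD, map_sum, map_smul, swapArgs_kerdD S j]

end Kernels

/-! ### Supersymmetry transformations of the component fields -/

section Multiplet

variable {H : Type*} [NormedAddCommGroup H] [InnerProductSpace ℂ H] {𝒬 : StateSpace H}
  {m : ℝ} {s n : ℕ} {F : FreeFields 𝒬 m s n}

open StateSpace

lemma rescale_gr (t : ℂ) (i : Fin 2 ⊕ Fin 2) :
    ExteriorAlgebra.map (t • LinearMap.id) (gr i) = t • gr i := by
  rcases i with i | i <;> simp [gr]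

lemma rescale_tmul (t : ℂ) (g : Grassmann) (A : 𝒬.Op) :
    rescale 𝒬 t (g ⊗ₜ A) = ExteriorAlgebra.map (t • LinearMap.id) g ⊗ₜ A := by
  simp [rescale]

lemma rescale_superSum (t : ℂ) (ψ : Fin 2 ⊕ Fin 2 → 𝒬.Op) :
    rescale 𝒬 t (superSum ψ) = t • superSum ψ := by
  simp only [superSum, map_sum, rescale_tmul, rescale_gr, Finset.smul_sum, TensorProduct.smul_tmul']

lemma rescale_degTwo (t : ℂ) (A B : 𝒬.Op) (W : Fin 2 → Fin 2 → 𝒬.Op) :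
    rescale 𝒬 t (degTwo A B W) = t ^ 2 • degTwo A B W := by
  simp only [degTwo, map_sum, map_add, rescale_tmul, map_mul, rescale_gr, Finset.smul_sum, smul_add,
    TensorProduct.smul_tmul', smul_mul_assoc, mul_smul_comm, smul_smul, pow_two]

lemma rescale_degThree (t : ℂ) (L L' : Fin 2 → 𝒬.Op) :
    rescale 𝒬 t (degThree L L') = t ^ 3 • degThree L L' := by
  simp only [degThree, map_sum, map_add, rescale_tmul, map_mul, rescale_gr, Finset.smul_sum,
    smul_add, TensorProduct.smul_tmul', smul_mul_assoc, mul_smul_comm, smul_smul, pow_succ,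
    pow_zero, one_mul]

lemma smul_degTwo (z : ℂ) (A B : 𝒬.Op) (W : Fin 2 → Fin 2 → 𝒬.Op) :
    z • degTwo A B W = degTwo (z • A) (z • B) (fun a b => z • W a b) := by
  simp only [degTwo, smul_add, Finset.smul_sum, TensorProduct.tmul_smul]

lemma smul_degThree (z : ℂ) (L L' : Fin 2 → 𝒬.Op) :
    z • degThree L L' = degThree (fun b => z • L b) (fun a => z • L' a) := by
  simp only [degThree, smul_add, Finset.smul_sum, TensorProduct.tmul_smul, mul_smul_comm]

namespace Supercharges

variable (S : Supercharges F)

/-- The four odd operators `iQ_a` and `-iQ̄_ā`. -/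
def charges : Fin 2 ⊕ Fin 2 → 𝒬.Op := Sum.elim S.R S.Rbar

lemma charges_odd (i : Fin 2 ⊕ Fin 2) : IsOdd (S.charges i) := by
  rcases i with i | i
  · exact isOdd_smul _ (S.Q_odd i)
  · exact isOdd_smul _ (S.Qbar_odd i)

lemma superGenerator_eq : superGenerator S = superSum S.charges := by
  simp only [superGenerator, superSum, Fintype.sum_sum_type, theta_eq, thetabar_eq, lift,
    Algebra.TensorProduct.tmul_mul_tmul, mul_one, charges, Sum.elim_inl, Sum.elim_inr, R, Rbar,
    mul_smul_comm, TensorProduct.tmul_smul, ← Finset.smul_sum]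
  module

end Supercharges

namespace Coefficients

variable (c : Coefficients s n)

lemma C_even (h : TestFn) : IsEven (c.C F h) := by
  rw [C, sum_smul_field_apply]; exact isEven_sum_smul _ fun j => F.b_even j h

lemma div_even (h : TestFn) : IsEven (div F.bv h) := by
  have : div F.bv h = ∑ μ, (1 : ℂ) • ∑ ρ, (metric μ ρ : ℂ) • fieldDeriv μ (F.bv ρ) h := by
    simp only [div, LinearMap.sum_apply, one_smul]; rfl
  rw [this]
  exact isEven_sum_smul _ fun μ => isEven_sum_smul _ fun ρ => isEven_fieldDeriv (F.bv_even ρ) μ h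

lemma even_aux (z : Fin s → ℂ) (w : ℂ) (h : TestFn) :
    IsEven (((∑ j, z j • F.b j) + w • div F.bv) h) := by
  change IsEven ((∑ j, z j • F.b j) h + w • div F.bv h)
  rw [sum_smul_field_apply]
  exact isEven_add (isEven_sum_smul _ fun j => F.b_even j h) (isEven_smul _ (div_even h))

lemma v_even (μ : Fin 4) (h : TestFn) : IsEven (c.v F μ h) := by
  change IsEven (c.τ₀ • F.bv μ h + (∑ j, c.τ j • fieldDeriv μ (F.b j)) h)
  rw [sum_smul_field_apply]
  exact isEven_add (isEven_smul _ (F.bv_even μ h))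
    (isEven_sum_smul _ fun j => isEven_fieldDeriv (F.b_even j) μ h)

lemma slash_even (a b : Fin 2) (h : TestFn) : IsEven (slash (c.v F) a b h) := by
  rw [slash, sum_smul_field_apply]; exact isEven_sum_smul _ fun μ => c.v_even μ h

lemma thetaSq_mul_tmul (g : Grassmann) (A : 𝒬.Op) :
    thetaSq 𝒬 * g ⊗ₜ[ℂ] A = (gr (Sum.inl 0) * (gr (Sum.inl 1) * g)) ⊗ₜ ((2 : ℂ) • A) := by
  rw [thetaSq_eq, smul_mul_assoc, Algebra.TensorProduct.tmul_mul_tmul, one_mul, mul_assoc,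
    TensorProduct.tmul_smul]

lemma thetabarSq_mul_tmul (g : Grassmann) (A : 𝒬.Op) :
    thetabarSq 𝒬 * g ⊗ₜ[ℂ] A = (gr (Sum.inr 0) * (gr (Sum.inr 1) * g)) ⊗ₜ ((-2 : ℂ) • A) := by
  rw [thetabarSq_eq, smul_mul_assoc, Algebra.TensorProduct.tmul_mul_tmul, one_mul, mul_assoc,
    TensorProduct.tmul_smul]

lemma sum_thetaSigma_mul_lift (v : Fin 4 → 𝒬.Field) (h : TestFn) :
    ∑ μ, thetaSigma 𝒬 μ * lift 𝒬 (v μ h) =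
      ∑ a, ∑ b, (gr (Sum.inl a) * gr (Sum.inr b)) ⊗ₜ[ℂ] (slash v a b h) := by
  simp only [thetaSigma_eq, slash, sum_smul_field_apply, TensorProduct.tmul_sum,
    TensorProduct.tmul_smul, Finset.sum_mul, lift, smul_mul_assoc,
    Algebra.TensorProduct.tmul_mul_tmul, mul_one, one_mul]
  rw [Finset.sum_comm]
  exact Finset.sum_congr rfl fun a _ => Finset.sum_comm

lemma thetaSq_mul_thetabarContr (ψ : Fin 2 → 𝒬.Field) (h : TestFn) :
    thetaSq 𝒬 * thetabarContr ψ h = ∑ b,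
      (gr (Sum.inl 0) * (gr (Sum.inl 1) * gr (Sum.inr b))) ⊗ₜ
        (𝒬.parity * ((-2 : ℂ) • ψ b h)) := by
  rw [thetabarContr_eq, Finset.mul_sum]
  refine Finset.sum_congr rfl fun b _ => ?_
  rw [thetaSq_mul_tmul, op_neg_eq_smul, mul_smul_comm, mul_smul_comm, smul_smul]
  norm_num

lemma thetabarSq_mul_thetaContr (ψ : Fin 2 → 𝒬.Field) (h : TestFn) :
    thetabarSq 𝒬 * thetaContr ψ h = ∑ a,
      (gr (Sum.inr 0) * (gr (Sum.inr 1) * gr (Sum.inl a))) ⊗ₜ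
        (𝒬.parity * ((-2 : ℂ) • ψ a h)) := by
  rw [thetaContr_eq, Finset.mul_sum]
  refine Finset.sum_congr rfl fun b _ => ?_
  rw [thetabarSq_mul_tmul, mul_smul_comm]

/-- The constants come from θ² = 2θ^0θ^1, θ̄² = -2θ̄^0θ̄^1 and θ̄ψ̄ = -θ̄^ā ψ̄_ā, with spinor
indices numbered 0 and 1. Thus λ̄ and λ both get -2, and d gets -4. -/
lemma expansion_eq (h : TestFn) : c.expansion F h = lift 𝒬 (c.C F h) +
    superSum (Sum.elim (fun a => c.chi F a h) (fun a => -c.chibar F a h)) +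
    degTwo ((2 : ℂ) • c.phi F h) ((-2 : ℂ) • c.phidag F h) (fun a b => slash (c.v F) a b h) +
    degThree (fun b => (-2 : ℂ) • c.lambar F b h) (fun a => (-2 : ℂ) • c.lam F a h) +
    (gr (Sum.inl 0) * (gr (Sum.inl 1) * (gr (Sum.inr 0) * gr (Sum.inr 1)))) ⊗ₜ
      ((-4 : ℂ) • c.d F h) := by
  have h1 : thetaSq 𝒬 * lift 𝒬 (c.phi F h) =
      (gr (Sum.inl 0) * gr (Sum.inl 1)) ⊗ₜ ((2 : ℂ) • c.phi F h) := by
    rw [lift, thetaSq_mul_tmul, mul_one]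
  have h2 : thetabarSq 𝒬 * lift 𝒬 (c.phidag F h) =
      (gr (Sum.inr 0) * gr (Sum.inr 1)) ⊗ₜ ((-2 : ℂ) • c.phidag F h) := by
    rw [lift, thetabarSq_mul_tmul, mul_one]
  have h3 : thetaSq 𝒬 * thetabarSq 𝒬 * lift 𝒬 (c.d F h) =
      (gr (Sum.inl 0) * (gr (Sum.inl 1) * (gr (Sum.inr 0) * gr (Sum.inr 1)))) ⊗ₜ
      ((-4 : ℂ) • c.d F h) := by
    rw [mul_assoc, lift, thetabarSq_mul_tmul, thetaSq_mul_tmul, mul_one, smul_smul]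
    norm_num
  have h4 : superSum (Sum.elim (fun a => c.chi F a h) (fun a => -c.chibar F a h)) =
      thetaContr (c.chi F) h + thetabarContr (c.chibar F) h := by
    rw [thetaContr_eq, thetabarContr_eq, superSum, Fintype.sum_sum_type]
    rfl
  rw [expansion, h1, h2, h3, h4, sum_thetaSigma_mul_lift, thetaSq_mul_thetabarContr,
    thetabarSq_mul_thetaContr, degTwo, degThree]
  abel

/-- The supersymmetry transformations contained in the expansion of the superfield. -/
structure SusyRelations (S : Supercharges F) : Prop where
  R_C : ∀ a, ad (S.R a) (c.C F) = c.chi F a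
  Rbar_C : ∀ a, ad (S.Rbar a) (c.C F) = -c.chibar F a
  R_chi : aad (S.R 1) (c.chi F 0) - aad (S.R 0) (c.chi F 1) = (4 : ℂ) • c.phi F
  Rbar_chibar : aad (S.Rbar 1) (c.chibar F 0) - aad (S.Rbar 0) (c.chibar F 1) =
    (4 : ℂ) • c.phidag F
  Rbar_chi : ∀ a b, aad (S.Rbar b) (c.chi F a) + aad (S.R a) (c.chibar F b) =
    (2 : ℂ) • slash (c.v F) a b
  Rbar_phi : ∀ b, (2 : ℂ) • ad (S.Rbar b) (c.phi F) - ad (S.R 1) (slash (c.v F) 0 b) +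
    ad (S.R 0) (slash (c.v F) 1 b) = (-6 : ℂ) • c.lambar F b
  R_phidag : ∀ a, (-2 : ℂ) • ad (S.R a) (c.phidag F) + ad (S.Rbar 1) (slash (c.v F) a 0) -
    ad (S.Rbar 0) (slash (c.v F) a 1) = (-6 : ℂ) • c.lam F a
  R_lam : (aad (S.R 1) (c.lam F 0) - aad (S.R 0) (c.lam F 1)) +
    (aad (S.Rbar 1) (c.lambar F 0) - aad (S.Rbar 0) (c.lambar F 1)) = (8 : ℂ) • c.d F

end Coefficients

end Multiplet

/-! ### Reading the supersymmetry relations off the superfield. -/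

section Multiplet

variable {H : Type*} [NormedAddCommGroup H] [InnerProductSpace ℂ H] {𝒬 : StateSpace H}
  {m : ℝ} {s n : ℕ} {F : FreeFields 𝒬 m s n}

open StateSpace
namespace Coefficients

variable (c : Coefficients s n)

lemma phi_even (h : TestFn) : IsEven (c.phi F h) := even_aux c.ρ c.ρ₀ h

lemma phidag_even (h : TestFn) : IsEven (c.phidag F h) :=
  even_aux (fun j => conj (c.ρ j)) (conj c.ρ₀) h

lemma lam_odd (a : Fin 2) (h : TestFn) : IsOdd (c.lam F a h) := F.fSum_odd c.β a h

lemma lambar_odd (a : Fin 2) (h : TestFn) : IsOdd (c.lambar F a h) :=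
  F.fbarSum_odd (fun A => conj (c.β A)) a h

lemma map_mul_mul_mul {A : Type*} [Ring A] [Algebra ℂ A] (f : A →ₐ[ℂ] A) {t : ℂ} {x y z w : A}
    (hx : f x = t • x) (hy : f y = t • y) (hz : f z = t • z) (hw : f w = t • w) :
    f (x * (y * (z * w))) = t ^ 4 • (x * (y * (z * w))) := by
  simp only [map_mul, hx, hy, hz, hw, smul_mul_assoc, mul_smul_comm, smul_smul]
  congr 1
  ring

lemma rescale_tmul_of_map_eq {t z : ℂ} {g : Grassmann}
    (hg : ExteriorAlgebra.map (t • LinearMap.id) g = z • g) (A : 𝒬.Op) :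
    rescale 𝒬 t (g ⊗ₜ A) = z • (g ⊗ₜ A) := by
  rw [rescale_tmul, hg, TensorProduct.smul_tmul']

lemma rescale_mul_mul_mul_tmul {t : ℂ} {x y z w : Grassmann}
    (hx : ExteriorAlgebra.map (t • LinearMap.id) x = t • x)
    (hy : ExteriorAlgebra.map (t • LinearMap.id) y = t • y)
    (hz : ExteriorAlgebra.map (t • LinearMap.id) z = t • z)
    (hw : ExteriorAlgebra.map (t • LinearMap.id) w = t • w) (A : 𝒬.Op) :
    rescale 𝒬 t ((x * (y * (z * w))) ⊗ₜ A) = t ^ 4 • ((x * (y * (z * w))) ⊗ₜ A) :=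
  rescale_tmul_of_map_eq (map_mul_mul_mul (A := Grassmann) _ hx hy hz hw) A

lemma rescale_gr_mul_gr_mul_gr_mul_gr (t : ℂ) (i j k l : Fin 2 ⊕ Fin 2) (A : 𝒬.Op) :
    rescale 𝒬 t ((gr i * (gr j * (gr k * gr l))) ⊗ₜ A) =
      t ^ 4 • ((gr i * (gr j * (gr k * gr l))) ⊗ₜ A) :=
  rescale_mul_mul_mul_tmul (rescale_gr t i) (rescale_gr t j) (rescale_gr t k) (rescale_gr t l) A

-- The degree-k part of the exponential expansion satisfies [X, V_{k-1}] = kV_k. Combined with the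
-- constants of `expansion_eq` this produces 4 = 2·2, -6 = 3·(-2) and, after division by -2, 8 from
-- 4·(-4).
set_option maxHeartbeats 1000000 in
theorem susyRelations (S : Supercharges F)
    (hV : ∀ h : TestFn, superfield S (c.C F) h = c.expansion F h) : c.SusyRelations S := by
  have key (h : TestFn) := commutator_of_superExp_eq
    (X := superGenerator S) (A := lift 𝒬 (c.C F h)) (V₀ := lift 𝒬 (c.C F h))
    (V₁ := superSum (Sum.elim (fun a => c.chi F a h) fun a => -c.chibar F a h))
    (V₂ := degTwo ((2 : ℂ) • c.phi F h) ((-2 : ℂ) • c.phidag F h) fun a b => slash (c.v F) a b h)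
    (V₃ := degThree (fun b => (-2 : ℂ) • c.lambar F b h) fun a => (-2 : ℂ) • c.lam F a h)
    (V₄ := (gr (Sum.inl 0) * (gr (Sum.inl 1) * (gr (Sum.inr 0) * gr (Sum.inr 1)))) ⊗ₜ
      ((-4 : ℂ) • c.d F h))
    (fun t => by rw [S.superGenerator_eq, rescale_superSum]) (fun t => rescale_lift t _)
    (fun t => rescale_lift t _)
    (fun t => rescale_superSum t _) (fun t => rescale_degTwo t _ _ _)
    (fun t => rescale_degThree t _ _) (fun t => rescale_gr_mul_gr_mul_gr_mul_gr t _ _ _ _ _)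
    ((superExp_mul_lift_mul_superExp S (c.C F) h).trans ((hV h).trans (c.expansion_eq h)))
  rw [S.superGenerator_eq] at key
  have hψ (h : TestFn) (i : Fin 2 ⊕ Fin 2) :
      IsOdd (Sum.elim (fun a => c.chi F a h) (fun a => -c.chibar F a h) i) := by
    rcases i with i | i
    · exact F.fSum_odd c.α i h
    · exact isOdd_neg (F.fbarSum_odd (fun A => conj (c.α A)) i h)
  have e1 (h : TestFn) := degree_one_components (c.C_even h) (key h).1
  have e2 (h : TestFn) := degree_two_components S.charges_odd (hψ h)
    ((key h).2.1.trans (smul_degTwo _ _ _ _))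
  have e3 (h : TestFn) := degree_three_components (isEven_smul _ (c.phi_even h))
    (isEven_smul _ (c.phidag_even h)) (fun a b => c.slash_even a b h)
    ((key h).2.2.1.trans (smul_degThree _ _ _))
  have e4 (h : TestFn) := degree_four_components S.charges_odd
    (fun b => isOdd_smul _ (c.lambar_odd (F := F) b h))
    (fun a => isOdd_smul _ (c.lam_odd (F := F) a h))
    ((key h).2.2.2.trans (TensorProduct.tmul_smul _ _ _).symm)
  simp only [Supercharges.charges, Sum.elim_inl, Sum.elim_inr] at e1 e2 e3 e4
  refine ⟨fun a => ?_, fun a => ?_, ?_, ?_, fun a b => ?_, fun b => ?_, fun a => ?_, ?_⟩ <;> ext1 h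
  · exact e1 h (Sum.inl a)
  · exact e1 h (Sum.inr a)
  · refine (e2 h).1.trans ?_
    rw [smul_smul]; norm_num
  · have := (e2 h).2.1
    change (S.Rbar 1 * c.chibar F 0 h + c.chibar F 0 h * S.Rbar 1) -
      (S.Rbar 0 * c.chibar F 1 h + c.chibar F 1 h * S.Rbar 0) = (4 : ℂ) • c.phidag F h
    simp only [mul_neg, neg_mul] at this
    linear_combination (norm := module) -this
  · have := (e2 h).2.2 a b
    change (S.Rbar b * c.chi F a h + c.chi F a h * S.Rbar b) +
      (S.R a * c.chibar F b h + c.chibar F b h * S.R a) = (2 : ℂ) • slash (c.v F) a b h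
    simp only [mul_neg, neg_mul] at this
    linear_combination (norm := module) this
  · have := (e3 h).1 b
    change (2 : ℂ) • (S.Rbar b * c.phi F h - c.phi F h * S.Rbar b) -
      (S.R 1 * slash (c.v F) 0 b h - slash (c.v F) 0 b h * S.R 1) +
      (S.R 0 * slash (c.v F) 1 b h - slash (c.v F) 1 b h * S.R 0) = (-6 : ℂ) • c.lambar F b h
    simp only [mul_smul_comm, smul_mul_assoc] at this
    linear_combination (norm := module) this
  · have := (e3 h).2 a
    change (-2 : ℂ) • (S.R a * c.phidag F h - c.phidag F h * S.R a) +
      (S.Rbar 1 * slash (c.v F) a 0 h - slash (c.v F) a 0 h * S.Rbar 1) -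
      (S.Rbar 0 * slash (c.v F) a 1 h - slash (c.v F) a 1 h * S.Rbar 0) = (-6 : ℂ) • c.lam F a h
    simp only [mul_smul_comm, smul_mul_assoc] at this
    linear_combination (norm := module) this
  · have := e4 h
    change (S.R 1 * c.lam F 0 h + c.lam F 0 h * S.R 1) -
      (S.R 0 * c.lam F 1 h + c.lam F 1 h * S.R 0) +
      ((S.Rbar 1 * c.lambar F 0 h + c.lambar F 0 h * S.Rbar 1) -
      (S.Rbar 0 * c.lambar F 1 h + c.lambar F 1 h * S.Rbar 0)) = (8 : ℂ) • c.d F h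
    simp only [mul_smul_comm, smul_mul_assoc] at this
    linear_combination (norm := module) (-1 / 2 : ℂ) • this

end Coefficients

end Multiplet

/-! ### Action of the charges on φ, χ and λ. -/

section Derived

variable {H : Type*} [NormedAddCommGroup H] [InnerProductSpace ℂ H] {𝒬 : StateSpace H}
  {m : ℝ} {s n : ℕ} {F : FreeFields 𝒬 m s n}

open StateSpace

lemma epsLow_zero_zero : epsLow 0 0 = 0 := rfl

lemma epsLow_zero_one : epsLow 0 1 = 1 := rfl

lemma epsLow_one_zero : epsLow 1 0 = -1 := rfl

lemma epsLow_one_one : epsLow 1 1 = 0 := rfl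

namespace Supercharges

variable (S : Supercharges F)

lemma aad_R_ad_R (a b : Fin 2) (φ : 𝒬.Field) :
    aad (S.R a) (ad (S.R b) φ) + aad (S.R b) (ad (S.R a) φ) = 0 := by
  rw [aad_ad_add_aad_ad, S.R_R, ad_zero_left]

lemma aad_Rbar_ad_Rbar (a b : Fin 2) (φ : 𝒬.Field) :
    aad (S.Rbar a) (ad (S.Rbar b) φ) + aad (S.Rbar b) (ad (S.Rbar a) φ) = 0 := by
  rw [aad_ad_add_aad_ad, S.Rbar_Rbar, ad_zero_left]

lemma ad_R_aad_R (a b : Fin 2) (φ : 𝒬.Field) :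
    ad (S.R a) (aad (S.R b) φ) + ad (S.R b) (aad (S.R a) φ) = 0 := by
  rw [ad_aad_add_ad_aad, S.R_R, ad_zero_left]

lemma ad_Rbar_aad_Rbar (a b : Fin 2) (φ : 𝒬.Field) :
    ad (S.Rbar a) (aad (S.Rbar b) φ) + ad (S.Rbar b) (aad (S.Rbar a) φ) = 0 := by
  rw [ad_aad_add_ad_aad, S.Rbar_Rbar, ad_zero_left]

variable {S} in
lemma IsCovariant.aad_R_ad_Rbar {φ : 𝒬.Field} (h : S.IsCovariant φ) (a b : Fin 2) :
    aad (S.R a) (ad (S.Rbar b) φ) + aad (S.Rbar b) (ad (S.R a) φ) =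
      (-2 * Complex.I) • SuperVector.sigmaDeriv a b φ := by
  rw [aad_ad_add_aad_ad, S.ad_R_Rbar h]

variable {S} in
lemma IsCovariant.ad_R_aad_Rbar {φ : 𝒬.Field} (h : S.IsCovariant φ) (a b : Fin 2) :
    ad (S.R a) (aad (S.Rbar b) φ) + ad (S.Rbar b) (aad (S.R a) φ) =
      (-2 * Complex.I) • SuperVector.sigmaDeriv a b φ := by
  rw [ad_aad_add_ad_aad, S.ad_R_Rbar h]

lemma isCovariant_div : S.IsCovariant (div F.bv) :=
  .sum fun μ => .sum fun ρ => .smul _ ((S.isCovariant_bv ρ).fieldDeriv μ)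

end Supercharges

namespace Coefficients

variable (c : Coefficients s n) (S : Supercharges F)

lemma isCovariant_C : S.IsCovariant (c.C F) := .sum fun j => .smul _ (S.isCovariant_b j)

lemma isCovariant_phi : S.IsCovariant (c.phi F) :=
  .add (.sum fun j => .smul _ (S.isCovariant_b j)) (.smul _ S.isCovariant_div)

lemma isCovariant_phidag : S.IsCovariant (c.phidag F) :=
  .add (.sum fun j => .smul _ (S.isCovariant_b j)) (.smul _ S.isCovariant_div)

lemma isCovariant_chi (a : Fin 2) : S.IsCovariant (c.chi F a) := S.isCovariant_fSum c.α a

lemma isCovariant_chibar (a : Fin 2) : S.IsCovariant (c.chibar F a) :=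
  S.isCovariant_fbarSum (fun A => conj (c.α A)) a

lemma isCovariant_lam (a : Fin 2) : S.IsCovariant (c.lam F a) := S.isCovariant_fSum c.β a

lemma isCovariant_lambar (a : Fin 2) : S.IsCovariant (c.lambar F a) :=
  S.isCovariant_fbarSum (fun A => conj (c.β A)) a

/-- The field `∑ ᾱ_A f^{(A)}_a`. -/
def chiConj (F : FreeFields 𝒬 m s n) (a : Fin 2) : 𝒬.Field := F.fSum (fun A => conj (c.α A)) a

/-- The field `∑ α_A f̄^{(A)}_ā`. -/
def chibarConj (F : FreeFields 𝒬 m s n) (a : Fin 2) : 𝒬.Field := F.fbarSum c.α a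

/-- The field `∑ β̄_A f^{(A)}_a`. -/
def lamConj (F : FreeFields 𝒬 m s n) (a : Fin 2) : 𝒬.Field := F.fSum (fun A => conj (c.β A)) a

/-- The field `∑ β_A f̄^{(A)}_ā`. -/
def lambarConj (F : FreeFields 𝒬 m s n) (a : Fin 2) : 𝒬.Field := F.fbarSum c.β a

/-- The conjugated coefficients of χ̄ stay conjugated, so the right side is not χ in general. -/
lemma sigmaDeriv_chibar (a : Fin 2) :
    sigmaDeriv a 1 (c.chibar F 0) - sigmaDeriv a 0 (c.chibar F 1) =
    (-(Complex.I * m)) • c.chiConj F a := F.sigmaDeriv_fbarSum _ a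

lemma sigmaDeriv_chi (b : Fin 2) : sigmaDeriv 1 b (c.chi F 0) - sigmaDeriv 0 b (c.chi F 1) =
    (Complex.I * m) • c.chibarConj F b := F.sigmaDeriv_fSum _ b

lemma sigmaDeriv_lambar (a : Fin 2) :
    sigmaDeriv a 1 (c.lambar F 0) - sigmaDeriv a 0 (c.lambar F 1) =
    (-(Complex.I * m)) • c.lamConj F a := F.sigmaDeriv_fbarSum _ a

lemma sigmaDeriv_lam (b : Fin 2) : sigmaDeriv 1 b (c.lam F 0) - sigmaDeriv 0 b (c.lam F 1) =
    (Complex.I * m) • c.lambarConj F b := F.sigmaDeriv_fSum _ b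

namespace SusyRelations

variable {c S}

/-- Since χ_b = [R_b, C] and {R_a, R_b} = 0, the bracket is antisymmetric in a, b, hence a multiple
of ε_{ab}. The θ² component fixes the multiple. -/
lemma aad_R_chi (r : c.SusyRelations S) (a b : Fin 2) :
    aad (S.R a) (c.chi F b) = (-2 * epsLow a b) • c.phi F := by
  have h1 := r.R_chi
  have h2 (a b : Fin 2) := S.aad_R_ad_R a b (c.C F)
  simp only [r.R_C] at h2
  revert a b
  simp only [Fin.forall_fin_two, epsLow_zero_zero, epsLow_zero_one, epsLow_one_zero, epsLow_one_one]
  refine ⟨⟨?_, ?_⟩, ?_, ?_⟩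
  · linear_combination (norm := module) (1 / 2 : ℂ) • h2 0 0
  · linear_combination (norm := module) (1 / 2 : ℂ) • h2 0 1 - (1 / 2 : ℂ) • h1
  · linear_combination (norm := module) (1 / 2 : ℂ) • h2 0 1 + (1 / 2 : ℂ) • h1
  · linear_combination (norm := module) (1 / 2 : ℂ) • h2 1 1

lemma aad_Rbar_chibar (r : c.SusyRelations S) (a b : Fin 2) :
    aad (S.Rbar a) (c.chibar F b) = (-2 * epsLow a b) • c.phidag F := by
  have h1 := r.Rbar_chibar
  have h2 (a b : Fin 2) := S.aad_Rbar_ad_Rbar a b (c.C F)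
  simp only [r.Rbar_C, map_neg] at h2
  revert a b
  simp only [Fin.forall_fin_two, epsLow_zero_zero, epsLow_zero_one, epsLow_one_zero, epsLow_one_one]
  refine ⟨⟨?_, ?_⟩, ?_, ?_⟩
  · linear_combination (norm := module) (-1 / 2 : ℂ) • h2 0 0
  · linear_combination (norm := module) (-1 / 2 : ℂ) • h2 0 1 - (1 / 2 : ℂ) • h1
  · linear_combination (norm := module) (-1 / 2 : ℂ) • h2 0 1 + (1 / 2 : ℂ) • h1
  · linear_combination (norm := module) (-1 / 2 : ℂ) • h2 1 1

/-- The expansion gives the sum of {Rbar, χ} and {R, χ̄}; the Jacobi identity for C gives their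
difference, a translation. -/
lemma aad_Rbar_chi (r : c.SusyRelations S) (a b : Fin 2) : aad (S.Rbar b) (c.chi F a) =
    slash (c.v F) a b - Complex.I • sigmaDeriv a b (c.C F) := by
  have h1 := r.Rbar_chi a b
  have h2 := (c.isCovariant_C S).aad_R_ad_Rbar a b
  simp only [r.R_C, r.Rbar_C, map_neg] at h2
  linear_combination (norm := module) (1 / 2 : ℂ) • h1 + (1 / 2 : ℂ) • h2

lemma aad_R_chibar (r : c.SusyRelations S) (a b : Fin 2) : aad (S.R a) (c.chibar F b) =
    slash (c.v F) a b + Complex.I • sigmaDeriv a b (c.C F) := by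
  have h1 := r.Rbar_chi a b
  have h2 := (c.isCovariant_C S).aad_R_ad_Rbar a b
  simp only [r.R_C, r.Rbar_C, map_neg] at h2
  linear_combination (norm := module) (1 / 2 : ℂ) • h1 - (1 / 2 : ℂ) • h2

lemma slash_eq_aad_Rbar_chi (r : c.SusyRelations S) (a b : Fin 2) : slash (c.v F) a b =
    aad (S.Rbar b) (c.chi F a) + Complex.I • sigmaDeriv a b (c.C F) := by
  rw [r.aad_Rbar_chi]; abel

lemma slash_eq_aad_R_chibar (r : c.SusyRelations S) (a b : Fin 2) : slash (c.v F) a b =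
    aad (S.R a) (c.chibar F b) - Complex.I • sigmaDeriv a b (c.C F) := by
  rw [r.aad_R_chibar]; abel

/-- Chirality of φ: it is a multiple of {R_a, χ_b} with b ≠ a, and applying the same R_a twice gives
0. -/
lemma ad_R_phi (r : c.SusyRelations S) (a : Fin 2) : ad (S.R a) (c.phi F) = 0 := by
  have h (a b : Fin 2) := S.ad_R_aad_R a a (c.chi F b)
  simp only [r.aad_R_chi, map_smul] at h
  revert a
  refine Fin.forall_fin_two.2 ⟨?_, ?_⟩
  · have := h 0 1
    rw [epsLow_zero_one] at this
    linear_combination (norm := module) (-1 / 4 : ℂ) • this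
  · have := h 1 0
    rw [epsLow_one_zero] at this
    linear_combination (norm := module) (1 / 4 : ℂ) • this

lemma ad_Rbar_phidag (r : c.SusyRelations S) (a : Fin 2) : ad (S.Rbar a) (c.phidag F) = 0 := by
  have h (a b : Fin 2) := S.ad_Rbar_aad_Rbar a a (c.chibar F b)
  simp only [r.aad_Rbar_chibar, map_smul] at h
  revert a
  refine Fin.forall_fin_two.2 ⟨?_, ?_⟩
  · have := h 0 1
    rw [epsLow_zero_one] at this
    linear_combination (norm := module) (-1 / 4 : ℂ) • this
  · have := h 1 0
    rw [epsLow_one_zero] at this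
    linear_combination (norm := module) (1 / 4 : ℂ) • this

/-- In the θ²θ̄ component, v is written through {Rbar, χ} and R is moved past Rbar. This leaves
[Rbar, φ] and σ∂χ, to which the Dirac equation applies. -/
lemma ad_Rbar_phi (r : c.SusyRelations S) (b : Fin 2) :
    ad (S.Rbar b) (c.phi F) = -c.lambar F b + ((m : ℂ) / 2) • c.chibarConj F b := by
  have h := r.Rbar_phi b
  have h0 := (c.isCovariant_chi S 0).ad_R_aad_Rbar 1 b
  have h1 := (c.isCovariant_chi S 1).ad_R_aad_Rbar 0 b
  have h2 := c.sigmaDeriv_chi (F := F) b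
  simp only [r.slash_eq_aad_Rbar_chi, map_add, map_smul, ad_sigmaDeriv, r.R_C] at h
  simp only [r.aad_R_chi, map_smul, epsLow_one_zero, epsLow_zero_one] at h0 h1
  linear_combination (norm := skip) (1 / 6 : ℂ) • h + (1 / 6 : ℂ) • h0 - (1 / 6 : ℂ) • h1 -
    (Complex.I / 2) • h2
  match_scalars <;> ring_nf <;> simp [Complex.I_sq]

lemma ad_R_phidag (r : c.SusyRelations S) (a : Fin 2) :
    ad (S.R a) (c.phidag F) = c.lam F a - ((m : ℂ) / 2) • c.chiConj F a := by
  have h := r.R_phidag a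
  have h0 := (c.isCovariant_chibar S 0).ad_R_aad_Rbar a 1
  have h1 := (c.isCovariant_chibar S 1).ad_R_aad_Rbar a 0
  have h2 := c.sigmaDeriv_chibar (F := F) a
  simp only [r.slash_eq_aad_R_chibar, map_sub, map_smul, ad_sigmaDeriv, r.Rbar_C, map_neg] at h
  simp only [r.aad_Rbar_chibar, map_smul, epsLow_one_zero, epsLow_zero_one] at h0 h1
  linear_combination (norm := skip) (-1 / 6 : ℂ) • h + (1 / 6 : ℂ) • h0 - (1 / 6 : ℂ) • h1 -
    (Complex.I / 2) • h2
  match_scalars <;> ring_nf <;> simp [Complex.I_sq]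

/-- The Jacobi identity for φ†, which Rbar annihilates, brings in m{Rbar, `chiConj`}. Applying Rbar
to the Dirac equation of χ̄ evaluates this product without dividing by m, so the massless case is
included. -/
lemma aad_Rbar_lam (r : c.SusyRelations S) (a b : Fin 2) :
    aad (S.Rbar b) (c.lam F a) = -Complex.I • sigmaDeriv a b (c.phidag F) := by
  have h0 := (c.isCovariant_phidag S).aad_R_ad_Rbar a b
  have h1 := congrArg (aad (S.Rbar b)) (c.sigmaDeriv_chibar (F := F) a)
  simp only [r.ad_Rbar_phidag, r.ad_R_phidag, map_zero, map_sub, map_smul] at h0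
  simp only [map_sub, aad_sigmaDeriv, r.aad_Rbar_chibar, map_smul] at h1
  revert b
  refine Fin.forall_fin_two.2 ⟨fun h0 h1 => ?_, fun h0 h1 => ?_⟩ <;>
  · simp only [epsLow_zero_zero, epsLow_zero_one, epsLow_one_zero, epsLow_one_one] at h1
    linear_combination (norm := skip) h0 - (Complex.I / 2) • h1
    match_scalars <;> ring_nf <;> simp [Complex.I_sq]

lemma aad_R_lambar (r : c.SusyRelations S) (a b : Fin 2) :
    aad (S.R a) (c.lambar F b) = Complex.I • sigmaDeriv a b (c.phi F) := by
  have h0 := (c.isCovariant_phi S).aad_R_ad_Rbar a b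
  have h1 := congrArg (aad (S.R a)) (c.sigmaDeriv_chi (F := F) b)
  simp only [r.ad_R_phi, r.ad_Rbar_phi, map_zero, map_add, map_neg, map_smul] at h0
  simp only [map_sub, aad_sigmaDeriv, r.aad_R_chi, map_smul] at h1
  revert a
  refine Fin.forall_fin_two.2 ⟨fun h0 h1 => ?_, fun h0 h1 => ?_⟩ <;>
  · simp only [epsLow_zero_zero, epsLow_zero_one, epsLow_one_zero, epsLow_one_one] at h1
    linear_combination (norm := skip) -h0 + (Complex.I / 2) • h1
    match_scalars <;> ring_nf <;> simp [Complex.I_sq]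

end SusyRelations

end Coefficients

end Derived

/-! ### Action of the charges on v and d. -/

section Derived

variable {H : Type*} [NormedAddCommGroup H] [InnerProductSpace ℂ H] {𝒬 : StateSpace H}
  {m : ℝ} {s n : ℕ} {F : FreeFields 𝒬 m s n}

open StateSpace

namespace Supercharges

variable (S : Supercharges F)

/-- Three anticommuting charges R with only two index values must give 0. -/
lemma ad_R_sub (a : Fin 2) (ψ : Fin 2 → 𝒬.Field) (hψ : ∃ φ : 𝒬.Field, ∀ b, ψ b = ad (S.R b) φ) :
    ad (S.R 0) (aad (S.R 1) (ψ a)) = 0 := by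
  obtain ⟨φ, hφ⟩ := hψ
  simp only [hφ]
  revert a
  refine Fin.forall_fin_two.2 ⟨?_, ?_⟩
  · have h1 := congrArg (ad (S.R 0)) (S.aad_R_ad_R 0 1 φ)
    have h2 := S.ad_R_aad_R 0 0 (ad (S.R 1) φ)
    rw [map_add, map_zero] at h1
    linear_combination (norm := module) h1 - (1 / 2 : ℂ) • h2
  · have h1 := congrArg (ad (S.R 0)) (S.aad_R_ad_R 1 1 φ)
    rw [map_add, map_zero] at h1
    linear_combination (norm := module) (1 / 2 : ℂ) • h1

lemma ad_Rbar_sub (a : Fin 2) (ψ : Fin 2 → 𝒬.Field)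
    (hψ : ∃ φ : 𝒬.Field, ∀ b, ψ b = ad (S.Rbar b) φ) :
    ad (S.Rbar 0) (aad (S.Rbar 1) (ψ a)) = 0 := by
  obtain ⟨φ, hφ⟩ := hψ
  simp only [hφ]
  revert a
  refine Fin.forall_fin_two.2 ⟨?_, ?_⟩
  · have h1 := congrArg (ad (S.Rbar 0)) (S.aad_Rbar_ad_Rbar 0 1 φ)
    have h2 := S.ad_Rbar_aad_Rbar 0 0 (ad (S.Rbar 1) φ)
    rw [map_add, map_zero] at h1
    linear_combination (norm := module) h1 - (1 / 2 : ℂ) • h2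
  · have h1 := congrArg (ad (S.Rbar 0)) (S.aad_Rbar_ad_Rbar 1 1 φ)
    rw [map_add, map_zero] at h1
    linear_combination (norm := module) (1 / 2 : ℂ) • h1

lemma ad_R_aad_R_sub (a : Fin 2) (ψ : Fin 2 → 𝒬.Field) :
    ad (S.R a) (aad (S.R 1) (ψ 0) - aad (S.R 0) (ψ 1)) = ad (S.R 0) (aad (S.R 1) (ψ a)) := by
  rw [map_sub]
  revert a
  refine Fin.forall_fin_two.2 ⟨?_, ?_⟩
  · linear_combination (norm := module) (-1 / 2 : ℂ) • S.ad_R_aad_R 0 0 (ψ 1)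
  · linear_combination (norm := module) (1 / 2 : ℂ) • S.ad_R_aad_R 1 1 (ψ 0) -
      S.ad_R_aad_R 0 1 (ψ 1)

lemma ad_Rbar_aad_Rbar_sub (a : Fin 2) (ψ : Fin 2 → 𝒬.Field) :
    ad (S.Rbar a) (aad (S.Rbar 1) (ψ 0) - aad (S.Rbar 0) (ψ 1)) =
      ad (S.Rbar 0) (aad (S.Rbar 1) (ψ a)) := by
  rw [map_sub]
  revert a
  refine Fin.forall_fin_two.2 ⟨?_, ?_⟩
  · linear_combination (norm := module) (-1 / 2 : ℂ) • S.ad_Rbar_aad_Rbar 0 0 (ψ 1)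
  · linear_combination (norm := module) (1 / 2 : ℂ) • S.ad_Rbar_aad_Rbar 1 1 (ψ 0) -
      S.ad_Rbar_aad_Rbar 0 1 (ψ 1)

end Supercharges

namespace Coefficients.SusyRelations

variable {c : Coefficients s n} {S : Supercharges F}

/-- Write v through {R, χ̄} and move Rbar past R. For b = d the translation term is already the
claimed one. -/
lemma ad_Rbar_slash (r : c.SusyRelations S) (b a d : Fin 2) : ad (S.Rbar b) (slash (c.v F) a d) =
    epsLow b d • ((2 : ℂ) • c.lam F a + (m : ℂ) • c.chiConj F a) -
      Complex.I • sigmaDeriv a d (c.chibar F b) := by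
  have h0 := (c.isCovariant_chibar S d).ad_R_aad_Rbar a b
  have h1 := c.sigmaDeriv_chibar (F := F) a
  rw [r.aad_Rbar_chibar, map_smul, r.ad_R_phidag] at h0
  rw [r.slash_eq_aad_R_chibar, map_sub, map_smul, ad_sigmaDeriv, r.Rbar_C, map_neg]
  revert b d
  simp only [Fin.forall_fin_two, epsLow_zero_zero, epsLow_zero_one, epsLow_one_zero, epsLow_one_one]
  refine ⟨⟨fun h => ?_, fun h => ?_⟩, fun h => ?_, fun h => ?_⟩
  · linear_combination (norm := module) h
  -- For b ≠ d the derivatives of χ̄_b and χ̄_d appear with exchanged indices, and their difference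
  -- is the Dirac operator on χ̄.
  · linear_combination (norm := skip) h + (2 * Complex.I) • h1
    match_scalars <;> ring_nf <;> simp [Complex.I_sq]
  · linear_combination (norm := skip) h - (2 * Complex.I) • h1
    match_scalars <;> ring_nf <;> simp [Complex.I_sq]
  · linear_combination (norm := module) h

lemma ad_R_slash (r : c.SusyRelations S) (b a d : Fin 2) : ad (S.R b) (slash (c.v F) a d) =
    -epsLow b a • ((2 : ℂ) • c.lambar F d + (m : ℂ) • c.chibarConj F d) -
      Complex.I • sigmaDeriv a d (c.chi F b) := by
  have h0 := (c.isCovariant_chi S a).ad_R_aad_Rbar b d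
  have h1 := c.sigmaDeriv_chi (F := F) d
  rw [r.aad_R_chi, map_smul, r.ad_Rbar_phi] at h0
  rw [r.slash_eq_aad_Rbar_chi, map_add, map_smul, ad_sigmaDeriv, r.R_C]
  revert a b
  simp only [Fin.forall_fin_two, epsLow_zero_zero, epsLow_zero_one, epsLow_one_zero, epsLow_one_one]
  refine ⟨⟨fun h => ?_, fun h => ?_⟩, fun h => ?_, fun h => ?_⟩
  · linear_combination (norm := module) h
  · linear_combination (norm := skip) h + (2 * Complex.I) • h1
    match_scalars <;> ring_nf <;> simp [Complex.I_sq]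
  · linear_combination (norm := skip) h - (2 * Complex.I) • h1
    match_scalars <;> ring_nf <;> simp [Complex.I_sq]
  · linear_combination (norm := module) h

lemma ad_Rbar_aad_Rbar_chi (r : c.SusyRelations S) (a b d : Fin 2) :
    ad (S.Rbar b) (aad (S.Rbar d) (c.chi F a)) =
      epsLow b d • ((2 : ℂ) • c.lam F a + (m : ℂ) • c.chiConj F a) := by
  rw [r.aad_Rbar_chi, map_sub, map_smul, ad_sigmaDeriv, r.Rbar_C, map_neg, r.ad_Rbar_slash]
  module

lemma ad_R_aad_R_chibar (r : c.SusyRelations S) (a b d : Fin 2) :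
    ad (S.R b) (aad (S.R d) (c.chibar F a)) =
      -epsLow b d • ((2 : ℂ) • c.lambar F a + (m : ℂ) • c.chibarConj F a) := by
  rw [r.aad_R_chibar, map_add, map_smul, ad_sigmaDeriv, r.R_C, r.ad_R_slash]
  module

/-- In [R_a, 8d], the RRλ part reduces to a mass term, because λ differs from [R, φ†] by
(m/2)`chiConj`. The part with λ̄ is handled by moving R past Rbar. All remaining derivatives combine
into Dirac operators. -/
lemma ad_R_d (r : c.SusyRelations S) (a : Fin 2) :
    ad (S.R a) (c.d F) = -((m : ℂ) / 2) • c.lamConj F a := by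
  have hd := congrArg (ad (S.R a)) r.R_lam
  rw [map_add, S.ad_R_aad_R_sub a (c.lam F), map_smul, map_sub] at hd
  have e1 : ad (S.R 0) (aad (S.R 1) (c.lam F a)) =
      (m / 2 : ℂ) • ad (S.R 0) (aad (S.R 1) (c.chiConj F a)) := by
    have := S.ad_R_sub a (fun b => c.lam F b - ((m : ℂ) / 2) • c.chiConj F b)
      ⟨_, fun b => (r.ad_R_phidag b).symm⟩
    rw [map_sub, map_sub, map_smul, map_smul] at this
    exact sub_eq_zero.1 this
  -- Only m·`chiConj` is needed, and the Dirac equation expresses it by derivatives of χ̄.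
  have e2 := congrArg (fun X => ad (S.R 0) (aad (S.R 1) X)) (c.sigmaDeriv_chibar (F := F) a)
  simp only [map_sub, map_smul, aad_sigmaDeriv, ad_sigmaDeriv, r.ad_R_aad_R_chibar, epsLow_zero_one,
    map_add] at e2
  have e3 (b d : Fin 2) := (c.isCovariant_lambar S d).ad_R_aad_Rbar a b
  simp only [r.aad_R_lambar, map_smul, ad_sigmaDeriv, r.ad_Rbar_phi, map_add, map_neg] at e3
  have l1 := c.sigmaDeriv_lambar (F := F) a
  linear_combination (norm := skip) (-1 / 8 : ℂ) • hd + (1 / 8 : ℂ) • e1 - (Complex.I / 16) • e2 +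
    (1 / 8 : ℂ) • e3 1 0 - (1 / 8 : ℂ) • e3 0 1 - (Complex.I / 2) • l1
  match_scalars <;> ring_nf <;> simp [Complex.I_sq]

lemma ad_Rbar_d (r : c.SusyRelations S) (a : Fin 2) :
    ad (S.Rbar a) (c.d F) = ((m : ℂ) / 2) • c.lambarConj F a := by
  have hd := congrArg (ad (S.Rbar a)) r.R_lam
  rw [map_add, S.ad_Rbar_aad_Rbar_sub a (c.lambar F), map_smul, map_sub] at hd
  have e1 : ad (S.Rbar 0) (aad (S.Rbar 1) (c.lambar F a)) =
      (m / 2 : ℂ) • ad (S.Rbar 0) (aad (S.Rbar 1) (c.chibarConj F a)) := by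
    have := S.ad_Rbar_sub a (fun b => -c.lambar F b + ((m : ℂ) / 2) • c.chibarConj F b)
      ⟨_, fun b => (r.ad_Rbar_phi b).symm⟩
    rw [map_add, map_add, map_smul, map_smul, map_neg, map_neg] at this
    exact (neg_add_eq_zero.1 this)
  have e2 := congrArg (fun X => ad (S.Rbar 0) (aad (S.Rbar 1) X)) (c.sigmaDeriv_chi (F := F) a)
  simp only [map_sub, map_smul, aad_sigmaDeriv, ad_sigmaDeriv, r.ad_Rbar_aad_Rbar_chi,
    epsLow_zero_one, map_add] at e2
  have e3 (b d : Fin 2) := (c.isCovariant_lam S d).ad_R_aad_Rbar b a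
  simp only [r.aad_Rbar_lam, map_smul, ad_sigmaDeriv, r.ad_R_phidag, map_sub] at e3
  have l1 := c.sigmaDeriv_lam (F := F) a
  linear_combination (norm := skip) (-1 / 8 : ℂ) • hd + (1 / 8 : ℂ) • e1 + (Complex.I / 16) • e2 +
    (1 / 8 : ℂ) • e3 1 0 - (1 / 8 : ℂ) • e3 0 1 - (Complex.I / 2) • l1
  match_scalars <;> ring_nf <;> simp [Complex.I_sq]

end Coefficients.SusyRelations

end Derived

/-! ### Causal commutators of the component fields -/

section Causal

variable {H : Type*} [NormedAddCommGroup H] [InnerProductSpace ℂ H] {𝒬 : StateSpace H}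
  {m : ℝ} {s n : ℕ} {F : FreeFields 𝒬 m s n}

open StateSpace

/-- The distribution `D_m(x - y) 1`. -/
def opD (𝒬 : StateSpace H) (m : ℝ) : TestFn → TestFn → 𝒬.Op := scalarK 𝒬 (kerD m)

/-- The distribution `(∂_μ D_m)(x - y) 1`. -/
def opdD (𝒬 : StateSpace H) (m : ℝ) (μ : Fin 4) : TestFn → TestFn → 𝒬.Op := scalarK 𝒬 (kerdD m μ)

/-- The distribution `σ^μ_{a b̄} (∂_μ D_m)(x - y) 1`. -/
def opSigmaD (𝒬 : StateSpace H) (m : ℝ) (a b : Fin 2) : TestFn → TestFn → 𝒬.Op :=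
  scalarK 𝒬 (kerSigmaD m a b)

lemma comm_smul_kerD {φ ψ : 𝒬.Field} {z : ℂ} : Comm φ ψ (z • kerD m) ↔ cm φ ψ = z • opD 𝒬 m := by
  rw [comm_iff, map_smul, opD]

lemma anticomm_smul_kerD {φ ψ : 𝒬.Field} {z : ℂ} :
    Anticomm φ ψ (z • kerD m) ↔ am φ ψ = z • opD 𝒬 m := by
  rw [anticomm_iff, map_smul, opD]

lemma anticomm_smul_kerSigmaD {φ ψ : 𝒬.Field} {z : ℂ} {a b : Fin 2} :
    Anticomm φ ψ (z • kerSigmaD m a b) ↔ am φ ψ = z • opSigmaD 𝒬 m a b := by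
  rw [anticomm_iff, map_smul, opSigmaD]

lemma smul_opD_injective {z w : ℂ} (h : z • opD 𝒬 m = w • opD 𝒬 m) : z = w := by
  rw [opD, ← map_smul, ← map_smul] at h
  exact smul_left_injective ℂ (kerD_ne_zero m) (scalarK_injective h)

/-- Diagonal spinor components suffice, since one of them is nonzero. -/
lemma smul_opSigmaD_injective {z w : ℂ}
    (h : ∀ a, z • opSigmaD 𝒬 m a a = w • opSigmaD 𝒬 m a a) : z = w := by
  obtain ⟨a, ha⟩ := kerSigmaD_ne_zero m
  have := h a
  rw [opSigmaD, ← map_smul, ← map_smul] at this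
  exact smul_left_injective ℂ ha (scalarK_injective this)

lemma swapArgs_opD (F : FreeFields 𝒬 m s n) (j : Fin s) :
    swapArgs 𝒬.Op (opD 𝒬 m) = -opD 𝒬 m := by
  rw [opD, scalarK_swapArgs, swapArgs_kerD F j, map_neg]

lemma swapArgs_opSigmaD (S : Supercharges F) (j : Fin s) (a b : Fin 2) :
    swapArgs 𝒬.Op (opSigmaD 𝒬 m a b) = opSigmaD 𝒬 m a b := by
  rw [opSigmaD, scalarK_swapArgs, swapArgs_kerSigmaD S j]

lemma cm_sigmaDeriv_right (a b : Fin 2) (φ ψ : 𝒬.Field) :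
    cm φ (sigmaDeriv a b ψ) = ∑ μ, pauli μ a b • derivRight 𝒬.Op μ (cm φ ψ) := by
  simp only [sigmaDeriv_apply, map_sum, map_smul, cm_fieldDeriv_right]

lemma am_sigmaDeriv_left (a b : Fin 2) (φ ψ : 𝒬.Field) :
    am (sigmaDeriv a b φ) ψ = ∑ μ, pauli μ a b • derivLeft 𝒬.Op μ (am φ ψ) := by
  simp only [sigmaDeriv_apply, map_sum, map_smul, LinearMap.sum_apply, LinearMap.smul_apply,
    am_fieldDeriv_left]

lemma am_sigmaDeriv_right (a b : Fin 2) (φ ψ : 𝒬.Field) :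
    am φ (sigmaDeriv a b ψ) = ∑ μ, pauli μ a b • derivRight 𝒬.Op μ (am φ ψ) := by
  simp only [sigmaDeriv_apply, map_sum, map_smul, am_fieldDeriv_right]

lemma sum_pauli_derivRight_smul_opD (S : Supercharges F) (j : Fin s) (a b : Fin 2) (z : ℂ) :
    ∑ μ, pauli μ a b • derivRight 𝒬.Op μ (z • opD 𝒬 m) = (-z) • opSigmaD 𝒬 m a b := by
  simp only [map_smul, opD, scalarK_derivRight, derivRight_kerD S j, opSigmaD, kerSigmaD, map_sum,
    map_neg, Finset.smul_sum]
  refine Finset.sum_congr rfl fun μ _ => ?_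
  rw [neg_smul, smul_neg, smul_neg, smul_comm]

lemma cm_sigmaDeriv_right_of_eq (S : Supercharges F) (j : Fin s) {φ ψ : 𝒬.Field} {z : ℂ}
    (h : cm φ ψ = z • opD 𝒬 m) (a b : Fin 2) :
    cm φ (sigmaDeriv a b ψ) = (-z) • opSigmaD 𝒬 m a b := by
  rw [cm_sigmaDeriv_right, h, sum_pauli_derivRight_smul_opD S j]

lemma am_sigmaDeriv_right_of_eq (S : Supercharges F) (j : Fin s) {φ ψ : 𝒬.Field} {z : ℂ}
    (h : am φ ψ = z • opD 𝒬 m) (a b : Fin 2) :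
    am φ (sigmaDeriv a b ψ) = (-z) • opSigmaD 𝒬 m a b := by
  rw [am_sigmaDeriv_right, h, sum_pauli_derivRight_smul_opD S j]

lemma cm_slash_right (φ : 𝒬.Field) (v : Fin 4 → 𝒬.Field) (a b : Fin 2) :
    cm φ (slash v a b) = ∑ μ, pauli μ a b • cm φ (v μ) := by
  simp only [slash, map_sum, map_smul]

lemma cm_slash_left (v : Fin 4 → 𝒬.Field) (φ : 𝒬.Field) (a b : Fin 2) :
    cm (slash v a b) φ = ∑ μ, pauli μ a b • cm (v μ) φ := by
  simp only [slash, map_sum, map_smul, LinearMap.sum_apply, LinearMap.smul_apply]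

lemma cm_comm_of_eq (F : FreeFields 𝒬 m s n) (j : Fin s) {φ ψ : 𝒬.Field} {z : ℂ}
    (h : cm φ ψ = z • opD 𝒬 m) : cm ψ φ = z • opD 𝒬 m := by
  rw [cm_swap, h, map_smul, swapArgs_opD F j, smul_neg, neg_neg]

lemma cm_comm_of_eq_zero {φ ψ : 𝒬.Field} (h : cm φ ψ = 0) : cm ψ φ = 0 := by
  rw [cm_swap, h, map_zero, neg_zero]

namespace FreeFields

lemma am_fSum_fSum_eq (z w : Fin n → ℂ) (a b : Fin 2) : am (F.fSum z a) (F.fSum w b) =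
    (Complex.I * m * (z ⬝ᵥ w) * epsLow a b) • opD 𝒬 m := by
  rw [am_fSum_fSum, map_smul, opD]; rfl

lemma am_fbarSum_fbarSum_eq (z w : Fin n → ℂ) (a b : Fin 2) :
    am (F.fbarSum z a) (F.fbarSum w b) =
      (-(Complex.I * m * (z ⬝ᵥ w) * epsLow a b)) • opD 𝒬 m := by
  rw [am_fbarSum_fbarSum, map_smul, opD]; rfl

lemma am_fSum_fbarSum_eq (z w : Fin n → ℂ) (a b : Fin 2) : am (F.fSum z a) (F.fbarSum w b) =
    (z ⬝ᵥ w) • opSigmaD 𝒬 m a b := by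
  rw [am_fSum_fbarSum, map_smul, opSigmaD]; rfl

lemma am_fbarSum_fSum_eq (S : Supercharges F) (j : Fin s) (z w : Fin n → ℂ) (a b : Fin 2) :
    am (F.fbarSum z a) (F.fSum w b) = (w ⬝ᵥ z) • opSigmaD 𝒬 m b a := by
  rw [am_swap, am_fSum_fbarSum_eq, map_smul, swapArgs_opSigmaD S j]

/-- A field commuting with all spinor fields. -/
def IsBose (F : FreeFields 𝒬 m s n) (φ : 𝒬.Field) : Prop :=
  ∀ A a, cm φ (F.f A a) = 0 ∧ cm φ (F.fbar A a) = 0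

lemma isBose_b (j : Fin s) : F.IsBose (F.b j) := fun A a =>
  ⟨(comm_iff.1 (F.b_f j A a)).trans (map_zero _), (comm_iff.1 (F.b_fbar j A a)).trans (map_zero _)⟩

lemma isBose_bv (μ : Fin 4) : F.IsBose (F.bv μ) := fun A a =>
  ⟨(comm_iff.1 (F.bv_f μ A a)).trans (map_zero _),
    (comm_iff.1 (F.bv_fbar μ A a)).trans (map_zero _)⟩

namespace IsBose

lemma add {φ ψ : 𝒬.Field} (h : F.IsBose φ) (h' : F.IsBose ψ) : F.IsBose (φ + ψ) := fun A a => by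
  simp only [map_add, LinearMap.add_apply, (h A a).1, (h A a).2, (h' A a).1, (h' A a).2, add_zero,
    and_self]

lemma smul (z : ℂ) {φ : 𝒬.Field} (h : F.IsBose φ) : F.IsBose (z • φ) := fun A a => by
  simp only [map_smul, LinearMap.smul_apply, (h A a).1, (h A a).2, smul_zero, and_self]

lemma sum {ι : Type*} [Fintype ι] {φ : ι → 𝒬.Field} (h : ∀ i, F.IsBose (φ i)) :
    F.IsBose (∑ i, φ i) := fun A a => by
  simp only [map_sum, LinearMap.sum_apply, (h _ A a).1, (h _ A a).2, Finset.sum_const_zero,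
    and_self]

lemma fieldDeriv {φ : 𝒬.Field} (h : F.IsBose φ) (μ : Fin 4) : F.IsBose (fieldDeriv μ φ) :=
  fun A a => by
    simp only [cm_fieldDeriv_left, (h A a).1, (h A a).2, map_zero, and_self]

lemma cm_fSum {φ : 𝒬.Field} (h : F.IsBose φ) (z : Fin n → ℂ) (a : Fin 2) :
    cm φ (F.fSum z a) = 0 := by
  simp only [FreeFields.fSum, map_sum, map_smul, (h _ a).1, smul_zero, Finset.sum_const_zero]

lemma cm_fbarSum {φ : 𝒬.Field} (h : F.IsBose φ) (z : Fin n → ℂ) (a : Fin 2) :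
    cm φ (F.fbarSum z a) = 0 := by
  simp only [FreeFields.fbarSum, map_sum, map_smul, (h _ a).2, smul_zero, Finset.sum_const_zero]

lemma sigmaDeriv {φ : 𝒬.Field} (h : F.IsBose φ) (a b : Fin 2) : F.IsBose (sigmaDeriv a b φ) := by
  rw [sigmaDeriv_apply]; exact .sum fun μ => (h.fieldDeriv μ).smul _

end IsBose

lemma isBose_div : F.IsBose (div F.bv) :=
  .sum fun μ => .sum fun ρ => .smul _ ((F.isBose_bv ρ).fieldDeriv μ)

lemma cm_b_div (j : Fin s) : cm (F.b j) (div F.bv) = 0 := by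
  have h : div F.bv = ∑ μ, ∑ ρ, (metric μ ρ : ℂ) • StateSpace.fieldDeriv μ (F.bv ρ) := rfl
  simp only [h, map_sum, map_smul, cm_fieldDeriv_right, comm_iff.1 (F.b_bv j _), map_zero,
    smul_zero, Finset.sum_const_zero]

lemma cm_sum_b_sum_b (z w : Fin s → ℂ) : cm (∑ j, z j • F.b j) (∑ j, w j • F.b j) =
    (-Complex.I * ∑ j, z j * w j) • opD 𝒬 m := by
  simp only [map_sum, map_smul, LinearMap.sum_apply, LinearMap.smul_apply,
    comm_iff.1 (F.b_b _ _)]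
  simp only [Finset.mul_sum, Finset.sum_smul]
  refine Finset.sum_congr rfl fun B _ => ?_
  rw [Finset.sum_eq_single B]
  · simp only [if_true, map_smul, smul_smul, opD]; congr 1; ring
  · intro A _ hA; simp [hA]
  · simp

lemma cm_sum_b_add_div (z w : Fin s → ℂ) (w₀ : ℂ) :
    cm (∑ j, z j • F.b j) ((∑ j, w j • F.b j) + w₀ • div F.bv) =
      (-Complex.I * ∑ j, z j * w j) • opD 𝒬 m := by
  have h : cm (∑ j, z j • F.b j) (div F.bv) = 0 := by
    simp only [map_sum, map_smul, LinearMap.sum_apply, LinearMap.smul_apply, F.cm_b_div, smul_zero,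
      Finset.sum_const_zero]
  rw [map_add, map_smul, h, smul_zero, add_zero, cm_sum_b_sum_b]

end FreeFields

namespace Coefficients

variable (c : Coefficients s n)

lemma isBose_C : F.IsBose (c.C F) := .sum fun j => .smul _ (F.isBose_b j)

lemma isBose_phi : F.IsBose (c.phi F) :=
  .add (.sum fun j => .smul _ (F.isBose_b j)) (.smul _ F.isBose_div)

lemma isBose_phidag : F.IsBose (c.phidag F) :=
  .add (.sum fun j => .smul _ (F.isBose_b j)) (.smul _ F.isBose_div)

lemma isBose_d : F.IsBose (c.d F) :=
  .add (.sum fun j => .smul _ (F.isBose_b j)) (.smul _ F.isBose_div)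

lemma isBose_v (μ : Fin 4) : F.IsBose (c.v F μ) :=
  .add (.smul _ (F.isBose_bv μ)) (.sum fun j => .smul _ ((F.isBose_b j).fieldDeriv μ))

lemma isBose_slash (a b : Fin 2) : F.IsBose (slash (c.v F) a b) :=
  .sum fun μ => .smul _ (c.isBose_v μ)

lemma bose_fermi (φ ψ : 𝒬.Field)
    (hφ : φ = c.C F ∨ φ = c.phi F ∨ φ = c.phidag F ∨ φ = c.d F ∨ ∃ μ, φ = c.v F μ)
    (hψ : ∃ a, ψ = c.chi F a ∨ ψ = c.chibar F a ∨ ψ = c.lam F a ∨ ψ = c.lambar F a) :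
    Comm φ ψ 0 := by
  have h : F.IsBose φ := by
    rcases hφ with rfl | rfl | rfl | rfl | ⟨μ, rfl⟩
    exacts [c.isBose_C, c.isBose_phi, c.isBose_phidag, c.isBose_d, c.isBose_v μ]
  rw [comm_iff, map_zero]
  rcases hψ with ⟨a, rfl | rfl | rfl | rfl⟩
  exacts [h.cm_fSum _ a, h.cm_fbarSum _ a, h.cm_fSum _ a, h.cm_fbarSum _ a]

lemma chi_eq_fSum (a : Fin 2) : c.chi F a = F.fSum c.α a := rfl

lemma lam_eq_fSum (a : Fin 2) : c.lam F a = F.fSum c.β a := rfl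

lemma chibar_eq_fbarSum (a : Fin 2) : c.chibar F a = F.fbarSum (star c.α) a := rfl

lemma lambar_eq_fbarSum (a : Fin 2) : c.lambar F a = F.fbarSum (star c.β) a := rfl

lemma chiConj_eq_fSum (a : Fin 2) : c.chiConj F a = F.fSum (star c.α) a := rfl

lemma chibarConj_eq_fbarSum (a : Fin 2) : c.chibarConj F a = F.fbarSum c.α a := rfl

lemma lamConj_eq_fSum (a : Fin 2) : c.lamConj F a = F.fSum (star c.β) a := rfl

lemma lambarConj_eq_fbarSum (a : Fin 2) : c.lambarConj F a = F.fbarSum c.β a := rfl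

/-- `∑ γ_j²`. -/
def normSq : ℂ := ∑ j, (c.γ j : ℂ) ^ 2

/-- The parameter `β = -i ∑ γ_j ρ_j`. -/
def beta : ℂ := -Complex.I * ∑ j, (c.γ j : ℂ) * c.ρ j

lemma cm_C_C : cm (c.C F) (c.C F) = (-Complex.I * c.normSq) • opD 𝒬 m := by
  rw [C, FreeFields.cm_sum_b_sum_b]
  simp only [normSq, pow_two]

lemma cm_C_phi : cm (c.C F) (c.phi F) = c.beta • opD 𝒬 m := F.cm_sum_b_add_div _ _ _

end Coefficients

end Causal

/-! ### Products of the coefficient vectors forced by Jacobi identities. -/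

section Causal

variable {H : Type*} [NormedAddCommGroup H] [InnerProductSpace ℂ H] {𝒬 : StateSpace H}
  {m : ℝ} {s n : ℕ} {F : FreeFields 𝒬 m s n}

open StateSpace

namespace Coefficients

variable (c : Coefficients s n)

lemma cm_C_chi (a : Fin 2) : cm (c.C F) (c.chi F a) = 0 := c.isBose_C.cm_fSum _ a

lemma cm_C_chibar (a : Fin 2) : cm (c.C F) (c.chibar F a) = 0 := c.isBose_C.cm_fbarSum _ a

namespace SusyRelations

variable {c : Coefficients s n} {S : Supercharges F}

/-- The anticommutator of χ and χ̄ is obtained once by transferring Rbar and once by transferring R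
from C. In the two results [C, v] and [C, σ∂C] enter with different relative signs, so both are
determined. -/
lemma star_dot_and_cm_C_slash (r : c.SusyRelations S) (j : Fin s) :
    c.α ⬝ᵥ star c.α = c.normSq ∧ ∀ a b, cm (c.C F) (slash (c.v F) a b) = 0 := by
  have h1 (a b : Fin 2) := am_ad_left (S.Rbar b) (c.cm_C_chi (F := F) a)
  have h2 (a b : Fin 2) := am_ad_left (S.R a) (c.cm_C_chibar (F := F) b)
  simp only [r.Rbar_C, r.R_C, r.aad_Rbar_chi, r.aad_R_chibar, map_add, map_sub, map_smul, map_neg,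
    cm_sigmaDeriv_right_of_eq S j c.cm_C_C, LinearMap.neg_apply, smul_smul] at h1 h2
  simp only [chi_eq_fSum, chibar_eq_fbarSum, FreeFields.am_fbarSum_fSum_eq S j,
    FreeFields.am_fSum_fbarSum_eq] at h1 h2
  have hN : Complex.I * -(-Complex.I * c.normSq) = -c.normSq := by
    linear_combination c.normSq * Complex.I_mul_I
  rw [hN] at h1 h2
  have h3 : c.α ⬝ᵥ star c.α = c.normSq := by
    refine smul_opSigmaD_injective (𝒬 := 𝒬) (m := m) fun a => ?_
    linear_combination (norm := module) (-1 / 2 : ℂ) • h1 a a + (1 / 2 : ℂ) • h2 a a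
  refine ⟨h3, fun a b => ?_⟩
  linear_combination (norm := module) (1 / 2 : ℂ) • h1 a b + (1 / 2 : ℂ) • h2 a b

lemma alpha_dot_star_alpha (r : c.SusyRelations S) (j : Fin s) : c.α ⬝ᵥ star c.α = c.normSq :=
  (r.star_dot_and_cm_C_slash j).1

lemma cm_C_slash (r : c.SusyRelations S) (j : Fin s) (a b : Fin 2) :
    cm (c.C F) (slash (c.v F) a b) = 0 := (r.star_dot_and_cm_C_slash j).2 a b

lemma am_chi_chi (r : c.SusyRelations S) (a b : Fin 2) :
    am (c.chi F a) (c.chi F b) = (2 * c.beta * epsLow a b) • opD 𝒬 m := by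
  have h := am_ad_left (S.R a) (c.cm_C_chi (F := F) b)
  rw [r.R_C, r.aad_R_chi, map_smul, c.cm_C_phi] at h
  rw [h]
  module

/-- Compares {χ, χ} computed from the free fields with its value -[C, {R, χ}]. -/
lemma alpha_dot_alpha (r : c.SusyRelations S) : Complex.I * m * (c.α ⬝ᵥ c.α) = 2 * c.beta := by
  have h := r.am_chi_chi 0 1
  rw [chi_eq_fSum, chi_eq_fSum, FreeFields.am_fSum_fSum_eq, epsLow_zero_one, mul_one, mul_one] at h
  exact smul_opD_injective h

lemma am_chi_lambar (r : c.SusyRelations S) (j : Fin s) (a b : Fin 2) :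
    am (c.chi F a) (c.lambar F b) = (Complex.I * c.beta) • opSigmaD 𝒬 m a b := by
  have h := am_ad_left (S.R a) (show cm (c.C F) (c.lambar F b) = 0 from c.isBose_C.cm_fbarSum _ b)
  rw [r.R_C, r.aad_R_lambar, map_smul, cm_sigmaDeriv_right_of_eq S j c.cm_C_phi] at h
  rw [h]
  module

lemma alpha_dot_star_beta (r : c.SusyRelations S) (j : Fin s) :
    c.α ⬝ᵥ star c.β = Complex.I * c.beta :=
  smul_opSigmaD_injective (𝒬 := 𝒬) (m := m) fun a =>
    (FreeFields.am_fSum_fbarSum_eq c.α (star c.β) a a).symm.trans (r.am_chi_lambar j a a)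

lemma beta_dot_star_alpha (r : c.SusyRelations S) (j : Fin s) :
    c.β ⬝ᵥ star c.α = -Complex.I * conj c.beta := by
  have h := congrArg conj (r.alpha_dot_star_beta j)
  rw [map_mul, Complex.conj_I] at h
  rw [← h]
  change _ = star _
  rw [dotProduct_comm, Matrix.star_dotProduct, dotProduct_comm c.α]

/-- Since 2φ = {R_0, χ_1} up to sign, the bracket becomes {χ_1, [R_0, φ†]}, an anticommutator of
spinors. -/
lemma cm_phi_phidag (r : c.SusyRelations S) (j : Fin s) : cm (c.phi F) (c.phidag F) =
    (Complex.I * m / 2 * (c.α ⬝ᵥ c.β - m / 2 * c.normSq)) • opD 𝒬 m := by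
  have h := am_ad_right (S.R 0)
    (show cm (c.chi F 1) (c.phidag F) = 0 from cm_comm_of_eq_zero (c.isBose_phidag.cm_fSum _ 1))
  rw [r.ad_R_phidag, r.aad_R_chi, map_sub, map_smul, map_smul, LinearMap.smul_apply, chi_eq_fSum,
    lam_eq_fSum, chiConj_eq_fSum, FreeFields.am_fSum_fSum_eq, FreeFields.am_fSum_fSum_eq,
    r.alpha_dot_star_alpha j, epsLow_zero_one, epsLow_one_zero] at h
  linear_combination (norm := module) (1 / 2 : ℂ) • h

lemma cm_phidag_phi (r : c.SusyRelations S) (j : Fin s) : cm (c.phidag F) (c.phi F) =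
    (Complex.I * m / 2 * (star c.α ⬝ᵥ star c.β - m / 2 * c.normSq)) • opD 𝒬 m := by
  have h := am_ad_right (S.Rbar 0)
    (show cm (c.chibar F 1) (c.phi F) = 0 from cm_comm_of_eq_zero (c.isBose_phi.cm_fbarSum _ 1))
  rw [r.ad_Rbar_phi, r.aad_Rbar_chibar, map_add, map_neg, map_smul, map_smul, LinearMap.smul_apply,
    chibar_eq_fbarSum, lambar_eq_fbarSum, chibarConj_eq_fbarSum, FreeFields.am_fbarSum_fbarSum_eq,
    FreeFields.am_fbarSum_fbarSum_eq, dotProduct_comm (star c.α) c.α, r.alpha_dot_star_alpha j,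
    epsLow_zero_one, epsLow_one_zero] at h
  linear_combination (norm := module) (1 / 2 : ℂ) • h

/-- The product m α·β is real: [φ, φ†] and [φ†, φ] are computed independently, and antisymmetry of
D_m makes their coefficients equal. -/
lemma mul_star_alpha_dot_star_beta (r : c.SusyRelations S) (j : Fin s) :
    m * (star c.α ⬝ᵥ star c.β) = m * (c.α ⬝ᵥ c.β) := by
  have h := smul_opD_injective ((r.cm_phidag_phi j).symm.trans
    (cm_comm_of_eq F j (r.cm_phi_phidag j)))
  linear_combination (-2 * Complex.I) * h + (star c.α ⬝ᵥ star c.β - c.α ⬝ᵥ c.β) * m *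
    Complex.I_mul_I

lemma cm_phi_phi (r : c.SusyRelations S) : cm (c.phi F) (c.phi F) = 0 := by
  have h := am_ad_right (S.R 0)
    (show cm (c.chi F 1) (c.phi F) = 0 from cm_comm_of_eq_zero (c.isBose_phi.cm_fSum _ 1))
  rw [r.ad_R_phi, r.aad_R_chi, map_zero, map_smul, LinearMap.smul_apply, epsLow_zero_one] at h
  linear_combination (norm := module) (1 / 2 : ℂ) • h

lemma cm_phi_slash (r : c.SusyRelations S) (j : Fin s) (a b : Fin 2) :
    cm (c.phi F) (slash (c.v F) a b) = (Complex.I * c.beta) • opSigmaD 𝒬 m a b := by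
  have h := am_ad_left (S.Rbar b)
    (show cm (c.phi F) (c.chi F a) = 0 from c.isBose_phi.cm_fSum _ a)
  rw [r.ad_Rbar_phi, r.aad_Rbar_chi, map_add, map_neg, map_smul, map_sub, map_smul,
    LinearMap.add_apply, LinearMap.neg_apply, LinearMap.smul_apply,
    cm_sigmaDeriv_right_of_eq S j (cm_comm_of_eq F j c.cm_C_phi), lambar_eq_fbarSum,
    chibarConj_eq_fbarSum, chi_eq_fSum, FreeFields.am_fbarSum_fSum_eq S j,
    FreeFields.am_fbarSum_fSum_eq S j, r.alpha_dot_star_beta j] at h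
  have e : (m / 2 : ℂ) * (c.α ⬝ᵥ c.α) = -Complex.I * c.beta := by
    linear_combination (-Complex.I / 2) * r.alpha_dot_alpha +
      (m / 2 * (c.α ⬝ᵥ c.α)) * Complex.I_mul_I
  rw [smul_smul, e] at h
  linear_combination (norm := module) h

/-- The identity {[Rbar, φ], λ} = -[φ, {Rbar, λ}] contains (m/2)α·β on both sides. It cancels,
leaving a multiple of m², and this excludes λ ≠ 0 in the massless case. -/
lemma beta_dot_star_beta (r : c.SusyRelations S) (j : Fin s) :
    c.β ⬝ᵥ star c.β = (m : ℂ) ^ 2 / 4 * c.normSq := by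
  refine smul_opSigmaD_injective (𝒬 := 𝒬) (m := m) fun a => ?_
  have h := am_ad_left (S.Rbar a)
    (show cm (c.phi F) (c.lam F a) = 0 from c.isBose_phi.cm_fSum _ a)
  rw [r.ad_Rbar_phi, r.aad_Rbar_lam, map_add, map_neg, map_smul, map_smul,
    LinearMap.add_apply, LinearMap.neg_apply, LinearMap.smul_apply,
    cm_sigmaDeriv_right_of_eq S j (r.cm_phi_phidag j), lambar_eq_fbarSum,
    chibarConj_eq_fbarSum, lam_eq_fSum, FreeFields.am_fbarSum_fSum_eq S j,
    FreeFields.am_fbarSum_fSum_eq S j, dotProduct_comm c.β c.α] at h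
  have e : -Complex.I * -(Complex.I * m / 2 * (c.α ⬝ᵥ c.β - m / 2 * c.normSq)) =
    -(m / 2 * (c.α ⬝ᵥ c.β - m / 2 * c.normSq)) := by
      linear_combination (m / 2 * (c.α ⬝ᵥ c.β - m / 2 * c.normSq)) * Complex.I_mul_I
  rw [smul_smul (-Complex.I), e] at h
  linear_combination (norm := module) -h

/-- B = {Rbar_0, χ_0} commutes with φ†, hence with {Rbar_1, λ_1}, a derivative of φ†. Transferring
Rbar_1 shows that [Rbar_1, B] anticommutes with λ_1. As [Rbar_1, B] is a multiple of 2λ_0 +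
m`chiConj` 0, β·β is reduced to β·ᾱ. -/
lemma beta_dot_beta (r : c.SusyRelations S) (j : Fin s) :
    Complex.I * m * (c.β ⬝ᵥ c.β) = -((m : ℂ) ^ 2 * conj c.beta / 2) := by
  have h1 := am_ad_right (S.Rbar 0)
    (show cm (c.chi F 0) (c.phidag F) = 0 from cm_comm_of_eq_zero (c.isBose_phidag.cm_fSum _ 0))
  have hB : F.IsBose (aad (S.Rbar 0) (c.chi F 0)) := by
    rw [r.aad_Rbar_chi, sub_eq_add_neg, ← neg_one_smul ℂ]
    exact (c.isBose_slash 0 0).add (((c.isBose_C.sigmaDeriv 0 0).smul _).smul _)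
  have h2 := am_ad_left (S.Rbar 1) (show cm (aad (S.Rbar 0) (c.chi F 0)) (c.lam F 1) = 0 from
    hB.cm_fSum _ 1)
  rw [r.ad_Rbar_phidag, map_zero] at h1
  rw [r.ad_Rbar_aad_Rbar_chi, r.aad_Rbar_lam, map_smul (cm _), cm_sigmaDeriv_right, ← h1,
    map_smul, map_add, map_smul, map_smul, LinearMap.smul_apply, LinearMap.add_apply,
    LinearMap.smul_apply, LinearMap.smul_apply, lam_eq_fSum, lam_eq_fSum, chiConj_eq_fSum,
    FreeFields.am_fSum_fSum_eq, FreeFields.am_fSum_fSum_eq, dotProduct_comm (star c.α),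
    r.beta_dot_star_alpha j, epsLow_zero_one, epsLow_one_zero] at h2
  simp only [map_zero, smul_zero, Finset.sum_const_zero, neg_zero] at h2
  refine smul_opD_injective (𝒬 := 𝒬) (m := m) ?_
  have e : Complex.I * m * (-Complex.I * conj c.beta) * 1 = m * conj c.beta := by
    linear_combination (-m * conj c.beta) * Complex.I_mul_I
  rw [e] at h2
  linear_combination (norm := module) (-1 / 2 : ℂ) • h2

end SusyRelations

end Coefficients

end Causal

/-! ### Commutators involving d and v. -/

section Causal

variable {H : Type*} [NormedAddCommGroup H] [InnerProductSpace ℂ H] {𝒬 : StateSpace H}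
  {m : ℝ} {s n : ℕ} {F : FreeFields 𝒬 m s n}

open StateSpace

/-- The distribution `(∂_μ ∂_ρ D_m)(x - y) 1`. -/
def opddD (𝒬 : StateSpace H) (m : ℝ) (μ ρ : Fin 4) : TestFn → TestFn → 𝒬.Op :=
  scalarK 𝒬 (kerddD m μ ρ)

lemma opSigmaD_eq_sum (a b : Fin 2) :
    opSigmaD 𝒬 m a b = ∑ μ, pauli μ a b • opdD 𝒬 m μ := by
  simp only [opSigmaD, opdD, kerSigmaD, map_sum, map_smul]

lemma derivLeft_opSigmaD (μ : Fin 4) (a b : Fin 2) :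
    derivLeft 𝒬.Op μ (opSigmaD 𝒬 m a b) = ∑ ν, pauli ν a b • opddD 𝒬 m μ ν := by
  simp only [opSigmaD, opddD, scalarK_derivLeft, kerSigmaD, map_sum, map_smul, derivLeft_kerdD]

/-- Completeness of the Pauli matrices; it identifies the product of two ε's in [v, v] as the metric
term. -/
lemma sum_sum_pauli_mul_metric (a b c d : Fin 2) :
    ∑ μ, ∑ ν, pauli μ c d * (pauli ν a b * (metric μ ν : ℂ)) =
      -2 * epsLow c a * epsLow b d := by
  have h (μ : Fin 4) : ∑ ν, pauli μ c d * (pauli ν a b * (metric μ ν : ℂ)) =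
      pauli μ c d * (pauli μ a b * (metric μ μ : ℂ)) := by
    refine Finset.sum_eq_single μ (fun ν _ hν => ?_) (by simp)
    rw [metric, if_neg (Ne.symm hν)]; simp
  simp only [h, Fin.sum_univ_four]
  fin_cases a <;> fin_cases b <;> fin_cases c <;> fin_cases d <;>
    simp [pauli, metric, epsLow] <;> norm_num

lemma eq_zero_of_sum_sum_pauli_smul {V : Type*} [AddCommGroup V] [Module ℂ V]
    {X : Fin 4 → Fin 4 → V}
    (h : ∀ a b c d, ∑ μ, pauli μ c d • ∑ ν, pauli ν a b • X μ ν = 0) (μ ν : Fin 4) :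
    X μ ν = 0 :=
  eq_zero_of_sum_pauli_smul (X := X μ)
    (fun a b => eq_zero_of_sum_pauli_smul (fun c d => h a b c d) μ) ν

namespace Coefficients.SusyRelations

variable {c : Coefficients s n} {S : Supercharges F}

/-- d is a combination of brackets of charges with λ and λ̄, and the charges are transferred to φ.
Every commutator with d thus becomes an anticommutator of spinors. -/
lemma cm_d_of_isBose (r : c.SusyRelations S) {φ : 𝒬.Field} (h : F.IsBose φ) :
    (8 : ℂ) • cm (c.d F) φ = am (c.lam F 0) (ad (S.R 1) φ) - am (c.lam F 1) (ad (S.R 0) φ) +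
      (am (c.lambar F 0) (ad (S.Rbar 1) φ) - am (c.lambar F 1) (ad (S.Rbar 0) φ)) := by
  have h1 (a : Fin 2) : cm (c.lam F a) φ = 0 := cm_comm_of_eq_zero (h.cm_fSum _ a)
  have h2 (a : Fin 2) : cm (c.lambar F a) φ = 0 := cm_comm_of_eq_zero (h.cm_fbarSum _ a)
  rw [am_ad_right _ (h1 0), am_ad_right _ (h1 1), am_ad_right _ (h2 0), am_ad_right _ (h2 1)]
  have h3 := congrArg (fun X => cm X φ) r.R_lam
  simp only [map_add, map_sub, map_smul, LinearMap.add_apply, LinearMap.sub_apply,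
    LinearMap.smul_apply] at h3
  exact h3.symm

lemma cm_d_C (r : c.SusyRelations S) (j : Fin s) :
    cm (c.d F) (c.C F) = (Complex.I * m * (c.α ⬝ᵥ c.β) / 2) • opD 𝒬 m := by
  have h := r.cm_d_of_isBose c.isBose_C
  have e := r.mul_star_alpha_dot_star_beta j
  simp only [r.R_C, r.Rbar_C, map_neg] at h
  simp only [chi_eq_fSum, chibar_eq_fbarSum, lam_eq_fSum, lambar_eq_fbarSum,
    FreeFields.am_fSum_fSum_eq, FreeFields.am_fbarSum_fbarSum_eq, epsLow_zero_one,
    epsLow_one_zero, dotProduct_comm c.β, dotProduct_comm (star c.β), mul_assoc, e] at h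
  simp only [← mul_assoc, mul_one, mul_neg] at h
  linear_combination (norm := module) (1 / 8 : ℂ) • h

lemma cm_d_phi (r : c.SusyRelations S) (j : Fin s) :
    cm (c.d F) (c.phi F) = ((m : ℂ) ^ 2 * c.beta / 4) • opD 𝒬 m := by
  have h := r.cm_d_of_isBose c.isBose_phi
  have e := congrArg conj (r.beta_dot_beta j)
  have e' : conj (c.β ⬝ᵥ c.β) = star c.β ⬝ᵥ star c.β := by
    rw [Matrix.star_dotProduct_star]; rfl
  simp only [map_mul, map_neg, map_div₀, map_pow, Complex.conj_I, Complex.conj_ofReal,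
    Complex.conj_conj, map_ofNat, e'] at e
  rw [r.ad_R_phi, r.ad_R_phi, r.ad_Rbar_phi, r.ad_Rbar_phi] at h
  simp only [map_zero, map_add, map_neg, map_smul] at h
  simp only [chibarConj_eq_fbarSum, lambar_eq_fbarSum, FreeFields.am_fbarSum_fbarSum_eq,
    epsLow_zero_one, epsLow_one_zero, dotProduct_comm (star c.β) c.α, r.alpha_dot_star_beta j] at h
  linear_combination (norm := skip) (1 / 8 : ℂ) • h
  match_scalars
  · ring
  linear_combination (-1 / 4 : ℂ) * e - (m : ℂ) ^ 2 * c.beta / 8 * Complex.I_mul_I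

lemma cm_d_d (r : c.SusyRelations S) (j : Fin s) :
    cm (c.d F) (c.d F) = (-(Complex.I * m ^ 4 / 16 * c.normSq)) • opD 𝒬 m := by
  have h := r.cm_d_of_isBose c.isBose_d
  have e := r.beta_dot_star_beta j
  simp only [r.ad_R_d, r.ad_Rbar_d, map_smul] at h
  simp only [lamConj_eq_fSum, lambarConj_eq_fbarSum, lam_eq_fSum, lambar_eq_fbarSum,
    FreeFields.am_fSum_fSum_eq, FreeFields.am_fbarSum_fbarSum_eq, epsLow_zero_one,
    epsLow_one_zero, dotProduct_comm (star c.β), e] at h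
  linear_combination (norm := module) (1 / 8 : ℂ) • h

lemma cm_d_slash (r : c.SusyRelations S) (j : Fin s) (a b : Fin 2) :
    cm (c.d F) (slash (c.v F) a b) = 0 := by
  have h := r.cm_d_of_isBose (c.isBose_slash a b)
  have e := r.mul_star_alpha_dot_star_beta j
  have e2 := r.beta_dot_star_beta j
  have k1 (a' b' : Fin 2) : am (c.lam F a') (sigmaDeriv a b (c.chi F b')) =
    (-(Complex.I * m * (c.β ⬝ᵥ c.α) * epsLow a' b')) • opSigmaD 𝒬 m a b :=
      am_sigmaDeriv_right_of_eq S j (FreeFields.am_fSum_fSum_eq _ _ _ _) _ _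
  have k2 (a' b' : Fin 2) : am (c.lambar F a') (sigmaDeriv a b (c.chibar F b')) =
    (- -(Complex.I * m * (star c.β ⬝ᵥ star c.α) * epsLow a' b')) • opSigmaD 𝒬 m a b :=
      am_sigmaDeriv_right_of_eq S j (FreeFields.am_fbarSum_fbarSum_eq _ _ _ _) _ _
  simp only [r.ad_R_slash, r.ad_Rbar_slash, map_sub, map_add, map_smul, k1, k2] at h
  simp only [lambar_eq_fbarSum, lam_eq_fSum, chiConj_eq_fSum, chibarConj_eq_fbarSum,
    FreeFields.am_fSum_fbarSum_eq, FreeFields.am_fbarSum_fSum_eq S j,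
    dotProduct_comm c.β c.α, dotProduct_comm (star c.β) (star c.α), e2] at h
  linear_combination (norm := skip) (1 / 8 : ℂ) • h
  revert a b
  refine Fin.forall_fin_two.2 ⟨Fin.forall_fin_two.2 ⟨?_, ?_⟩, Fin.forall_fin_two.2 ⟨?_, ?_⟩⟩
  all_goals
    intros
    simp only [epsLow_zero_zero, epsLow_zero_one, epsLow_one_zero, epsLow_one_one]
    match_scalars
  all_goals first
    | ring1
    | linear_combination (1 / 8 : ℂ) * e +
        m / 4 * (c.α ⬝ᵥ c.β - star c.α ⬝ᵥ star c.β) * Complex.I_mul_I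

/-- One factor v is replaced by {Rbar, χ} plus a derivative of C, which commutes with v.
Transferring Rbar leaves {[Rbar, v], χ}; its derivative term is the source of ∂∂D_m. -/
lemma cm_slash_slash (r : c.SusyRelations S) (j : Fin s) (a b a' b' : Fin 2) :
    cm (slash (c.v F) a' b') (slash (c.v F) a b) =
      ((Complex.I * (m ^ 2 / 2 * c.normSq + m * (c.α ⬝ᵥ c.β))) *
        (-2 * epsLow a' a * epsLow b b')) • opD 𝒬 m +
      (Complex.I * c.normSq) • ∑ μ, pauli μ a' b' • ∑ ν, pauli ν a b • opddD 𝒬 m μ ν := by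
  have h := am_ad_left (S.Rbar b) (show cm (slash (c.v F) a' b') (c.chi F a) = 0 from
    (c.isBose_slash a' b').cm_fSum _ a)
  have h0 : cm (slash (c.v F) a' b') (sigmaDeriv a b (c.C F)) = 0 := by
    rw [cm_sigmaDeriv_right, cm_comm_of_eq_zero (r.cm_C_slash j a' b')]
    simp only [map_zero, smul_zero, Finset.sum_const_zero]
  have h1 : am (sigmaDeriv a' b' (c.chibar F b)) (c.chi F a) =
      c.normSq • ∑ μ, pauli μ a' b' • ∑ ν, pauli ν a b • opddD 𝒬 m μ ν := by
    rw [am_sigmaDeriv_left, chi_eq_fSum, chibar_eq_fbarSum, FreeFields.am_fbarSum_fSum_eq S j,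
      r.alpha_dot_star_alpha j, Finset.smul_sum]
    refine Finset.sum_congr rfl fun μ _ => ?_
    rw [map_smul, derivLeft_opSigmaD, smul_comm]
  rw [r.ad_Rbar_slash, r.aad_Rbar_chi, map_sub (cm _), map_smul (cm _), h0, smul_zero, sub_zero,
    map_sub, map_smul, map_add, map_smul, map_smul, map_smul, LinearMap.sub_apply,
    LinearMap.smul_apply, LinearMap.add_apply, LinearMap.smul_apply, LinearMap.smul_apply,
    LinearMap.smul_apply, h1, chi_eq_fSum, chiConj_eq_fSum, lam_eq_fSum,
    FreeFields.am_fSum_fSum_eq, FreeFields.am_fSum_fSum_eq, dotProduct_comm c.β,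
    dotProduct_comm (star c.α), r.alpha_dot_star_alpha j] at h
  linear_combination (norm := module) h

lemma cm_v_v (r : c.SusyRelations S) (j : Fin s) (μ ν : Fin 4) :
    cm (c.v F μ) (c.v F ν) = (Complex.I * c.normSq) • opddD 𝒬 m μ ν +
      (Complex.I * (m ^ 2 / 2 * c.normSq + m * (c.α ⬝ᵥ c.β)) * (metric μ ν : ℂ)) • opD 𝒬 m := by
  rw [← sub_eq_zero]
  refine eq_zero_of_sum_sum_pauli_smul (X := fun μ ν => cm (c.v F μ) (c.v F ν) -
    ((Complex.I * c.normSq) • opddD 𝒬 m μ ν + (Complex.I * (m ^ 2 / 2 * c.normSq +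
      m * (c.α ⬝ᵥ c.β)) * (metric μ ν : ℂ)) • opD 𝒬 m)) (fun a b a' b' => ?_) μ ν
  have h := r.cm_slash_slash j a b a' b'
  rw [← sum_sum_pauli_mul_metric, cm_slash_left] at h
  simp only [cm_slash_right] at h
  simp only [smul_sub, smul_add, Finset.sum_sub_distrib, Finset.sum_add_distrib, h]
  simp only [Finset.smul_sum, Finset.sum_smul, Finset.mul_sum, smul_smul]
  rw [sub_eq_zero, add_comm]
  congr 1 <;>
  · refine Finset.sum_congr rfl fun μ _ => Finset.sum_congr rfl fun ν _ => ?_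
    congr 1
    ring

lemma cm_v_of_cm_slash {φ : 𝒬.Field} {z : ℂ}
    (h : ∀ a b, cm φ (slash (c.v F) a b) = z • opSigmaD 𝒬 m a b) (μ : Fin 4) :
    cm φ (c.v F μ) = z • opdD 𝒬 m μ := by
  rw [← sub_eq_zero]
  refine eq_zero_of_sum_pauli_smul (X := fun μ => cm φ (c.v F μ) - z • opdD 𝒬 m μ)
    (fun a b => ?_) μ
  have h' := h a b
  rw [cm_slash_right, opSigmaD_eq_sum, Finset.smul_sum] at h'
  simp only [smul_sub, Finset.sum_sub_distrib, h']
  rw [sub_eq_zero]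
  exact Finset.sum_congr rfl fun μ _ => smul_comm _ _ _

end Coefficients.SusyRelations

end Causal

/-! ### Inequalities for the parameters. -/

section Parameters

lemma re_dotProduct {n : ℕ} (z w : Fin n → ℂ) :
    (z ⬝ᵥ w).re = ∑ A, (z A).re * (w A).re - ∑ A, (z A).im * (w A).im := by
  simp only [dotProduct, Complex.re_sum, Complex.mul_re, Finset.sum_sub_distrib]

lemma re_dotProduct_star {n : ℕ} (z w : Fin n → ℂ) :
    (z ⬝ᵥ star w).re = ∑ A, (z A).re * (w A).re + ∑ A, (z A).im * (w A).im := by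
  rw [re_dotProduct]
  simp

/-- Cauchy–Schwarz for vectors whose lengths have ratio t, from ∑ (t p ∓ r)² ≥ 0. -/
lemma abs_sum_mul_le_of_sum_sq_eq {n : ℕ} {p r : Fin n → ℝ} {t : ℝ} (ht : 0 < t)
    (h : ∑ A, r A * r A = t ^ 2 * ∑ A, p A * p A) : |∑ A, p A * r A| ≤ t * ∑ A, p A * p A := by
  have key (u : ℝ) (hu : u ^ 2 = 1) : u * ∑ A, p A * r A ≤ t * ∑ A, p A * p A := by
    have h0 : 0 ≤ ∑ A, (t * p A - u * r A) ^ 2 := Finset.sum_nonneg fun A _ => sq_nonneg _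
    have h1 : ∑ A, (t * p A - u * r A) ^ 2 =
        t ^ 2 * ∑ A, p A * p A - 2 * t * u * ∑ A, p A * r A + u ^ 2 * ∑ A, r A * r A := by
      simp only [Finset.mul_sum, ← Finset.sum_sub_distrib, ← Finset.sum_add_distrib]
      exact Finset.sum_congr rfl fun A _ => by ring
    rw [h1, hu, h] at h0
    refine le_of_mul_le_mul_left ?_ ht
    linarith
  refine abs_le.2 ⟨?_, ?_⟩
  · linarith [key (-1) (by norm_num)]
  · linarith [key 1 (by norm_num)]

/-- The constraints on two complex vectors `z`, `w` prescribed by all their bilinear and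
sesquilinear products. -/
lemma bounds_of_dotProduct {n : ℕ} {z w : Fin n → ℂ} {m a : ℝ} {b : ℂ} (hm : 0 < m)
    (hzz : Complex.I * m * (z ⬝ᵥ z) = 2 * b) (hzz' : z ⬝ᵥ star z = 1)
    (hww : Complex.I * m * (w ⬝ᵥ w) = -((m : ℂ) ^ 2 * conj b / 2))
    (hww' : w ⬝ᵥ star w = (m : ℂ) ^ 2 / 4) (hzw : (m : ℂ) * (z ⬝ᵥ w) = -2 * a)
    (hzw' : z ⬝ᵥ star w = Complex.I * b) :
    |a| ≤ m ^ 2 / 4 ∧ ‖b‖ ≤ m / 2 ∧ |b.im| ≤ m / 4 + a / m := by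
  have e1 := congrArg Complex.im hzz
  have e2 := congrArg Complex.re hzz'
  have e3 := congrArg Complex.im hww
  have e4 := congrArg Complex.re hww'
  have e5 := congrArg Complex.re hzw
  have e6 := congrArg Complex.re hzw'
  rw [mul_assoc, Complex.I_mul_im, Complex.re_ofReal_mul, re_dotProduct] at e1
  rw [re_dotProduct_star, Complex.one_re] at e2
  rw [mul_assoc, Complex.I_mul_im, Complex.re_ofReal_mul, re_dotProduct] at e3
  rw [re_dotProduct_star] at e4
  rw [Complex.re_ofReal_mul, re_dotProduct] at e5
  rw [re_dotProduct_star, Complex.I_mul_re] at e6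
  have f1 : (2 * b).im = 2 * b.im := by simp
  have f3 : (-((m : ℂ) ^ 2 * conj b / 2)).im = m ^ 2 / 2 * b.im := by
    rw [show -((m : ℂ) ^ 2 * conj b / 2) = ((-(m ^ 2 / 2) : ℝ) : ℂ) * conj b by push_cast; ring,
      Complex.im_ofReal_mul, Complex.conj_im]
    ring
  have f4 : ((m : ℂ) ^ 2 / 4).re = m ^ 2 / 4 := by
    rw [show (m : ℂ) ^ 2 / 4 = ((m ^ 2 / 4 : ℝ) : ℂ) by push_cast; ring, Complex.ofReal_re]
  have f5 : (-2 * (a : ℂ)).re = -2 * a := by simp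
  rw [f1] at e1
  rw [f3, show m ^ 2 / 2 * b.im = m * (m / 2 * b.im) by ring] at e3
  rw [f4] at e4
  rw [f5] at e5
  have e3' := mul_left_cancel₀ hm.ne' e3
  -- Adding the equations for w·w̄ and w·w isolates |Re w|², and those for z isolate |Re z|²; the
  -- ratio is (m/2)². Subtracting them does the same for the imaginary parts.
  have hp := abs_le.1 (abs_sum_mul_le_of_sum_sq_eq (p := fun A => (z A).re)
    (r := fun A => (w A).re) (half_pos hm) (by
      refine mul_left_cancel₀ two_ne_zero ?_
      linear_combination e4 + e3' - m ^ 2 / 4 * e2 - m / 4 * e1))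
  have hq := abs_le.1 (abs_sum_mul_le_of_sum_sq_eq (p := fun A => (z A).im)
    (r := fun A => (w A).im) (half_pos hm) (by
      refine mul_left_cancel₀ two_ne_zero ?_
      linear_combination e4 - e3' - m ^ 2 / 4 * e2 + m / 4 * e1))
  have ha : a / m * m = a := div_mul_cancel₀ a hm.ne'
  have e5' : ∑ A, (z A).re * (w A).re - ∑ A, (z A).im * (w A).im = -2 * (a / m) := by
    refine mul_left_cancel₀ hm.ne' ?_
    linear_combination e5 + 2 * ha
  have g1 : m * ∑ A, (z A).re * (z A).re = m / 2 + b.im := by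
    linear_combination m / 2 * e2 + 1 / 2 * e1
  have g2 : m * ∑ A, (z A).im * (z A).im = m / 2 - b.im := by
    linear_combination m / 2 * e2 - 1 / 2 * e1
  -- By `e5'` and `e6`, Re z·Re w = -Im b/2 - a/m and Im z·Im w = -Im b/2 + a/m. By `hp`, `hq`,
  -- `g1`, `g2` their absolute values are at most m/4 + Im b/2 and m/4 - Im b/2. This bound and the
  -- one on Im b are combinations of these inequalities.
  have h1 : |a / m| ≤ m / 4 := abs_le.2 ⟨by linarith, by linarith⟩
  refine ⟨?_, ?_, abs_le.2 ⟨by linarith, by linarith⟩⟩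
  · rw [← ha, abs_mul, abs_of_pos hm]
    calc _ ≤ m / 4 * m := mul_le_mul_of_nonneg_right h1 hm.le
      _ = _ := by ring
  · have h2 : ‖z ⬝ᵥ z‖ ≤ 1 := by
      rw [← e2]
      refine (norm_sum_le _ _).trans_eq ?_
      rw [← Finset.sum_add_distrib]
      refine Finset.sum_congr rfl fun A _ => ?_
      rw [norm_mul, ← Complex.normSq_apply, Complex.normSq_eq_norm_sq, sq]
    have h3 := congrArg norm hzz
    rw [norm_mul, norm_mul, norm_mul, Complex.norm_I, Complex.norm_real, Real.norm_eq_abs,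
      abs_of_pos hm, Complex.norm_ofNat, one_mul] at h3
    nlinarith

end Parameters

/-! ### Assembly of the causal relations. -/

section Main

variable {H : Type*} [NormedAddCommGroup H] [InnerProductSpace ℂ H] {𝒬 : StateSpace H}
  {m : ℝ} {s n : ℕ} {F : FreeFields 𝒬 m s n}

open StateSpace

namespace Coefficients.SusyRelations

variable {c : Coefficients s n} {S : Supercharges F}

-- Here β·β̄ = 0 is the vanishing of the standard positive definite norm on ℂⁿ.
open scoped ComplexOrder in
lemma lam_eq_zero_of_mass_eq_zero (r : c.SusyRelations S) (j : Fin s) (hm : m = 0) (a : Fin 2) :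
    c.lam F a = 0 := by
  have h := r.beta_dot_star_beta j
  rw [hm, Complex.ofReal_zero, zero_pow two_ne_zero, zero_div, zero_mul,
    dotProduct_self_star_eq_zero] at h
  simp only [lam, h, Pi.zero_apply, zero_smul, Finset.sum_const_zero]

/-- Exhibits the real parameter α of the theorem: m α·β is real, and α is defined as -1/2 times it.
-/
lemma mul_alpha_dot_beta (r : c.SusyRelations S) (j : Fin s) :
    (m : ℂ) * (c.α ⬝ᵥ c.β) = -2 * ((-(m / 2 * (c.α ⬝ᵥ c.β).re) : ℝ) : ℂ) := by
  have h := r.mul_star_alpha_dot_star_beta j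
  rw [Matrix.star_dotProduct_star, dotProduct_comm] at h
  have h1 := Complex.add_conj (c.α ⬝ᵥ c.β)
  rw [starRingEnd_apply] at h1
  push_cast at h1 ⊢
  linear_combination (m / 2 : ℂ) * h1 - (1 / 2 : ℂ) * h

theorem causalRelations (r : c.SusyRelations S) (j : Fin s) (hN : c.normSq = 1) {a : ℝ}
    (ha : (m : ℂ) * (c.α ⬝ᵥ c.β) = -2 * a) : c.CausalRelations F a c.beta where
  C_C := by
    rw [comm_smul_kerD, c.cm_C_C, hN, mul_one]
  C_d := by
    rw [comm_smul_kerD, cm_comm_of_eq F j (r.cm_d_C j), mul_assoc, ha]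
    congr 1; ring
  C_phi := by rw [comm_smul_kerD, c.cm_C_phi]
  phi_phidag := by
    rw [comm_smul_kerD, r.cm_phi_phidag j, hN]
    congr 1; linear_combination (Complex.I / 2) * ha
  phi_d := by rw [comm_smul_kerD, cm_comm_of_eq F j (r.cm_d_phi j)]
  phi_v μ := by
    rw [comm_iff, map_smul]
    exact cm_v_of_cm_slash (r.cm_phi_slash j) μ
  d_d := by rw [comm_smul_kerD, r.cm_d_d j, hN, mul_one]
  v_v μ ρ := by
    rw [comm_iff, map_add, map_smul, map_smul, r.cm_v_v j, ha, hN, mul_one, mul_one, opddD, opD]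
    congr 2; ring
  chi_chi a b := by rw [anticomm_smul_kerD, r.am_chi_chi]
  chi_chibar a b := by
    rw [anticomm_iff, chi_eq_fSum, chibar_eq_fbarSum, FreeFields.am_fSum_fbarSum_eq,
      r.alpha_dot_star_alpha j, hN, one_smul, opSigmaD]
  lam_lam a b := by
    rw [anticomm_smul_kerD, lam_eq_fSum, lam_eq_fSum, FreeFields.am_fSum_fSum_eq,
      r.beta_dot_beta j]
  lam_lambar a b := by
    rw [anticomm_smul_kerSigmaD, lam_eq_fSum, lambar_eq_fbarSum, FreeFields.am_fSum_fbarSum_eq,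
      r.beta_dot_star_beta j, hN, mul_one]
  chi_lam a b := by
    rw [anticomm_smul_kerD, chi_eq_fSum, lam_eq_fSum, FreeFields.am_fSum_fSum_eq]
    congr 1; linear_combination Complex.I * epsLow a b * ha
  chi_lambar a b := by rw [anticomm_smul_kerSigmaD, r.am_chi_lambar j]
  C_v μ := by
    rw [comm_iff, map_zero]
    exact eq_zero_of_sum_pauli_smul
      (fun a b => (cm_slash_right _ _ a b).symm.trans (r.cm_C_slash j a b)) μ
  phi_phi := by rw [comm_iff, map_zero, r.cm_phi_phi]
  d_v μ := by
    rw [comm_iff, map_zero]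
    exact eq_zero_of_sum_pauli_smul
      (fun a b => (cm_slash_right _ _ a b).symm.trans (r.cm_d_slash j a b)) μ
  bose_fermi := c.bose_fermi

end Coefficients.SusyRelations

end Main

end SuperVector

end

theorem mainTheorem1 {H : Type*} [NormedAddCommGroup H] [InnerProductSpace ℂ H] [CompleteSpace H]
    (𝒬 : SuperVector.StateSpace H) (m : ℝ) (hm : 0 ≤ m) (s n : ℕ)
    (F : SuperVector.FreeFields 𝒬 m s n) (S : SuperVector.Supercharges F)
    (c : SuperVector.Coefficients s n) (hγ : c.γ ≠ 0)
    (hV : ∀ h : SuperVector.TestFn, SuperVector.superfield S (c.C F) h = c.expansion F h) :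
    (m = 0 → (∀ a b, SuperVector.StateSpace.Anticomm (c.lam F a) (c.lambar F b) 0) ∧
      ∀ a, c.lam F a = 0) ∧
    (c.lam F ≠ 0 → 0 < m) ∧
    (0 < m → ∑ j, c.γ j ^ 2 = 1 →
      ∃ (α : ℝ) (β : ℂ), c.CausalRelations F α β ∧
        |α| ≤ m ^ 2 / 4 ∧ ‖β‖ ≤ m / 2 ∧ |β.im| ≤ m / 4 + α / m) := by
  -- Only the existence of a scalar field is kept; it supplies the symmetry properties of D_m.
  obtain ⟨j, -⟩ := Function.ne_iff.1 hγ
  have r := c.susyRelations S hV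
  have h0 (h : m = 0) (a : Fin 2) : c.lam F a = 0 := r.lam_eq_zero_of_mass_eq_zero j h a
  refine ⟨fun h => ⟨fun a b => ?_, h0 h⟩, fun h => ?_, fun hm' hN => ?_⟩
  · rw [SuperVector.anticomm_iff, h0 h, map_zero, map_zero, LinearMap.zero_apply]
  · exact hm.lt_of_ne fun h' => h (funext (h0 h'.symm))
  · have hN' : c.normSq = 1 := by
      rw [SuperVector.Coefficients.normSq]
      exact_mod_cast hN
    refine ⟨_, c.beta, r.causalRelations j hN' (r.mul_alpha_dot_beta j),
      SuperVector.bounds_of_dotProduct hm' r.alpha_dot_alpha ?_ (r.beta_dot_beta j) ?_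
        (r.mul_alpha_dot_beta j) (r.alpha_dot_star_beta j)⟩
    · rw [r.alpha_dot_star_alpha j, hN']
    · rw [r.beta_dot_star_beta j, hN', mul_one]
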